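/- Let $m\ge 2$ and $l$ be coprime natural numbers, $\gamma=\pi l/m$, $\Delta=\cos\gamma$. On $n$ spins $1/2$ let $H_n=\sum_{x=1}^{n-1}\big[2(\sigma^+_x\sigma^-_{x+1}+\sigma^-_x\sigma^+_{x+1})+\Delta\,\sigma^z_x\sigma^z_{x+1}\big]$ be the open XXZ Hamiltonian, $J_n=4\mathrm i\sum_{x=1}^{n-1}(\sigma^+_x\sigma^-_{x+1}-\sigma^-_x\sigma^+_{x+1})$ the spin current, $\tau_t(A)=e^{\mathrm itH_n}Ae^{-\mathrm itH_n}$, $\langle A\rangle_\beta=\operatorname{tr}(Ae^{-\beta H_n})/\operatorname{tr}e^{-\beta H_n}$, $\omega(A)=2^{-n}\operatorname{tr}A$ and $(A,B)=\omega(A^\dagger B)$. Let the auxiliary space have the basis $|\mathrm L\rangle,|\mathrm R\rangle,|1\rangle,|2\rangle,\dots$, put $[x]_q=\sin(\gamma x)/\sin\gamma$, $s^z=-\sum_{k\ge1}k|k\rangle\langle k|$, $s^+=\sum_{k\ge1}[k+1]_q|k\rangle\langle k+1|$, $s^-=\sum_{k\ge1}[-k]_q|k+1\rangle\langle k|$,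 and $L^0=|\mathrm L\rangle\langle \mathrm L|+|\mathrm R\rangle\langle \mathrm R|+\cos(\gamma s^z)$ (the cosine acting on the span of the $|k\rangle$), $L^z=\cot\varphi\,\sin(\gamma s^z)$, $L^+=|1\rangle\langle \mathrm R|+\frac{\sin\gamma}{\sin\varphi}s^-$, $L^-=|\mathrm L\rangle\langle 1|+\frac{\sin\gamma}{\sin\varphi}s^+$. The charges are $$Z_n(\varphi)=\sum_{\alpha_1,\dots,\alpha_n\in\{0,+,-,z\}}\langle \mathrm L|L^{\alpha_1}\cdots L^{\alpha_n}|\mathrm R\rangle\,\sigma^{\alpha_1}\otimes\cdots\otimes\sigma^{\alpha_n},\qquad \varphi\in\mathcal D_m=\{\varphi\in\mathbb C:|\operatorname{Re}\varphi-\tfrac{\pi}{2}|<\tfrac{\pi}{2m}\}.$$ Then the following hold. 1. For all $\varphi,\varphi'\in\mathcal D_m$ and $n\ge1$: $(J_n,Z_n(\varphi))=\mathrm i(n-1)$, and $\lim_{n\to\infty}\frac1n(Z_n(\overline\varphi),Z_n(\varphi'))=K(\varphi,\varphi')$, where $$K(\varphi,\varphi')=-\frac{\sin\varphi\,\sin\varphi'}{2\sin^2(\pi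 l/m)}\,\frac{\sin((m-1)(\varphi+\varphi'))}{\sin(m(\varphi+\varphi'))},$$ the last quotient being continued by $-(m-1)/m$ at $\varphi+\varphi'=\pi$. 2. There is a constant $c>0$ such that $f(\varphi)=c/|\sin\varphi|^4$ is integrable on $\mathcal D_m$ and solves the Fredholm equation of the first kind $\int_{\mathcal D_m}K(\varphi,\varphi')f(\varphi')\,d^2\varphi'=1$ for all $\varphi\in\mathcal D_m$ (with absolutely convergent integrals; $d^2\varphi$ is the area measure), and $$\frac14\int_{\mathcal D_m}f(\varphi)\,d^2\varphi=D_K:=\frac{\sin^2(\pi l/m)}{\sin^2(\pi/m)}\left(1-\frac{m}{2\pi}\sin\frac{2\pi}{m}\right).$$ 3. The limit $C(s)=\lim_{n\to\infty}\frac1n\,\omega(J_n\tau_s(J_n))$ exists for every $s\in\mathbb R$ and is real and continuous in $s$, and the high-temperature Drude weight (the coefficient of order $\beta$ of the thermal Drude weight $D^{\rm th}_\beta$) $$\lim_{\beta\to0}\frac{D^{\rm th}_\beta}{\beta}:=\lim_{t\to\infty}\frac1{2t}\int_0^tC(s)\,ds=\lim_{t\to\infty}\lim_{n\to\infty}\lim_{\beta\to0^+}\frac1\beta\cdot\frac{\beta}{4nt}\int_{-t}^{t}\langle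 J_n\,\tau_s(J_n)\rangle_\beta\,ds$$ exists (all the limits exist) and satisfies $$\lim_{\beta\to0}\frac{D^{\rm th}_\beta}{\beta}\;\ge\;\int_{\mathcal D_m}f(\varphi)\,d^2\varphi=4D_K,\qquad\text{in particular}\qquad \lim_{\beta\to0}\frac{D^{\rm th}_\beta}{\beta}\ge\frac{D_K}{4}.$$ -/

import Mathlib

open Filter Topology MeasureTheory

namespace XXZ

noncomputable section

/-! ### Operators on a chain of `n` spins one half -/

/-- Operators on `(ℂ²)^{⊗ n}`, as matrices in the computational basis `Fin n → Fin 2`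
(`0` is spin up, `1` is spin down). -/
abbrev ChainOp (n : ℕ) : Type := Matrix (Fin n → Fin 2) (Fin n → Fin 2) ℂ

/-- The labels of the one-site operators `σ⁰ = 1, σ⁺, σ⁻, σᶻ`. -/
inductive SpinLabel
  | zero
  | plus
  | minus
  | z
  deriving DecidableEq

instance : Fintype SpinLabel where
  elems := {SpinLabel.zero, SpinLabel.plus, SpinLabel.minus, SpinLabel.z}
  complete := by intro α; cases α <;> simp

/-- The one-site operators `σ⁰ = 1`, `σ^± = (σˣ ± i σʸ)/2`, `σᶻ`. -/
def pauli : SpinLabel → Matrix (Fin 2) (Fin 2) ℂ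
  | SpinLabel.zero => 1
  | SpinLabel.plus => !![0, 1; 0, 0]
  | SpinLabel.minus => !![0, 0; 1, 0]
  | SpinLabel.z => !![1, 0; 0, -1]

/-- The tensor product `a 0 ⊗ a 1 ⊗ ⋯ ⊗ a (n - 1)`. -/
def tensor {n : ℕ} (a : Fin n → Matrix (Fin 2) (Fin 2) ℂ) : ChainOp n :=
  Matrix.of fun σ τ => ∏ x, a x (σ x) (τ x)

/-- The operator `σ^α` at site `x` (sites are numbered `0, …, n - 1`). -/
def siteOp (n x : ℕ) (α : SpinLabel) : ChainOp n :=
  tensor fun y : Fin n => if (y : ℕ) = x then pauli α else 1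

/-- The Hamiltonian of the open anisotropic Heisenberg chain,
`H_n = ∑ₓ 2 (σ⁺ₓ σ⁻ₓ₊₁ + σ⁻ₓ σ⁺ₓ₊₁) + Δ σᶻₓ σᶻₓ₊₁`. -/
def hamiltonian (Δ : ℝ) (n : ℕ) : ChainOp n :=
  ∑ x ∈ Finset.range (n - 1),
    ((2 : ℂ) • (siteOp n x .plus * siteOp n (x + 1) .minus
        + siteOp n x .minus * siteOp n (x + 1) .plus)
      + (Δ : ℂ) • (siteOp n x .z * siteOp n (x + 1) .z))

/-- The extensive spin current `J_n = ∑ₓ jₓ`, `j = 4 i (σ⁺ ⊗ σ⁻ - σ⁻ ⊗ σ⁺)`. -/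
def current (n : ℕ) : ChainOp n :=
  ∑ x ∈ Finset.range (n - 1),
    (4 * Complex.I) • (siteOp n x .plus * siteOp n (x + 1) .minus
      - siteOp n x .minus * siteOp n (x + 1) .plus)

/-- Heisenberg evolution `τ_t(A) = exp(i t H) A exp(-i t H)`. -/
def evolve (Δ : ℝ) (n : ℕ) (t : ℝ) (A : ChainOp n) : ChainOp n :=
  NormedSpace.exp ((Complex.I * (t : ℂ)) • hamiltonian Δ n) * A *
    NormedSpace.exp (-((Complex.I * (t : ℂ)) • hamiltonian Δ n))

/-- The Gibbs expectation `⟨A⟩_β = tr(A exp(-β H)) / tr(exp(-β H))` of the chain. -/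
def gibbs (Δ β : ℝ) (n : ℕ) (A : ChainOp n) : ℂ :=
  (A * NormedSpace.exp (-((β : ℂ) • hamiltonian Δ n))).trace /
    (NormedSpace.exp (-((β : ℂ) • hamiltonian Δ n))).trace

/-- The normalized trace (infinite temperature state) `ω(A) = 2⁻ⁿ tr A`. -/
def tracial (n : ℕ) (A : ChainOp n) : ℂ := A.trace / 2 ^ n

/-- The weighted Hilbert-Schmidt inner product `(A, B) = 2⁻ⁿ tr(A† B)`. -/
def hsInner (n : ℕ) (A B : ChainOp n) : ℂ := tracial n (A.conjTranspose * B)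

/-! ### The thermal spin Drude weight -/

/-- The thermal Drude weight before its limits,
`D^th_β(t, n) = β / (4 n t) ∫_{-t}^{t} ⟨J_n(0) J_n(s)⟩_β ds`. -/
def thermalDrude (Δ β t : ℝ) (n : ℕ) : ℂ :=
  ((β / (4 * n * t) : ℝ) : ℂ) *
    ∫ s in (-t)..t, gibbs Δ β n (current n * evolve Δ n s (current n))

/-- `D` is the coefficient of order `β` of the thermal Drude weight at high temperature:
`D = lim_{t → ∞} lim_{n → ∞} lim_{β → 0⁺} D^th_β(t, n) / β`, all the limits existing. -/
def IsThermalDrudeRate (Δ D : ℝ) : Prop :=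
  ∃ (d : ℝ → ℕ → ℂ) (e : ℝ → ℂ),
    (∀ t : ℝ, 0 < t → ∀ n : ℕ,
      Tendsto (fun β : ℝ => thermalDrude Δ β t n / (β : ℂ)) (𝓝[>] 0) (𝓝 (d t n))) ∧
    (∀ t : ℝ, 0 < t → Tendsto (d t) atTop (𝓝 (e t))) ∧
    Tendsto e atTop (𝓝 (D : ℂ))

/-- `C` is the current autocorrelation function of the infinite chain in the tracial state,
`C(s) = lim_{n → ∞} ω(J_n τ_s(J_n)) / n`. -/
def IsCurrentCorrelation (Δ : ℝ) (C : ℝ → ℝ) : Prop :=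
  Continuous C ∧ ∀ s : ℝ,
    Tendsto (fun n : ℕ => tracial n (current n * evolve Δ n s (current n)) / (n : ℂ))
      atTop (𝓝 (C s : ℂ))

/-! ### The charges `Z_n(φ)` -/

/-- The `q`-number `[x]_q = sin(γ x) / sin γ`, `q = exp(i γ)`. -/
def qNumber (γ x : ℝ) : ℝ := Real.sin (γ * x) / Real.sin γ

/-- Labels of the orthonormal basis `|L⟩, |R⟩, |1⟩, |2⟩, …` of the auxiliary space;
`level k` stands for `|k + 1⟩`. -/
inductive AuxLabel
  | left
  | right
  | level (k : ℕ)

/-- The auxiliary space, finite linear combinations of the basis. -/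
abbrev Aux : Type := AuxLabel →₀ ℂ

/-- The basis vector with a given label. -/
def ket (a : AuxLabel) : Aux := Finsupp.single a 1

/-- The components of the modified Lax operator on basis vectors. With the spin-zero generators
`s^z = -∑ k |k⟩⟨k|`, `s⁺ = ∑ [k+1]_q |k⟩⟨k+1|`, `s⁻ = ∑ [-k]_q |k+1⟩⟨k|` (sums over `k ≥ 1`),
they are
`L⁰ = |L⟩⟨L| + |R⟩⟨R| + cos(γ s^z)`, `Lᶻ = cot φ sin(γ s^z)`,
`L⁺ = |1⟩⟨R| + (sin γ / sin φ) s⁻`, `L⁻ = |L⟩⟨1| + (sin γ / sin φ) s⁺`. -/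
def laxOnBasis (γ : ℝ) (φ : ℂ) : SpinLabel → AuxLabel → Aux
  | .zero, .left => ket .left
  | .zero, .right => ket .right
  | .zero, .level k => (Real.cos (γ * -(k + 1 : ℝ)) : ℂ) • ket (.level k)
  | .z, .left => 0
  | .z, .right => 0
  | .z, .level k =>
      (Complex.cos φ / Complex.sin φ * (Real.sin (γ * -(k + 1 : ℝ)) : ℂ)) • ket (.level k)
  | .plus, .left => 0
  | .plus, .right => ket (.level 0)
  | .plus, .level k =>
      ((Real.sin γ : ℂ) / Complex.sin φ * (qNumber γ (-(k + 1 : ℝ)) : ℂ)) • ket (.level (k + 1))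
  | .minus, .left => 0
  | .minus, .right => 0
  | .minus, .level 0 => ket .left
  | .minus, .level (k + 1) =>
      ((Real.sin γ : ℂ) / Complex.sin φ * (qNumber γ (k + 2 : ℝ) : ℂ)) • ket (.level k)

/-- The components of the modified Lax operator, as operators on the auxiliary space. -/
def lax (γ : ℝ) (φ : ℂ) (α : SpinLabel) : Module.End ℂ Aux :=
  Finsupp.linearCombination ℂ (laxOnBasis γ φ α)

/-- The charge `Z_n(φ) = ⟨L| 𝐋(φ)^{⊗ n} |R⟩
= ∑_{α₁ … α_n} ⟨L| L^{α₁}(φ) ⋯ L^{α_n}(φ) |R⟩ σ^{α₁} ⊗ ⋯ ⊗ σ^{α_n}`. -/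
def charge (γ : ℝ) (n : ℕ) (φ : ℂ) : ChainOp n :=
  ∑ α : Fin n → SpinLabel,
    ((List.ofFn fun x => lax γ φ (α x)).prod (ket .right) .left) •
      tensor fun x => pauli (α x)

/-- The overlaps `K_n(φ, φ') = (Z_n(conj φ), Z_n(φ'))`. -/
def overlap (γ : ℝ) (n : ℕ) (φ φ' : ℂ) : ℂ :=
  hsInner n (charge γ n (starRingEnd ℂ φ)) (charge γ n φ')

/-! ### The kernel, the integration domain and the bound -/

/-- The open strip `𝒟_m = {φ : |Re φ - π/2| < π/(2m)}`. -/
def strip (m : ℕ) : Set ℂ := {φ | |φ.re - Real.pi / 2| < Real.pi / (2 * m)}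

/-- The kernel
`K(φ, φ') = - sin φ sin φ' / (2 sin²(πl/m)) · sin((m-1)(φ+φ')) / sin(m(φ+φ'))`.
For `φ, φ' ∈ 𝒟_m` the denominator vanishes only at `φ + φ' = π`, where the singularity of the last
quotient is removable with value `-(m-1)/m`. -/
def kernel (l m : ℕ) (φ φ' : ℂ) : ℂ :=
  -(Complex.sin φ * Complex.sin φ') / (2 * (Real.sin (Real.pi * l / m) : ℂ) ^ 2) *
    open Classical in
    if φ + φ' = (Real.pi : ℂ) then -((m : ℂ) - 1) / m
    else Complex.sin (((m : ℂ) - 1) * (φ + φ')) / Complex.sin ((m : ℂ) * (φ + φ'))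

/-- The weight `f(φ) = c / |sin φ|⁴`. -/
def weight (c : ℝ) (φ : ℂ) : ℝ := c / ‖Complex.sin φ‖ ^ 4

/-- `f` solves the Fredholm equation of the first kind
`∫_{𝒟_m} K(φ, φ') f(φ') d²φ' = 1` for all `φ ∈ 𝒟_m`, the integrals being absolutely convergent. -/
def SolvesFredholm (l m : ℕ) (f : ℂ → ℝ) : Prop :=
  ∀ φ ∈ strip m,
    IntegrableOn (fun φ' : ℂ => kernel l m φ φ' * (f φ' : ℂ)) (strip m) ∧
      ∫ φ' in strip m, kernel l m φ φ' * (f φ' : ℂ) = 1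

/-- The closed form
`D_K = sin²(πl/m) / sin²(π/m) · (1 - m/(2π) sin(2π/m))`. -/
def drudeBound (l m : ℕ) : ℝ :=
  Real.sin (Real.pi * l / m) ^ 2 / Real.sin (Real.pi / m) ^ 2 *
    (1 - m / (2 * Real.pi) * Real.sin (2 * Real.pi / m))

end

end XXZ

namespace XXZ

noncomputable section

/-! ### Tensor products, traces and the Hilbert-Schmidt form -/

section Tensor

variable {n : ℕ}

/-! The result is a Mazur bound for a continuous family of almost conserved charges, and the
Fredholm equation selects the combination of charges that is used.

Overlaps. Pauli strings are orthogonal and every coordinate of a Lax image depends on one coordinate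
only, so overlaps of charges obey a tridiagonal recursion on the levels (`levelGram_succ`). At γ =
πl/m the coupling sin²(γm) vanishes and only the levels 1, …, m-1 matter. In the ℓ¹ norm with
weights sin(πk/m) the recursion contracts for parameters in the strip (`transfer_column_le`,
`gap_pos`). Its fixed point is a quotient of Chebyshev polynomials, which yields the kernel
(`tendsto_overlap_div`). The same contraction bounds the norm of a charge by √n times an inverse
square root of the gap.

Integrals. Since |sin z|⁴ = sin² z · sin² z̄ and 1/sin² z̄ is a ∂̄-derivative of -cot z̄ up to a
constant, Green's formula on the strip evaluates everything. Conjugation maps one edge to π minus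
the other, so a correction can make the edge terms cancel and only the limits at ±i∞ remain
(`green_strip`, `integral_fredholm`, `integral_sin_inv_pow_four`).

Conservation. The commutator of a bond energy with two Lax operators is a discrete divergence
(`divergence_condition`). Hence [H, Z] telescopes to two terms at the ends of the chain, each
traceless at its end site and so orthogonal to everything supported away from the ends
(`hsInner_charge_deriv`).

Thermodynamic limit. Nested commutators with H grow only factorially in Hilbert-Schmidt norm,
uniformly in n (`hsNorm_deriv_pow_le`), so autocorrelations have Taylor series with a uniform
radius. Limits of the derivatives at time zero come from locality, and they propagate to all real
times in steps of fixed length (`exists_correlation`, `tendsto_hsInner_charge_evolve`).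

Bound. Let B be the charges integrated against the weight f, and I = ∫ f. Per site, B overlaps with
every evolved current in -iI, and by the Fredholm equation its squared norm is I. B is orthogonal to
its adjoint, so Cauchy-Schwarz with B - B† gives 2I(∑ p_i)² ≤ ∑ p_i p_j C(s_j - s_i)
(`mazur_bound`). A mean ergodic argument turns this positivity into existence of the time average of
C and the lower bound 2I (`exists_tendsto_average`). The Drude weight is half the average, so it is
at least I = 4 D_K. -/

theorem tensor_mul_tensor (a b : Fin n → Matrix (Fin 2) (Fin 2) ℂ) :
    tensor a * tensor b = tensor fun x => a x * b x := by
  ext σ τ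
  simp only [tensor, Matrix.mul_apply, Matrix.of_apply, ← Finset.prod_mul_distrib,
    Finset.prod_univ_sum, Fintype.piFinset_univ]

theorem trace_tensor (a : Fin n → Matrix (Fin 2) (Fin 2) ℂ) :
    (tensor a).trace = ∏ x, (a x).trace := by
  simp only [tensor, Matrix.trace, Matrix.diag_apply, Matrix.of_apply, Finset.prod_univ_sum,
    Fintype.piFinset_univ]

theorem tensor_conjTranspose (a : Fin n → Matrix (Fin 2) (Fin 2) ℂ) :
    (tensor a).conjTranspose = tensor fun x => (a x).conjTranspose := by
  ext σ τ
  simp [tensor, Matrix.conjTranspose_apply]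

theorem tensor_one : tensor (fun _ : Fin n => (1 : Matrix (Fin 2) (Fin 2) ℂ)) = 1 := by
  ext σ τ
  simp only [tensor, Matrix.of_apply, Matrix.one_apply]
  rw [Finset.prod_ite_zero]
  simp [funext_iff]

theorem tracial_tensor (a : Fin n → Matrix (Fin 2) (Fin 2) ℂ) :
    tracial n (tensor a) = ∏ x, ((a x).trace / 2) := by
  simp [tracial, trace_tensor, Finset.prod_div_distrib]

theorem hsInner_tensor (a b : Fin n → Matrix (Fin 2) (Fin 2) ℂ) :
    hsInner n (tensor a) (tensor b) = ∏ x, (((a x).conjTranspose * b x).trace / 2) := by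
  rw [hsInner, tensor_conjTranspose, tensor_mul_tensor, tracial_tensor]

theorem tracial_add (A B : ChainOp n) : tracial n (A + B) = tracial n A + tracial n B := by
  simp [tracial, add_div]

theorem tracial_sub (A B : ChainOp n) : tracial n (A - B) = tracial n A - tracial n B := by
  simp [tracial, sub_div]

theorem tracial_smul (c : ℂ) (A : ChainOp n) : tracial n (c • A) = c * tracial n A := by
  simp [tracial, mul_div_assoc]

theorem tracial_zero : tracial n (0 : ChainOp n) = 0 := by simp [tracial]

theorem tracial_one : tracial n (1 : ChainOp n) = 1 := by
  simp [tracial]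

theorem tracial_sum {ι : Type*} (s : Finset ι) (f : ι → ChainOp n) :
    tracial n (∑ i ∈ s, f i) = ∑ i ∈ s, tracial n (f i) := by
  simp [tracial, Matrix.trace_sum, Finset.sum_div]

theorem tracial_mul_comm (A B : ChainOp n) : tracial n (A * B) = tracial n (B * A) := by
  rw [tracial, Matrix.trace_mul_comm, ← tracial]

theorem tracial_conjTranspose (A : ChainOp n) :
    tracial n A.conjTranspose = starRingEnd ℂ (tracial n A) := by
  simp [tracial, Matrix.trace_conjTranspose, map_ofNat]

theorem hsInner_add_right (A B C : ChainOp n) :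
    hsInner n A (B + C) = hsInner n A B + hsInner n A C := by
  simp [hsInner, mul_add, tracial_add]

theorem hsInner_sub_right (A B C : ChainOp n) :
    hsInner n A (B - C) = hsInner n A B - hsInner n A C := by
  simp [hsInner, mul_sub, tracial_sub]

theorem hsInner_smul_right (c : ℂ) (A B : ChainOp n) :
    hsInner n A (c • B) = c * hsInner n A B := by
  simp [hsInner, tracial_smul]

theorem hsInner_sum_right {ι : Type*} (s : Finset ι) (A : ChainOp n) (f : ι → ChainOp n) :
    hsInner n A (∑ i ∈ s, f i) = ∑ i ∈ s, hsInner n A (f i) := by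
  simp [hsInner, Finset.mul_sum, tracial_sum]

theorem hsInner_conj (A B : ChainOp n) :
    starRingEnd ℂ (hsInner n A B) = hsInner n B A := by
  rw [hsInner, hsInner, ← tracial_conjTranspose, Matrix.conjTranspose_mul,
    Matrix.conjTranspose_conjTranspose]

theorem hsInner_add_left (A B C : ChainOp n) :
    hsInner n (A + B) C = hsInner n A C + hsInner n B C := by
  simp [hsInner, add_mul, tracial_add]

theorem hsInner_sub_left (A B C : ChainOp n) :
    hsInner n (A - B) C = hsInner n A C - hsInner n B C := by
  simp [hsInner, sub_mul, tracial_sub]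

theorem hsInner_smul_left (c : ℂ) (A B : ChainOp n) :
    hsInner n (c • A) B = starRingEnd ℂ c * hsInner n A B := by
  simp [hsInner, tracial_smul]

theorem hsInner_sum_left {ι : Type*} (s : Finset ι) (B : ChainOp n) (f : ι → ChainOp n) :
    hsInner n (∑ i ∈ s, f i) B = ∑ i ∈ s, hsInner n (f i) B := by
  simp [hsInner, Finset.sum_mul, Matrix.conjTranspose_sum, tracial_sum]

theorem hsInner_eq_sum (A B : ChainOp n) :
    hsInner n A B = (∑ p : (Fin n → Fin 2) × (Fin n → Fin 2),
      starRingEnd ℂ (A p.1 p.2) * B p.1 p.2) / 2 ^ n := by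
  rw [hsInner, tracial, Fintype.sum_prod_type, Finset.sum_comm]
  simp [Matrix.trace, Matrix.mul_apply]

/-- A matrix as a vector of the Hilbert space of its entries. -/
def entryVec (A : ChainOp n) : EuclideanSpace ℂ ((Fin n → Fin 2) × (Fin n → Fin 2)) :=
  WithLp.toLp 2 fun p => A p.1 p.2

theorem hsInner_eq_inner (A B : ChainOp n) :
    hsInner n A B = inner ℂ (entryVec A) (entryVec B) / 2 ^ n := by
  rw [hsInner_eq_sum, PiLp.inner_apply]
  simp [entryVec, mul_comm]

theorem hsInner_self_eq (A : ChainOp n) :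
    hsInner n A A = ((‖entryVec A‖ ^ 2 / 2 ^ n : ℝ) : ℂ) := by
  rw [hsInner_eq_inner, inner_self_eq_norm_sq_to_K]
  push_cast
  rfl

theorem hsInner_self_re_nonneg (A : ChainOp n) : 0 ≤ (hsInner n A A).re := by
  rw [hsInner_self_eq, Complex.ofReal_re]; positivity

theorem norm_hsInner_sq_le (A B : ChainOp n) :
    ‖hsInner n A B‖ ^ 2 ≤ (hsInner n A A).re * (hsInner n B B).re := by
  rw [hsInner_self_eq, hsInner_self_eq, Complex.ofReal_re, Complex.ofReal_re, hsInner_eq_inner,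
    norm_div, div_pow, div_mul_div_comm, ← mul_pow]
  have h : ‖(2 : ℂ) ^ n‖ ^ 2 = (2 : ℝ) ^ n * 2 ^ n := by simp [sq]
  rw [h]
  gcongr
  exact norm_inner_le_norm _ _

end Tensor

/-! ### One-site traces -/

/-- `tr(σ^α† σ^α) / 2`. -/
def pauliWeight : SpinLabel → ℂ
  | .zero => 1
  | .plus => 1 / 2
  | .minus => 1 / 2
  | .z => 1

theorem sum_spinLabel {M : Type*} [AddCommMonoid M] (f : SpinLabel → M) :
    ∑ α, f α = f .zero + (f .plus + (f .minus + f .z)) := by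
  change ∑ α ∈ {SpinLabel.zero, SpinLabel.plus, SpinLabel.minus, SpinLabel.z}, f α = _
  rw [Finset.sum_insert (by decide), Finset.sum_insert (by decide), Finset.sum_insert (by decide),
    Finset.sum_singleton]

/-- Orthogonality of the one-site labels; taken over all sites it makes the Pauli strings an
orthogonal family. -/
theorem trace_pauli_conjTranspose_mul (α β : SpinLabel) :
    ((pauli α).conjTranspose * pauli β).trace / 2 = if α = β then pauliWeight α else 0 := by
  cases α <;> cases β <;>
    simp [pauli, pauliWeight, Matrix.trace_fin_two, Matrix.mul_apply, Fin.sum_univ_two,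
      Matrix.conjTranspose_apply]

/-! ### The Lax operators in coordinates -/

section Lax

variable (γ : ℝ) (φ : ℂ)

theorem lax_ket (α : SpinLabel) (a : AuxLabel) : lax γ φ α (ket a) = laxOnBasis γ φ α a := by
  simp [lax, ket, Finsupp.linearCombination_single]

theorem ket_apply (a b : AuxLabel) [Decidable (a = b)] : ket a b = if a = b then 1 else 0 := by
  classical
  rw [ket, Finsupp.single_apply]

/-- The coordinates of `lax γ φ α v`. -/
def laxCoord (v : Aux) : SpinLabel → AuxLabel → ℂ
  | .zero, .left => v .left
  | .zero, .right => v .right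
  | .zero, .level k => (Real.cos (γ * -(k + 1 : ℝ)) : ℂ) * v (.level k)
  | .z, .left => 0
  | .z, .right => 0
  | .z, .level k =>
      (Complex.cos φ / Complex.sin φ * (Real.sin (γ * -(k + 1 : ℝ)) : ℂ)) * v (.level k)
  | .plus, .left => 0
  | .plus, .right => 0
  | .plus, .level 0 => v .right
  | .plus, .level (k + 1) =>
      ((Real.sin γ : ℂ) / Complex.sin φ * (qNumber γ (-(k + 1 : ℝ)) : ℂ)) * v (.level k)
  | .minus, .left => v (.level 0)
  | .minus, .right => 0
  | .minus, .level k =>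
      ((Real.sin γ : ℂ) / Complex.sin φ * (qNumber γ (k + 2 : ℝ) : ℂ)) * v (.level (k + 1))

theorem lax_apply (α : SpinLabel) (v : Aux) (a : AuxLabel) :
    lax γ φ α v a = laxCoord γ φ v α a := by
  classical
  induction v using Finsupp.induction_linear with
  | zero =>
    rw [map_zero]
    rcases α <;> rcases a with _ | _ | (_ | k) <;> simp [laxCoord]
  | add v w hv hw =>
    rw [map_add, Finsupp.add_apply, hv, hw]
    rcases α <;> rcases a with _ | _ | (_ | k) <;> simp [laxCoord, mul_add]
  | single b c =>
    have hs : Finsupp.single b c = c • ket b := by simp [ket]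
    rw [hs, map_smul, Finsupp.smul_apply, lax_ket]
    rcases α <;> rcases a with _ | _ | (_ | k) <;> rcases b with _ | _ | (_ | j) <;>
      simp [laxCoord, laxOnBasis, ket_apply, mul_comm]
    all_goals split_ifs with h1 <;>
      first | rfl | omega | (subst h1; push_cast; ring_nf)

end Lax

end

end XXZ

namespace XXZ

noncomputable section

/-! ### Overlaps of the charges -/

section Overlap

variable (γ : ℝ) (φ φ' : ℂ)

/-- The vector `L^{α₁} ⋯ L^{α_n} |R⟩`. -/
def laxVec (φ : ℂ) {n : ℕ} (α : Fin n → SpinLabel) : Aux :=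
  (List.ofFn fun x => lax γ φ (α x)).prod (ket .right)

theorem laxVec_zero (α : Fin 0 → SpinLabel) : laxVec γ φ α = ket .right := by
  simp [laxVec]

theorem laxVec_cons {n : ℕ} (β : SpinLabel) (α : Fin n → SpinLabel) :
    laxVec γ φ (Fin.cons β α : Fin (n + 1) → SpinLabel) = lax γ φ β (laxVec γ φ α) := by
  simp [laxVec, List.ofFn_succ]

theorem charge_eq (n : ℕ) :
    charge γ n φ = ∑ α : Fin n → SpinLabel,
      laxVec γ φ α .left • tensor fun x => pauli (α x) := rfl

theorem sum_cons {M : Type*} [AddCommMonoid M] {n : ℕ} (f : (Fin (n + 1) → SpinLabel) → M) :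
    ∑ α, f α = ∑ β, ∑ α : Fin n → SpinLabel, f (Fin.cons β α : Fin (n + 1) → SpinLabel) := by
  rw [← (Fin.consEquiv fun _ : Fin (n + 1) => SpinLabel).sum_comp, Fintype.sum_prod_type]
  rfl

theorem laxCoord_conj (v w : Aux) (h : ∀ a, w a = starRingEnd ℂ (v a)) (α : SpinLabel)
    (a : AuxLabel) :
    laxCoord γ (starRingEnd ℂ φ) w α a = starRingEnd ℂ (laxCoord γ φ v α a) := by
  rcases α <;> rcases a with _ | _ | (_ | k) <;>
    simp only [laxCoord, h, map_mul, map_div₀, map_zero, Complex.conj_ofReal,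
      Complex.sin_conj, Complex.cos_conj]

/-- The amplitudes are rational in sin φ and cos φ with real coefficients. Conjugation therefore
moves onto φ, and the overlap becomes bilinear in the amplitudes at φ and φ'. -/
theorem laxVec_conj {n : ℕ} (α : Fin n → SpinLabel) (a : AuxLabel) :
    laxVec γ (starRingEnd ℂ φ) α a = starRingEnd ℂ (laxVec γ φ α a) := by
  induction n generalizing a with
  | zero =>
    classical
    simp [laxVec_zero, ket_apply, apply_ite (starRingEnd ℂ)]
  | succ n ih =>
    rw [← Fin.cons_self_tail α, laxVec_cons, laxVec_cons, lax_apply, lax_apply]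
    exact laxCoord_conj γ φ _ _ (fun a => ih _ a) _ _

/-- The weighted diagonal correlations of the vectors `laxVec`. -/
def laxGram (n : ℕ) (a : AuxLabel) : ℂ :=
  ∑ α : Fin n → SpinLabel,
    (∏ x, pauliWeight (α x)) * (laxVec γ φ α a * laxVec γ φ' α a)

/-- By orthogonality of the strings only equal pairs of strings survive in the double sum. -/
theorem hsInner_charge (n : ℕ) :
    hsInner n (charge γ n φ) (charge γ n φ') = laxGram γ (starRingEnd ℂ φ) φ' n .left := by
  classical
  rw [charge_eq, charge_eq, hsInner_sum_left, laxGram]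
  refine Finset.sum_congr rfl fun α _ => ?_
  rw [hsInner_sum_right, Finset.sum_eq_single α]
  · simp only [hsInner_smul_left, hsInner_smul_right, hsInner_tensor,
      trace_pauli_conjTranspose_mul, if_true, laxVec_conj]
    ring
  · intro β _ hβ
    obtain ⟨x, hx⟩ := Function.ne_iff.mp hβ
    rw [hsInner_smul_left, hsInner_smul_right, hsInner_tensor,
      Finset.prod_eq_zero (Finset.mem_univ x), mul_zero, mul_zero]
    rw [trace_pauli_conjTranspose_mul, if_neg (Ne.symm hx)]
  · simp

theorem overlap_eq (n : ℕ) : overlap γ n φ φ' = laxGram γ φ φ' n .left := by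
  rw [overlap, hsInner_charge, Complex.conj_conj]

theorem laxGram_zero (a : AuxLabel) :
    laxGram γ φ φ' 0 a = open Classical in if a = .right then 1 else 0 := by
  classical
  simp [laxGram, laxVec_zero, ket_apply, eq_comm]

/-- The leftmost letter is peeled off. As each coordinate of a Lax image involves one coordinate of
its argument, the products on the right are again diagonal and the recursion closes on `laxGram`. -/
theorem laxGram_succ (n : ℕ) (a : AuxLabel) :
    laxGram γ φ φ' (n + 1) a = ∑ β, pauliWeight β * ∑ α : Fin n → SpinLabel,
      (∏ x, pauliWeight (α x)) *
        (laxCoord γ φ (laxVec γ φ α) β a * laxCoord γ φ' (laxVec γ φ' α) β a) := by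
  rw [laxGram, sum_cons]
  refine Finset.sum_congr rfl fun β _ => ?_
  rw [Finset.mul_sum]
  refine Finset.sum_congr rfl fun α _ => ?_
  rw [Fin.prod_univ_succ, laxVec_cons, laxVec_cons, lax_apply, lax_apply]
  simp only [Fin.cons_zero, Fin.cons_succ]
  ring

/-- `sin²(γ (k + 1))`. -/
def sinSq (k : ℕ) : ℝ := Real.sin (γ * (k + 1)) ^ 2

/-- Only the all-identity string keeps the component along |R⟩, so this label acts as a constant
source. -/
theorem laxGram_right (n : ℕ) : laxGram γ φ φ' n .right = 1 := by
  induction n with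
  | zero => simp [laxGram_zero]
  | succ n ih =>
    rw [laxGram_succ, sum_spinLabel]
    simpa [laxCoord, pauliWeight, laxGram] using ih

theorem laxGram_left_succ (n : ℕ) :
    laxGram γ φ φ' (n + 1) .left
      = laxGram γ φ φ' n .left + 1 / 2 * laxGram γ φ φ' n (.level 0) := by
  rw [laxGram_succ, sum_spinLabel]
  simp [laxCoord, pauliWeight, laxGram]

theorem laxGram_left_zero : laxGram γ φ φ' 0 .left = 0 := by simp [laxGram_zero]

theorem laxGram_level_zero (k : ℕ) : laxGram γ φ φ' 0 (.level k) = 0 := by simp [laxGram_zero]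

variable {γ φ φ'}

/-- The letters 0 and z both preserve the level. Their weights 1 - s and s cot φ cot φ', with s =
sin²(γ(k+1)), merge through the addition formula of the cosine. -/
theorem diag_coeff (hφ : Complex.sin φ ≠ 0) (hφ' : Complex.sin φ' ≠ 0) (k : ℕ) :
    (Real.cos (γ * -(k + 1 : ℝ)) : ℂ) * (Real.cos (γ * -(k + 1 : ℝ)) : ℂ)
      + (Complex.cos φ / Complex.sin φ * (Real.sin (γ * -(k + 1 : ℝ)) : ℂ)) *
        (Complex.cos φ' / Complex.sin φ' * (Real.sin (γ * -(k + 1 : ℝ)) : ℂ))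
      = 1 + (sinSq γ k : ℂ) * Complex.cos (φ + φ') / (Complex.sin φ * Complex.sin φ') := by
  have h1 : (Real.cos (γ * -(k + 1 : ℝ)) : ℂ) * (Real.cos (γ * -(k + 1 : ℝ)) : ℂ)
      = 1 - (sinSq γ k : ℂ) := by
    rw [← Complex.ofReal_mul, ← sq, mul_neg, Real.cos_neg, Real.cos_sq', sinSq]
    push_cast; ring
  have h2 : (Real.sin (γ * -(k + 1 : ℝ)) : ℂ) * (Real.sin (γ * -(k + 1 : ℝ)) : ℂ)
      = (sinSq γ k : ℂ) := by
    rw [← Complex.ofReal_mul, ← sq, mul_neg, Real.sin_neg, neg_sq, sinSq]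
  rw [h1, show ∀ a b c : ℂ, a * b * (c * b) = a * c * (b * b) by intros; ring, h2,
    Complex.cos_add]
  field_simp
  ring

/-- The prefactor sin γ cancels the denominator of the q-number. What is left is sin²(γx), which
vanishes at x = m and decouples the levels from m on. -/
theorem hop_coeff (hγ : Real.sin γ ≠ 0) (x : ℝ) :
    ((Real.sin γ : ℂ) / Complex.sin φ * (qNumber γ x : ℂ)) *
      ((Real.sin γ : ℂ) / Complex.sin φ' * (qNumber γ x : ℂ))
      = ((Real.sin (γ * x) ^ 2 : ℝ) : ℂ) / (Complex.sin φ * Complex.sin φ') := by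
  have h : (Real.sin γ : ℂ) * (qNumber γ x : ℂ) = (Real.sin (γ * x) : ℂ) := by
    rw [qNumber, ← Complex.ofReal_mul, mul_div_cancel₀ _ hγ]
  rw [Complex.ofReal_pow, ← h]
  ring

theorem laxGram_level_zero_succ (hγ : Real.sin γ ≠ 0) (hφ : Complex.sin φ ≠ 0)
    (hφ' : Complex.sin φ' ≠ 0) (n : ℕ) :
    laxGram γ φ φ' (n + 1) (.level 0)
      = (1 + (sinSq γ 0 : ℂ) * Complex.cos (φ + φ') / (Complex.sin φ * Complex.sin φ')) *
          laxGram γ φ φ' n (.level 0) + 1 / 2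
        + 1 / 2 * ((sinSq γ 1 : ℂ) / (Complex.sin φ * Complex.sin φ')) *
          laxGram γ φ φ' n (.level 1) := by
  have h1 := hop_coeff (φ := φ) (φ' := φ') hγ 2
  have e : sinSq γ 1 = Real.sin (γ * 2) ^ 2 := by rw [sinSq]; norm_num
  have hr : (1 / 2 : ℂ) = 1 / 2 * laxGram γ φ φ' n .right := by rw [laxGram_right, mul_one]
  conv_rhs =>
    enter [1, 2]
    rw [hr]
  rw [laxGram_succ, sum_spinLabel, ← diag_coeff hφ hφ', e, ← h1]
  simp only [laxGram, laxCoord, pauliWeight, Finset.mul_sum, ← Finset.sum_add_distrib]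
  refine Finset.sum_congr rfl fun α _ => ?_
  norm_num
  ring

theorem laxGram_level_succ_succ (hγ : Real.sin γ ≠ 0) (hφ : Complex.sin φ ≠ 0)
    (hφ' : Complex.sin φ' ≠ 0) (n k : ℕ) :
    laxGram γ φ φ' (n + 1) (.level (k + 1))
      = (1 + (sinSq γ (k + 1) : ℂ) * Complex.cos (φ + φ') / (Complex.sin φ * Complex.sin φ')) *
          laxGram γ φ φ' n (.level (k + 1))
        + 1 / 2 * ((sinSq γ k : ℂ) / (Complex.sin φ * Complex.sin φ')) *
          laxGram γ φ φ' n (.level k)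
        + 1 / 2 * ((sinSq γ (k + 2) : ℂ) / (Complex.sin φ * Complex.sin φ')) *
          laxGram γ φ φ' n (.level (k + 2)) := by
  have h1 := hop_coeff (φ := φ) (φ' := φ') hγ (k + 3)
  have h2 := hop_coeff (φ := φ) (φ' := φ') hγ (-(k + 1))
  rw [laxGram_succ, sum_spinLabel, ← diag_coeff hφ hφ']
  have e1 : sinSq γ (k + 2) = Real.sin (γ * (k + 3)) ^ 2 := by
    rw [sinSq]; push_cast; ring_nf
  have e2 : sinSq γ k = Real.sin (γ * -(k + 1)) ^ 2 := by
    rw [sinSq, mul_neg, Real.sin_neg, neg_sq]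
  rw [e1, e2, ← h1, ← h2]
  simp only [laxGram, laxCoord, pauliWeight, Finset.mul_sum, ← Finset.sum_add_distrib]
  refine Finset.sum_congr rfl fun α _ => ?_
  rw [show ((k + 1 : ℕ) : ℝ) + 2 = k + 3 by push_cast; ring]
  ring

/-- The correlations on the levels, numbered from `1`. -/
def levelGram (γ : ℝ) (φ φ' : ℂ) (n : ℕ) : ℕ → ℂ
  | 0 => 0
  | k + 1 => laxGram γ φ φ' n (.level k)

/-- One three-term form for all levels: the padding entry at index 0 replaces the missing lower
neighbour of the first level, and |R⟩ feeds that level with the weight 1/2 of σ⁺. -/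
theorem levelGram_succ (hγ : Real.sin γ ≠ 0) (hφ : Complex.sin φ ≠ 0)
    (hφ' : Complex.sin φ' ≠ 0) (n k : ℕ) :
    levelGram γ φ φ' (n + 1) (k + 1)
      = (1 + ((Real.sin (γ * (k + 1 : ℕ)) ^ 2 : ℝ) : ℂ) *
            (Complex.cos (φ + φ') / (Complex.sin φ * Complex.sin φ'))) *
          levelGram γ φ φ' n (k + 1)
        + 1 / 2 * (1 / (Complex.sin φ * Complex.sin φ')) *
          (((Real.sin (γ * (k + 2 : ℕ)) ^ 2 : ℝ) : ℂ) * levelGram γ φ φ' n (k + 2)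
            + ((Real.sin (γ * k) ^ 2 : ℝ) : ℂ) * levelGram γ φ φ' n k)
        + if k = 0 then 1 / 2 else 0 := by
  rcases k with _ | k
  · simp only [levelGram]
    rw [laxGram_level_zero_succ hγ hφ hφ']
    simp only [sinSq]
    norm_num
    ring
  · simp only [levelGram]
    rw [laxGram_level_succ_succ hγ hφ hφ']
    simp only [sinSq]
    rw [if_neg (Nat.succ_ne_zero k)]
    push_cast
    rw [show (k : ℂ) + 1 + 2 = k + 2 + 1 by ring]
    ring

end Overlap

end

end XXZ

namespace XXZ

noncomputable section

/-! ### The transfer matrix of the overlaps is a contraction -/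

section Contraction

/-- One step of the transfer matrix in the weighted `ℓ¹` norm with weights `sin (π k / m)`. -/
theorem weighted_step {m : ℕ} (hm : 2 ≤ m) {σ x x' D : ℕ → ℝ} {r b θ : ℝ}
    (hσ0 : σ 0 = 0) (hσm : σ m = 0) (hx : ∀ k, 0 ≤ x k)
    (hstep : ∀ k, k + 1 < m → x' (k + 1) ≤ D (k + 1) * x (k + 1)
      + 1 / 2 * r * (σ (k + 2) * x (k + 2) + σ k * x k) + if k = 0 then b else 0)
    (hθ : ∀ k, k + 1 < m → D (k + 1) + r * σ (k + 1) * Real.cos (Real.pi / m) ≤ θ) :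
    ∑ k ∈ Finset.range m, Real.sin (Real.pi / m * k) * x' k
      ≤ θ * ∑ k ∈ Finset.range m, Real.sin (Real.pi / m * k) * x k
        + b * Real.sin (Real.pi / m) := by
  obtain ⟨p, rfl⟩ : ∃ p, m = p + 2 := ⟨m - 2, by omega⟩
  set a : ℝ := Real.pi / ((p + 2 : ℕ) : ℝ) with ha
  have hm0 : (0 : ℝ) < ((p + 2 : ℕ) : ℝ) := by positivity
  have ham : a * ((p + 2 : ℕ) : ℝ) = Real.pi := by rw [ha]; field_simp
  have ha0 : 0 < a := div_pos Real.pi_pos hm0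
  have hw : ∀ k : ℕ, k + 1 < p + 2 → 0 ≤ Real.sin (a * (k + 1 : ℕ)) := by
    intro k hk
    refine Real.sin_nonneg_of_nonneg_of_le_pi (by positivity) ?_
    rw [← ham]
    gcongr
  have hwm : Real.sin (a * ((p + 2 : ℕ) : ℝ)) = 0 := by rw [ham, Real.sin_pi]
  have e0 : ∀ y : ℕ → ℝ, ∑ k ∈ Finset.range (p + 2), Real.sin (a * k) * y k
      = ∑ k ∈ Finset.range (p + 1), Real.sin (a * (k + 1 : ℕ)) * y (k + 1) := by
    intro y
    rw [Finset.sum_range_succ']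
    simp
  -- shifting the two neighbour sums
  have e1 : ∑ k ∈ Finset.range (p + 1), Real.sin (a * (k + 1 : ℕ)) * (σ (k + 2) * x (k + 2))
      = ∑ k ∈ Finset.range (p + 1), Real.sin (a * k) * (σ (k + 1) * x (k + 1)) := by
    have h := Finset.sum_range_succ (fun k : ℕ => Real.sin (a * k) * (σ (k + 1) * x (k + 1))) (p + 1)
    rw [Finset.sum_range_succ'] at h
    simp only [hσm, Nat.cast_zero, mul_zero, Real.sin_zero, zero_mul, add_zero] at h
    exact h
  -- The end terms lost in this shift carry `σ 0 = 0` and the weight sin π = 0; in the previous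
  -- shift they carry `σ m = 0` and sin 0.
  have e2 : ∑ k ∈ Finset.range (p + 1), Real.sin (a * (k + 1 : ℕ)) * (σ k * x k)
      = ∑ k ∈ Finset.range (p + 1), Real.sin (a * (k + 2 : ℕ)) * (σ (k + 1) * x (k + 1)) := by
    have h := Finset.sum_range_succ (fun k : ℕ => Real.sin (a * (k + 1 : ℕ)) * (σ k * x k)) (p + 1)
    rw [Finset.sum_range_succ'] at h
    simp only [hσ0, hwm, zero_mul, mul_zero, add_zero] at h
    exact h.symm
  have e3 : ∑ k ∈ Finset.range (p + 1), Real.sin (a * (k + 1 : ℕ)) * (if k = 0 then b else 0)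
      = b * Real.sin a := by
    rw [Finset.sum_eq_single 0] <;> simp +contextual [mul_comm]
  rw [e0, e0]
  calc ∑ k ∈ Finset.range (p + 1), Real.sin (a * (k + 1 : ℕ)) * x' (k + 1)
      ≤ ∑ k ∈ Finset.range (p + 1), Real.sin (a * (k + 1 : ℕ)) *
          (D (k + 1) * x (k + 1) + 1 / 2 * r * (σ (k + 2) * x (k + 2) + σ k * x k)
            + if k = 0 then b else 0) := by
        refine Finset.sum_le_sum fun k hk => ?_
        have hk' : k + 1 < p + 2 := by have := Finset.mem_range.mp hk; omega
        exact mul_le_mul_of_nonneg_left (hstep k hk') (hw k hk')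
    _ = ∑ k ∈ Finset.range (p + 1), (Real.sin (a * (k + 1 : ℕ)) * D (k + 1) * x (k + 1)
          + 1 / 2 * r * (Real.sin (a * k) + Real.sin (a * (k + 2 : ℕ))) *
            (σ (k + 1) * x (k + 1))) + b * Real.sin a := by
        rw [← e3]
        have h1 : ∀ k : ℕ, Real.sin (a * (k + 1 : ℕ)) *
          (D (k + 1) * x (k + 1) + 1 / 2 * r * (σ (k + 2) * x (k + 2) + σ k * x k)
            + if k = 0 then b else 0) = Real.sin (a * (k + 1 : ℕ)) * D (k + 1) * x (k + 1)
            + 1 / 2 * r * (Real.sin (a * (k + 1 : ℕ)) * (σ (k + 2) * x (k + 2)))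
            + 1 / 2 * r * (Real.sin (a * (k + 1 : ℕ)) * (σ k * x k))
            + Real.sin (a * (k + 1 : ℕ)) * (if k = 0 then b else 0) := fun k => by ring
        have h2 : ∀ k : ℕ, Real.sin (a * (k + 1 : ℕ)) * D (k + 1) * x (k + 1)
          + 1 / 2 * r * (Real.sin (a * k) + Real.sin (a * (k + 2 : ℕ))) *
            (σ (k + 1) * x (k + 1)) = Real.sin (a * (k + 1 : ℕ)) * D (k + 1) * x (k + 1)
            + 1 / 2 * r * (Real.sin (a * k) * (σ (k + 1) * x (k + 1)))
            + 1 / 2 * r * (Real.sin (a * (k + 2 : ℕ)) * (σ (k + 1) * x (k + 1))) :=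
          fun k => by ring
        simp only [h1, h2, Finset.sum_add_distrib, ← Finset.mul_sum, e1, e2]
    _ ≤ _ := by
        rw [Finset.mul_sum]
        gcongr with k hk
        have hk' : k + 1 < p + 2 := by have := Finset.mem_range.mp hk; omega
        -- The weights form the positive eigenvector of the path on m - 1 vertices, with eigenvalue
        -- 2 cos(π/m); this is where the cosine in the hypothesis `hθ` comes from.
        have h3 : Real.sin (a * k) + Real.sin (a * (k + 2 : ℕ))
            = 2 * Real.cos a * Real.sin (a * (k + 1 : ℕ)) := by
          rw [show a * (k : ℝ) = a * (k + 1 : ℕ) - a by push_cast; ring,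
            show a * ((k + 2 : ℕ) : ℝ) = a * (k + 1 : ℕ) + a by push_cast; ring,
            Real.sin_sub, Real.sin_add]
          ring
        rw [h3]
        have := mul_le_mul_of_nonneg_left (hθ k hk') (mul_nonneg (hw k hk') (hx (k + 1)))
        linarith

/-- The addition formula for cos(φ + φ̄), whose argument is 2 Re φ. -/
theorem normSq_cos_sub_normSq_sin (φ : ℂ) :
    ‖Complex.cos φ‖ ^ 2 - ‖Complex.sin φ‖ ^ 2 = Real.cos (2 * φ.re) := by
  have h : Complex.cos (φ + starRingEnd ℂ φ) = (Real.cos (2 * φ.re) : ℂ) := by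
    rw [Complex.add_conj]; push_cast; rfl
  rw [Complex.cos_add, Complex.cos_conj, Complex.sin_conj, Complex.mul_conj, Complex.mul_conj,
    Complex.normSq_eq_norm_sq, Complex.normSq_eq_norm_sq] at h
  exact_mod_cast h

/-- The spectral gap of the transfer matrix at `φ`, up to a factor that depends on `γ` only. -/
def gap (m : ℕ) (φ : ℂ) : ℝ :=
  (-Real.cos (2 * φ.re) - Real.cos (Real.pi / m)) / ‖Complex.sin φ‖ ^ 2

/-- The diagonal entry is the convex combination (1 - σ) + σ cot φ cot φ'. The arithmetic-geometric
mean inequality separates φ from φ' both in |cot φ cot φ'| and in 1/|sin φ sin φ'|, and the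
resulting halves are the two gaps. -/
theorem transfer_column_le {m : ℕ} (hm : 2 ≤ m) {φ φ' : ℂ} (hφ : Complex.sin φ ≠ 0)
    (hφ' : Complex.sin φ' ≠ 0) {σ : ℝ} (hσ0 : 0 ≤ σ) (hσ1 : σ ≤ 1) :
    ‖1 + (σ : ℂ) * (Complex.cos (φ + φ') / (Complex.sin φ * Complex.sin φ'))‖
      + ‖1 / (Complex.sin φ * Complex.sin φ')‖ * σ * Real.cos (Real.pi / m)
      ≤ 1 - σ * ((gap m φ + gap m φ') / 2) := by
  have hp : 0 < ‖Complex.sin φ‖ := norm_pos_iff.mpr hφ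
  have hp' : 0 < ‖Complex.sin φ'‖ := norm_pos_iff.mpr hφ'
  have hc : 0 ≤ Real.cos (Real.pi / m) := by
    refine Real.cos_nonneg_of_neg_pi_div_two_le_of_le ?_ ?_
    · have : 0 ≤ Real.pi / m := by positivity
      linarith [Real.pi_pos]
    · have : (2 : ℝ) ≤ m := by exact_mod_cast hm
      gcongr
  have e1 : 1 + (σ : ℂ) * (Complex.cos (φ + φ') / (Complex.sin φ * Complex.sin φ'))
      = ((1 - σ : ℝ) : ℂ) + (σ : ℂ) * (Complex.cos φ / Complex.sin φ) *
        (Complex.cos φ' / Complex.sin φ') := by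
    rw [Complex.cos_add]; push_cast; field_simp; ring
  set x := ‖Complex.sin φ‖⁻¹ with hx
  set x' := ‖Complex.sin φ'‖⁻¹ with hx'
  have hgap : gap m φ = (-Real.cos (2 * φ.re) - Real.cos (Real.pi / m)) * x ^ 2 := by
    rw [gap, hx]; field_simp
  have hgap' : gap m φ' = (-Real.cos (2 * φ'.re) - Real.cos (Real.pi / m)) * x' ^ 2 := by
    rw [gap, hx']; field_simp
  have hcot : (‖Complex.cos φ‖ * x) ^ 2 = 1 + Real.cos (2 * φ.re) * x ^ 2 := by
    rw [← normSq_cos_sub_normSq_sin, hx]; field_simp; ring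
  have hcot' : (‖Complex.cos φ'‖ * x') ^ 2 = 1 + Real.cos (2 * φ'.re) * x' ^ 2 := by
    rw [← normSq_cos_sub_normSq_sin, hx']; field_simp; ring
  have h1 : ‖1 + (σ : ℂ) * (Complex.cos (φ + φ') / (Complex.sin φ * Complex.sin φ'))‖
      ≤ (1 - σ) + σ * ((‖Complex.cos φ‖ * x) * (‖Complex.cos φ'‖ * x')) := by
    rw [e1]
    refine (norm_add_le _ _).trans (le_of_eq ?_)
    rw [norm_mul, norm_mul, norm_div, norm_div, Complex.norm_real, Complex.norm_real,
      Real.norm_of_nonneg hσ0, Real.norm_of_nonneg (sub_nonneg.mpr hσ1)]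
    rw [hx, hx']; ring
  have h2 : ‖1 / (Complex.sin φ * Complex.sin φ')‖ = x * x' := by
    rw [norm_div, norm_one, norm_mul, hx, hx', one_div, mul_inv]
  rw [h2, hgap, hgap']
  have h3 : (‖Complex.cos φ‖ * x) * (‖Complex.cos φ'‖ * x')
      ≤ (2 + Real.cos (2 * φ.re) * x ^ 2 + Real.cos (2 * φ'.re) * x' ^ 2) / 2 := by
    nlinarith [sq_nonneg (‖Complex.cos φ‖ * x - ‖Complex.cos φ'‖ * x')]
  have h4 : x * x' ≤ (x ^ 2 + x' ^ 2) / 2 := by nlinarith [sq_nonneg (x - x')]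
  have h5 := mul_le_mul_of_nonneg_left h3 hσ0
  have h6 := mul_le_mul_of_nonneg_left h4 (mul_nonneg hσ0 hc)
  nlinarith

end Contraction

/-! ### The strip -/

section Strip

variable {m : ℕ} {φ φ' : ℂ}

theorem re_mem_of_mem_strip (hm : 2 ≤ m) (hφ : φ ∈ strip m) :
    Real.pi / 4 < φ.re ∧ φ.re < 3 * Real.pi / 4 := by
  have h : Real.pi / (2 * m) ≤ Real.pi / 4 := by
    have : (2 : ℝ) ≤ m := by exact_mod_cast hm
    gcongr
    linarith
  have := abs_lt.mp (show |φ.re - Real.pi / 2| < Real.pi / (2 * m) from hφ)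
  constructor <;> linarith [this.1, this.2]

theorem sin_ne_zero_of_re {z : ℂ} (h0 : 0 < z.re) (h1 : z.re < Real.pi) : Complex.sin z ≠ 0 := by
  rw [Complex.sin_ne_zero_iff]
  intro k hk
  have hre : z.re = k * Real.pi := by
    rw [hk, ← Complex.ofReal_intCast, ← Complex.ofReal_mul, Complex.ofReal_re]
  rw [hre] at h0 h1
  have h0' : (0 : ℝ) < k := by
    by_contra h
    nlinarith [Real.pi_pos]
  have h1' : (k : ℝ) < 1 := by
    by_contra h
    nlinarith [Real.pi_pos]
  have : 0 < k := by exact_mod_cast h0'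
  have : k < 1 := by exact_mod_cast h1'
  omega

theorem sin_ne_zero_of_mem_strip (hm : 2 ≤ m) (hφ : φ ∈ strip m) : Complex.sin φ ≠ 0 := by
  have := re_mem_of_mem_strip hm hφ
  exact sin_ne_zero_of_re (by linarith [Real.pi_pos]) (by linarith [Real.pi_pos])

theorem conj_mem_strip (hφ : φ ∈ strip m) : starRingEnd ℂ φ ∈ strip m := by
  simpa [strip] using hφ

theorem gap_conj : gap m (starRingEnd ℂ φ) = gap m φ := by
  simp [gap, Complex.sin_conj]

/-- -cos(2 Re φ) = cos|2 Re φ - π|, and the strip is the condition |2 Re φ - π| < π/m, on which the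
cosine exceeds cos(π/m). -/
theorem gap_pos (hm : 2 ≤ m) (hφ : φ ∈ strip m) : 0 < gap m φ := by
  have hs := norm_pos_iff.mpr (sin_ne_zero_of_mem_strip hm hφ)
  refine div_pos ?_ (by positivity)
  have h := (show |φ.re - Real.pi / 2| < Real.pi / (2 * m) from hφ)
  have e : -Real.cos (2 * φ.re) = Real.cos |2 * φ.re - Real.pi| := by
    rw [Real.cos_abs, Real.cos_sub_pi]
  rw [e, sub_pos]
  have h2 : |2 * φ.re - Real.pi| < Real.pi / m := by
    have e2 : 2 * φ.re - Real.pi = 2 * (φ.re - Real.pi / 2) := by ring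
    rw [e2, abs_mul, abs_two]
    have e3 : Real.pi / m = 2 * (Real.pi / (2 * m)) := by field_simp
    rw [e3]
    linarith
  refine Real.cos_lt_cos_of_nonneg_of_le_pi (abs_nonneg _) ?_ h2
  have hm' : (1 : ℝ) ≤ m := by exact_mod_cast (by omega : 1 ≤ m)
  exact div_le_self Real.pi_pos.le hm'

theorem re_add_of_mem_strip (hφ : φ ∈ strip m) (hφ' : φ' ∈ strip m) :
    |(φ + φ').re - Real.pi| < Real.pi / m := by
  have h := (show |φ.re - Real.pi / 2| < Real.pi / (2 * m) from hφ)
  have h' := (show |φ'.re - Real.pi / 2| < Real.pi / (2 * m) from hφ')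
  have e3 : Real.pi / m = Real.pi / (2 * m) + Real.pi / (2 * m) := by field_simp; ring
  rw [e3, Complex.add_re, show φ.re + φ'.re - Real.pi
    = (φ.re - Real.pi / 2) + (φ'.re - Real.pi / 2) by ring]
  exact (abs_add_le _ _).trans_lt (add_lt_add h h')

end Strip

end

end XXZ

namespace XXZ

noncomputable section

/-! ### Convergence of the transfer matrix and the Chebyshev form of the kernel. -/

section OverlapLimit

variable {m : ℕ} {γ κ : ℝ} {φ φ' : ℂ}

theorem levelGram_zero (γ : ℝ) (φ φ' : ℂ) (k : ℕ) : levelGram γ φ φ' 0 k = 0 := by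
  cases k with
  | zero => rfl
  | succ k => exact laxGram_level_zero γ φ φ' k

theorem le_weighted_sum (hm : 2 ≤ m) {x : ℕ → ℝ} (hx : ∀ k, 0 ≤ x k) :
    Real.sin (Real.pi / m) * x 1 ≤ ∑ k ∈ Finset.range m, Real.sin (Real.pi / m * k) * x k := by
  have hm0 : (0 : ℝ) < m := by exact_mod_cast (by omega : 0 < m)
  have h := Finset.single_le_sum (f := fun k : ℕ => Real.sin (Real.pi / m * k) * x k)
    (s := Finset.range m) (fun k hk => mul_nonneg ?_ (hx k)) (Finset.mem_range.mpr (by omega : 1 < m))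
  · simpa using h
  · refine Real.sin_nonneg_of_nonneg_of_le_pi (by positivity) ?_
    have hk' : (k : ℝ) ≤ m := by exact_mod_cast (Finset.mem_range.mp hk).le
    rw [div_mul_eq_mul_div, div_le_iff₀ hm0]
    exact mul_le_mul_of_nonneg_left hk' Real.pi_pos.le

theorem sin_pi_div_pos (hm : 2 ≤ m) : 0 < Real.sin (Real.pi / m) := by
  have hm' : (2 : ℝ) ≤ m := by exact_mod_cast hm
  refine Real.sin_pos_of_pos_of_lt_pi (by positivity) (div_lt_self Real.pi_pos (by linarith))

/-- The lower bound κ on the couplings makes the contraction factor the same for all levels. -/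
theorem column_le (hm : 2 ≤ m) (hκ : ∀ k, k + 1 < m → κ ≤ Real.sin (γ * (k + 1 : ℕ)) ^ 2)
    (hφ : φ ∈ strip m) (hφ' : φ' ∈ strip m) (k : ℕ) (hk : k + 1 < m) :
    ‖1 + ((Real.sin (γ * (k + 1 : ℕ)) ^ 2 : ℝ) : ℂ) *
        (Complex.cos (φ + φ') / (Complex.sin φ * Complex.sin φ'))‖
      + ‖1 / (Complex.sin φ * Complex.sin φ')‖ * Real.sin (γ * (k + 1 : ℕ)) ^ 2 *
        Real.cos (Real.pi / m)
      ≤ 1 - κ * ((gap m φ + gap m φ') / 2) := by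
  refine (transfer_column_le hm (sin_ne_zero_of_mem_strip hm hφ)
    (sin_ne_zero_of_mem_strip hm hφ') (sq_nonneg _) (Real.sin_sq_le_one _)).trans ?_
  have h1 := gap_pos hm hφ
  have h2 := gap_pos hm hφ'
  have := hκ k hk
  gcongr

theorem factor_nonneg (hm : 2 ≤ m) (hκ : ∀ k, k + 1 < m → κ ≤ Real.sin (γ * (k + 1 : ℕ)) ^ 2)
    (hφ : φ ∈ strip m) (hφ' : φ' ∈ strip m) : 0 ≤ 1 - κ * ((gap m φ + gap m φ') / 2) := by
  refine le_trans ?_ (column_le hm hκ hφ hφ' 0 (by omega))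
  have : 0 ≤ Real.cos (Real.pi / m) := by
    refine Real.cos_nonneg_of_neg_pi_div_two_le_of_le ?_ ?_
    · have : 0 ≤ Real.pi / m := by positivity
      linarith [Real.pi_pos]
    · have : (2 : ℝ) ≤ m := by exact_mod_cast hm
      gcongr
  positivity

/-- The weighted norm N satisfies N' ≤ θN + ½ sin(π/m), so starting from 0 it stays below the fixed
point ½ sin(π/m)/(1 - θ), where 1 - θ = κ(g + g')/2 and g, g' are the two gaps. -/
theorem norm_levelGram_one_le (hm : 2 ≤ m) (hγ : Real.sin γ ≠ 0) (hγm : Real.sin (γ * m) = 0)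
    (hκ0 : 0 < κ) (hκ : ∀ k, k + 1 < m → κ ≤ Real.sin (γ * (k + 1 : ℕ)) ^ 2)
    (hφ : φ ∈ strip m) (hφ' : φ' ∈ strip m) (n : ℕ) :
    ‖levelGram γ φ φ' n 1‖ ≤ 1 / (κ * (gap m φ + gap m φ')) := by
  have hg := add_pos (gap_pos hm hφ) (gap_pos hm hφ')
  have hs := sin_pi_div_pos hm
  have key : ∀ n, ∑ k ∈ Finset.range m, Real.sin (Real.pi / m * k) * ‖levelGram γ φ φ' n k‖
      ≤ Real.sin (Real.pi / m) * (1 / (κ * (gap m φ + gap m φ'))) := by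
    intro n
    induction n with
    | zero => simp only [levelGram_zero, norm_zero, mul_zero, Finset.sum_const_zero]; positivity
    | succ n ih =>
      refine (weighted_step hm (σ := fun k => Real.sin (γ * k) ^ 2)
        (D := fun k => ‖1 + ((Real.sin (γ * (k : ℕ)) ^ 2 : ℝ) : ℂ) *
          (Complex.cos (φ + φ') / (Complex.sin φ * Complex.sin φ'))‖)
        (r := ‖1 / (Complex.sin φ * Complex.sin φ')‖) (b := 1 / 2)
        (x := fun k => ‖levelGram γ φ φ' n k‖) (by simp) (by simp [hγm])
        (fun k => norm_nonneg _) ?_ (column_le hm hκ hφ hφ')).trans ?_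
      · intro k _
        rw [levelGram_succ hγ (sin_ne_zero_of_mem_strip hm hφ)
          (sin_ne_zero_of_mem_strip hm hφ')]
        refine (norm_add_le _ _).trans (add_le_add ((norm_add_le _ _).trans (add_le_add ?_ ?_)) ?_)
        · rw [norm_mul]
        · rw [norm_mul, norm_mul, show ‖(1 / 2 : ℂ)‖ = 1 / 2 by norm_num]
          gcongr
          refine (norm_add_le _ _).trans (le_of_eq ?_)
          rw [norm_mul, norm_mul, Complex.norm_real, Complex.norm_real,
            Real.norm_of_nonneg (sq_nonneg _), Real.norm_of_nonneg (sq_nonneg _)]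
        · split_ifs <;> simp
      · have := mul_le_mul_of_nonneg_left ih (factor_nonneg hm hκ hφ hφ')
        refine (add_le_add_left this _).trans (le_of_eq ?_)
        field_simp
        ring
  have h := (le_weighted_sum hm fun k => norm_nonneg (levelGram γ φ φ' n k)).trans (key n)
  exact le_of_mul_le_mul_left h hs

theorem overlap_succ (γ : ℝ) (φ φ' : ℂ) (n : ℕ) :
    overlap γ (n + 1) φ φ' = overlap γ n φ φ' + 1 / 2 * levelGram γ φ φ' n 1 := by
  rw [overlap_eq, overlap_eq, laxGram_left_succ]
  rfl

theorem overlap_eq_sum (γ : ℝ) (φ φ' : ℂ) (n : ℕ) :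
    overlap γ n φ φ' = ∑ i ∈ Finset.range n, 1 / 2 * levelGram γ φ φ' i 1 := by
  induction n with
  | zero => rw [overlap_eq, laxGram_left_zero]; simp
  | succ n ih => rw [overlap_succ, ih, Finset.sum_range_succ]

theorem norm_overlap_le (hm : 2 ≤ m) (hγ : Real.sin γ ≠ 0) (hγm : Real.sin (γ * m) = 0)
    (hκ0 : 0 < κ) (hκ : ∀ k, k + 1 < m → κ ≤ Real.sin (γ * (k + 1 : ℕ)) ^ 2)
    (hφ : φ ∈ strip m) (hφ' : φ' ∈ strip m) (n : ℕ) :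
    ‖overlap γ n φ φ'‖ ≤ n * (1 / (2 * κ * (gap m φ + gap m φ'))) := by
  rw [overlap_eq_sum]
  refine (norm_sum_le _ _).trans ?_
  have : ∀ i ∈ Finset.range n, ‖1 / 2 * levelGram γ φ φ' i 1‖
      ≤ 1 / (2 * κ * (gap m φ + gap m φ')) := by
    intro i _
    rw [norm_mul, show ‖(1 / 2 : ℂ)‖ = 1 / 2 by norm_num]
    have h := norm_levelGram_one_le hm hγ hγm hκ0 hκ hφ hφ' i
    refine (mul_le_mul_of_nonneg_left h (by norm_num)).trans (le_of_eq ?_)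
    rw [mul_assoc 2, one_div_mul_one_div]
  refine (Finset.sum_le_card_nsmul _ _ _ this).trans ?_
  simp

/-- The growth rate of `‖Z_n(φ)‖²` is bounded by the inverse gap. -/
theorem hsInner_charge_self_le (hm : 2 ≤ m) (hγ : Real.sin γ ≠ 0) (hγm : Real.sin (γ * m) = 0)
    (hκ0 : 0 < κ) (hκ : ∀ k, k + 1 < m → κ ≤ Real.sin (γ * (k + 1 : ℕ)) ^ 2)
    (hφ : φ ∈ strip m) (n : ℕ) :
    (hsInner n (charge γ n φ) (charge γ n φ)).re ≤ n * (1 / (4 * κ * gap m φ)) := by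
  have h := norm_overlap_le hm hγ hγm hκ0 hκ (conj_mem_strip hφ) hφ n
  rw [gap_conj, overlap, Complex.conj_conj] at h
  refine (Complex.re_le_norm _).trans (h.trans (le_of_eq ?_))
  ring_nf

/-- The values `U_j(cos u)`. -/
def chebU (u : ℂ) (j : ℤ) : ℂ := (Polynomial.Chebyshev.U ℂ j).eval (Complex.cos u)

theorem chebU_rec (u : ℂ) (j : ℤ) :
    chebU u (j + 1) + chebU u (j - 1) = 2 * Complex.cos u * chebU u j := by
  have h := congrArg (Polynomial.eval (Complex.cos u)) (Polynomial.Chebyshev.U_add_two ℂ (j - 1))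
  rw [show j - 1 + 2 = j + 1 by ring, show j - 1 + 1 = j by ring] at h
  simp only [Polynomial.eval_sub, Polynomial.eval_mul, Polynomial.eval_ofNat,
    Polynomial.eval_X] at h
  rw [chebU, chebU, chebU, h]
  ring

theorem chebU_neg_one (u : ℂ) : chebU u (-1) = 0 := by simp [chebU]

theorem chebU_mul_sin (u : ℂ) (j : ℤ) : chebU u j * Complex.sin u = Complex.sin ((j + 1) * u) :=
  Polynomial.Chebyshev.U_complex_cos u j

theorem chebU_pi (j : ℤ) : chebU Real.pi j = j.negOnePow * (j + 1) := by
  rw [chebU, Complex.cos_pi, Polynomial.Chebyshev.U_eval_neg_one]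

/-- The zeros of sin(mu) are real with spacing π/m and include π, so an open window of half-width
π/m around π contains no other. -/
theorem eq_pi_of_sin_eq_zero (hm : 1 ≤ m) {u : ℂ} (hu : |u.re - Real.pi| < Real.pi / m)
    (h : Complex.sin (m * u) = 0) : u = Real.pi := by
  have hm0 : (0 : ℝ) < m := by exact_mod_cast hm
  have hmc : (m : ℂ) ≠ 0 := by exact_mod_cast (by omega : m ≠ 0)
  obtain ⟨k, hk⟩ := Complex.sin_eq_zero_iff.mp h
  have hu' : u = ((k * Real.pi / m : ℝ) : ℂ) := by
    push_cast; rw [← hk]; field_simp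
  have hre : u.re = k * Real.pi / m := by rw [hu', Complex.ofReal_re]
  rw [hre, show k * Real.pi / m - Real.pi = (k - m) * (Real.pi / m) by field_simp, abs_mul,
    abs_of_pos (div_pos Real.pi_pos hm0)] at hu
  have h1 : |(k : ℝ) - m| < 1 := by
    by_contra hcon
    have := mul_le_mul_of_nonneg_right (not_lt.mp hcon) (div_pos Real.pi_pos hm0).le
    linarith
  have h2 : k = m := by
    have : |k - (m : ℤ)| < 1 := by exact_mod_cast h1
    have := Int.abs_lt_one_iff.mp this
    omega
  rw [hu', h2]
  push_cast
  field_simp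

/-- The only candidate zero is u = π, where the value is ±m. With Chebyshev quotients the removable
singularity of the kernel needs no separate treatment. -/
theorem chebU_ne_zero (hm : 1 ≤ m) {u : ℂ} (hu : |u.re - Real.pi| < Real.pi / m) :
    chebU u ((m : ℤ) - 1) ≠ 0 := by
  intro h
  have h1 := chebU_mul_sin u ((m : ℤ) - 1)
  rw [h, zero_mul] at h1
  have h2 : Complex.sin (m * u) = 0 := by
    rw [h1]; push_cast; ring_nf
  have h3 := eq_pi_of_sin_eq_zero hm hu h2
  rw [h3, chebU_pi] at h
  have hmc : (m : ℂ) ≠ 0 := by exact_mod_cast (by omega : m ≠ 0)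
  rcases Int.even_or_odd ((m : ℤ) - 1) with he | he
  · rw [Int.negOnePow_even _ he] at h; simp [hmc] at h
  · rw [Int.negOnePow_odd _ he] at h; simp [hmc] at h

/-- The kernel as a quotient of Chebyshev polynomials. -/
theorem kernel_eq (l : ℕ) (hm : 2 ≤ m) (hφ : |(φ + φ').re - Real.pi| < Real.pi / m) :
    kernel l m φ φ' = -(Complex.sin φ * Complex.sin φ') /
      (2 * (Real.sin (Real.pi * l / m) : ℂ) ^ 2) *
      (chebU (φ + φ') ((m : ℤ) - 2) / chebU (φ + φ') ((m : ℤ) - 1)) := by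
  rw [kernel]
  congr 1
  have hmc : (m : ℂ) ≠ 0 := by exact_mod_cast (by omega : m ≠ 0)
  split_ifs with h
  · rw [h, chebU_pi, chebU_pi, show (m : ℤ) - 1 = (m : ℤ) - 2 + 1 by ring, Int.negOnePow_succ]
    rcases Int.even_or_odd ((m : ℤ) - 2) with he | he
    · rw [Int.negOnePow_even _ he]; push_cast; rw [show (m : ℂ) - 2 + 1 + 1 = m by ring]
      field_simp; ring
    · rw [Int.negOnePow_odd _ he]; push_cast; rw [show (m : ℂ) - 2 + 1 + 1 = m by ring]
      field_simp; ring
  · have hs : Complex.sin (m * (φ + φ')) ≠ 0 := fun h0 =>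
      h (eq_pi_of_sin_eq_zero (by omega) hφ h0)
    have h1 := chebU_mul_sin (φ + φ') ((m : ℤ) - 1)
    have h2 := chebU_mul_sin (φ + φ') ((m : ℤ) - 2)
    push_cast at h1 h2
    rw [show (m : ℂ) - 1 + 1 = m by ring] at h1
    rw [show (m : ℂ) - 2 + 1 = m - 1 by ring] at h2
    have hsu : Complex.sin (φ + φ') ≠ 0 := by
      intro h0; rw [h0, mul_zero] at h1; exact hs h1.symm
    rw [← h1, ← h2, mul_div_mul_right _ _ hsu]

/-- The recursion is affine with a contractive linear part, so it converges geometrically to any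
fixed point. Multiplying by sin²(γk) turns the fixed-point equation into the Chebyshev recurrence,
with the vanishing condition at level m. -/
theorem tendsto_levelGram_one (hm : 2 ≤ m) (hγ : Real.sin γ ≠ 0) (hγm : Real.sin (γ * m) = 0)
    (hκ0 : 0 < κ) (hκ : ∀ k, k + 1 < m → κ ≤ Real.sin (γ * (k + 1 : ℕ)) ^ 2)
    (hφ : φ ∈ strip m) (hφ' : φ' ∈ strip m) :
    Tendsto (fun n => levelGram γ φ φ' n 1) atTop
      (𝓝 (-(Complex.sin φ * Complex.sin φ') / (Real.sin γ : ℂ) ^ 2 *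
        (chebU (φ + φ') ((m : ℤ) - 2) / chebU (φ + φ') ((m : ℤ) - 1)))) := by
  have hs := sin_ne_zero_of_mem_strip hm hφ
  have hs' := sin_ne_zero_of_mem_strip hm hφ'
  have hU := chebU_ne_zero (by omega) (re_add_of_mem_strip hφ hφ')
  set u := φ + φ' with hu
  -- the stationary vector, multiplied by `sin² (γ k)` and as it is
  let W : ℕ → ℂ := fun k => if k = 0 then 0 else Complex.sin φ * Complex.sin φ' * (-1) ^ k *
    (chebU u ((m : ℤ) - k - 1) / chebU u ((m : ℤ) - 1))
  let V : ℕ → ℂ := fun k => W k / ((Real.sin (γ * k) ^ 2 : ℝ) : ℂ)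
  have hpos : ∀ k, k + 1 < m → ((Real.sin (γ * (k + 1 : ℕ)) ^ 2 : ℝ) : ℂ) ≠ 0 := by
    intro k hk
    exact_mod_cast (hκ0.trans_le (hκ k hk)).ne'
  have hWV : ∀ k, k ≤ m → ((Real.sin (γ * k) ^ 2 : ℝ) : ℂ) * V k = W k := by
    intro k hk
    rcases k with _ | k
    · simp [W]
    · rcases hk.lt_or_eq with h | h
      · exact mul_div_cancel₀ _ (hpos k h)
      -- At k = m both sides vanish, the left because sin(γm) = 0 and the right because U₋₁ = 0.
      · rw [h, hγm]
        simp only [W]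
        rw [if_neg (by omega), show (m : ℤ) - m - 1 = -1 by ring, chebU_neg_one]
        simp
  -- This is the Chebyshev recurrence after the alternating sign is absorbed. At k = 0 the general
  -- formula would give sin φ sin φ' but `W 0` is set to 0; the difference produces the source term.
  have hW0 : ∀ k, Complex.cos u * W (k + 1) + 1 / 2 * (W (k + 2) + W k)
      = if k = 0 then -(1 / 2 * (Complex.sin φ * Complex.sin φ')) else 0 := by
    intro k
    have hr := chebU_rec u ((m : ℤ) - (k + 1 : ℕ) - 1)
    rw [show (m : ℤ) - (k + 1 : ℕ) - 1 + 1 = (m : ℤ) - k - 1 by push_cast; ring,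
      show (m : ℤ) - (k + 1 : ℕ) - 1 - 1 = (m : ℤ) - (k + 2 : ℕ) - 1 by push_cast; ring] at hr
    have e : Complex.cos u * W (k + 1) + 1 / 2 * W (k + 2)
        = -(1 / 2 * (Complex.sin φ * Complex.sin φ' * (-1) ^ k *
          (chebU u ((m : ℤ) - k - 1) / chebU u ((m : ℤ) - 1)))) := by
      simp only [W, Nat.add_eq_zero_iff, one_ne_zero, and_false, if_false, OfNat.ofNat_ne_zero]
      rw [eq_sub_of_add_eq hr, pow_succ, pow_succ]
      field_simp
      ring
    rw [mul_add, ← add_assoc, e]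
    rcases k with _ | k
    · simp only [W, if_true, pow_zero, Nat.cast_zero, sub_zero]
      rw [div_self hU]; ring
    · simp only [W, Nat.add_eq_zero_iff, one_ne_zero, and_false, if_false]
      ring
  have hfix : ∀ k, k + 1 < m → V (k + 1)
      = (1 + ((Real.sin (γ * (k + 1 : ℕ)) ^ 2 : ℝ) : ℂ) *
            (Complex.cos u / (Complex.sin φ * Complex.sin φ'))) * V (k + 1)
        + 1 / 2 * (1 / (Complex.sin φ * Complex.sin φ')) *
          (((Real.sin (γ * (k + 2 : ℕ)) ^ 2 : ℝ) : ℂ) * V (k + 2)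
            + ((Real.sin (γ * k) ^ 2 : ℝ) : ℂ) * V k)
        + if k = 0 then 1 / 2 else 0 := by
    intro k hk
    have h1 := hWV (k + 1) (by omega)
    have h0 := hW0 k
    rw [hWV (k + 2) (by omega), hWV k (by omega)]
    have : (1 + ((Real.sin (γ * (k + 1 : ℕ)) ^ 2 : ℝ) : ℂ) *
            (Complex.cos u / (Complex.sin φ * Complex.sin φ'))) * V (k + 1)
        + 1 / 2 * (1 / (Complex.sin φ * Complex.sin φ')) * (W (k + 2) + W k)
        = V (k + 1) + (Complex.cos u * W (k + 1) + 1 / 2 * (W (k + 2) + W k)) /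
          (Complex.sin φ * Complex.sin φ') := by
      rw [← h1]; field_simp; ring
    rw [this, h0]
    split_ifs <;> field_simp <;> ring
  -- the distance to the stationary vector
  have hg := add_pos (gap_pos hm hφ) (gap_pos hm hφ')
  set θ := 1 - κ * ((gap m φ + gap m φ') / 2) with hθ
  have hθ0 : 0 ≤ θ := factor_nonneg hm hκ hφ hφ'
  have hθ1 : θ < 1 := by rw [hθ]; nlinarith [mul_pos hκ0 hg]
  set N : ℕ → ℝ := fun n =>
    ∑ k ∈ Finset.range m, Real.sin (Real.pi / m * k) * ‖levelGram γ φ φ' n k - V k‖ with hN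
  have hstep : ∀ n, N (n + 1) ≤ θ * N n := by
    intro n
    have := weighted_step hm (σ := fun k => Real.sin (γ * k) ^ 2)
        (D := fun k => ‖1 + ((Real.sin (γ * (k : ℕ)) ^ 2 : ℝ) : ℂ) *
          (Complex.cos (φ + φ') / (Complex.sin φ * Complex.sin φ'))‖)
        (r := ‖1 / (Complex.sin φ * Complex.sin φ')‖) (b := 0)
        (x := fun k => ‖levelGram γ φ φ' n k - V k‖)
        (x' := fun k => ‖levelGram γ φ φ' (n + 1) k - V k‖) (by simp) (by simp [hγm])
        (fun k => norm_nonneg _) ?_ (column_le hm hκ hφ hφ')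
    · simpa using this
    · intro k hk
      have e : levelGram γ φ φ' (n + 1) (k + 1) - V (k + 1)
          = (1 + ((Real.sin (γ * (k + 1 : ℕ)) ^ 2 : ℝ) : ℂ) *
              (Complex.cos u / (Complex.sin φ * Complex.sin φ'))) *
              (levelGram γ φ φ' n (k + 1) - V (k + 1))
            + 1 / 2 * (1 / (Complex.sin φ * Complex.sin φ')) *
              (((Real.sin (γ * (k + 2 : ℕ)) ^ 2 : ℝ) : ℂ) * (levelGram γ φ φ' n (k + 2) - V (k + 2))
                + ((Real.sin (γ * k) ^ 2 : ℝ) : ℂ) * (levelGram γ φ φ' n k - V k)) := by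
        rw [levelGram_succ hγ hs hs']
        conv_lhs => rw [hfix k hk]
        ring
      simp only [ite_self, add_zero]
      rw [e]
      refine (norm_add_le _ _).trans (add_le_add ?_ ?_)
      · rw [norm_mul]
      · rw [norm_mul, norm_mul, show ‖(1 / 2 : ℂ)‖ = 1 / 2 by norm_num]
        gcongr
        refine (norm_add_le _ _).trans (le_of_eq ?_)
        rw [norm_mul, norm_mul, Complex.norm_real, Complex.norm_real,
          Real.norm_of_nonneg (sq_nonneg _), Real.norm_of_nonneg (sq_nonneg _)]
  have hgeom : ∀ n, N n ≤ θ ^ n * N 0 := by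
    intro n
    induction n with
    | zero => simp
    | succ n ih =>
      calc N (n + 1) ≤ θ * N n := hstep n
        _ ≤ θ * (θ ^ n * N 0) := mul_le_mul_of_nonneg_left ih hθ0
        _ = _ := by ring
  have hsin := sin_pi_div_pos hm
  have hV1 : V 1 = -(Complex.sin φ * Complex.sin φ') / (Real.sin γ : ℂ) ^ 2 *
        (chebU u ((m : ℤ) - 2) / chebU u ((m : ℤ) - 1)) := by
    simp only [V, W, one_ne_zero, if_false, pow_one]
    rw [show (m : ℤ) - (1 : ℕ) - 1 = (m : ℤ) - 2 by push_cast; ring]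
    push_cast
    rw [mul_one]
    ring
  rw [← hV1, tendsto_iff_norm_sub_tendsto_zero]
  refine squeeze_zero (g := fun n => θ ^ n * N 0 / Real.sin (Real.pi / m))
    (fun n => norm_nonneg _) (fun n => ?_) ?_
  · rw [le_div_iff₀ hsin, mul_comm]
    exact (le_weighted_sum hm fun k => norm_nonneg (levelGram γ φ φ' n k - V k)).trans (hgeom n)
  · have := ((tendsto_pow_atTop_nhds_zero_of_lt_one hθ0 hθ1).mul_const (N 0)).div_const
      (Real.sin (Real.pi / m))
    simpa using this

/-- The overlap is the sum of its increments, half the value at the first level, so dividing by n is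
a Cesàro mean of a convergent sequence. -/
theorem tendsto_overlap_div (l : ℕ) (hm : 2 ≤ m) (hl : γ = Real.pi * l / m)
    (hγ : Real.sin γ ≠ 0) (hγm : Real.sin (γ * m) = 0)
    (hκ0 : 0 < κ) (hκ : ∀ k, k + 1 < m → κ ≤ Real.sin (γ * (k + 1 : ℕ)) ^ 2)
    (hφ : φ ∈ strip m) (hφ' : φ' ∈ strip m) :
    Tendsto (fun n : ℕ => overlap γ n φ φ' / n) atTop (𝓝 (kernel l m φ φ')) := by
  have h := ((tendsto_levelGram_one hm hγ hγm hκ0 hκ hφ hφ').const_mul (1 / 2 : ℂ)).cesaro_smul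
  have hγc : (Real.sin γ : ℂ) ≠ 0 := by exact_mod_cast hγ
  rw [kernel_eq l hm (re_add_of_mem_strip hφ hφ'), ← hl]
  convert h using 2
  · rw [overlap_eq_sum, Complex.real_smul]
    push_cast
    rw [div_eq_inv_mul]
  · field_simp

/-- A zero would mean m ∣ lk, hence m ∣ k by coprimality. -/
theorem sin_mul_ne_zero (l : ℕ) (hlm : Nat.Coprime l m) (hγ : γ = Real.pi * l / m) {k : ℕ}
    (hk0 : 0 < k) (hk : k < m) : Real.sin (γ * k) ≠ 0 := by
  have hm0 : (m : ℝ) ≠ 0 := by exact_mod_cast (by omega : m ≠ 0)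
  rw [Real.sin_ne_zero_iff]
  intro n hn
  have h1 : (n : ℝ) * m = l * k := by
    rw [hγ] at hn
    have hpi := Real.pi_ne_zero
    field_simp at hn
    linarith
  have h2 : (m : ℤ) ∣ (l * k : ℕ) := ⟨n, by push_cast; rw [mul_comm (m : ℤ)]; exact_mod_cast h1.symm⟩
  have h3 : m ∣ k := hlm.symm.dvd_of_dvd_mul_left (by exact_mod_cast h2)
  exact absurd (Nat.le_of_dvd hk0 h3) (by omega)

theorem sin_mul_eq_zero (l : ℕ) (hm : 2 ≤ m) (hγ : γ = Real.pi * l / m) :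
    Real.sin (γ * m) = 0 := by
  have hm0 : (m : ℝ) ≠ 0 := by exact_mod_cast (by omega : m ≠ 0)
  rw [hγ, div_mul_cancel₀ _ hm0, mul_comm]
  exact Real.sin_nat_mul_pi l

/-- At coprime `l, m` the numbers `sin² (π l k / m)`, `0 < k < m`, are bounded below. -/
theorem exists_sinSq_lower (l : ℕ) (hm : 2 ≤ m) (hlm : Nat.Coprime l m)
    (hγ : γ = Real.pi * l / m) :
    ∃ κ : ℝ, 0 < κ ∧ ∀ k, k + 1 < m → κ ≤ Real.sin (γ * (k + 1 : ℕ)) ^ 2 := by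
  obtain ⟨k₀, hk₀, hmin⟩ := Finset.exists_min_image (Finset.range (m - 1))
    (fun k : ℕ => Real.sin (γ * (k + 1 : ℕ)) ^ 2) ⟨0, by simp; omega⟩
  refine ⟨Real.sin (γ * (k₀ + 1 : ℕ)) ^ 2, ?_, fun k hk => hmin k (by simp; omega)⟩
  have hk₁ : k₀ + 1 < m := by have := Finset.mem_range.mp hk₀; omega
  have := sin_mul_ne_zero l hlm hγ (Nat.succ_pos k₀) hk₁
  positivity

end OverlapLimit

end

end XXZ

namespace XXZ

noncomputable section

/-! ### Integration over the strip -/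

section StripIntegral

variable {m : ℕ}

/-- The left end of the interval of real parts of the strip. -/
def stripL (m : ℕ) : ℝ := Real.pi / 2 - Real.pi / (2 * m)

/-- The right end of the interval of real parts of the strip. -/
def stripR (m : ℕ) : ℝ := Real.pi / 2 + Real.pi / (2 * m)

theorem mem_strip_iff {z : ℂ} : z ∈ strip m ↔ z.re ∈ Set.Ioo (stripL m) (stripR m) := by
  rw [strip, Set.mem_ofPred_eq, abs_lt, Set.mem_Ioo, stripL, stripR]
  constructor <;> rintro ⟨h1, h2⟩ <;> constructor <;> linarith

theorem stripL_le_stripR (m : ℕ) : stripL m ≤ stripR m := by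
  have : 0 ≤ Real.pi / (2 * m) := by positivity
  rw [stripL, stripR]; linarith

theorem isOpen_strip (m : ℕ) : IsOpen (strip m) := by
  have : strip m = Complex.re ⁻¹' Set.Ioo (stripL m) (stripR m) := by
    ext z; exact mem_strip_iff
  rw [this]
  exact isOpen_Ioo.preimage Complex.continuous_re

theorem measurableSet_strip (m : ℕ) : MeasurableSet (strip m) := (isOpen_strip m).measurableSet

/-- The function of two real variables behind a function of a complex variable. -/
def onPlane {E : Type*} (h : ℂ → E) (p : ℝ × ℝ) : E := h (p.1 + p.2 * Complex.I)

theorem onPlane_eq {E : Type*} (h : ℂ → E) :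
    onPlane h = h ∘ Complex.measurableEquivRealProd.symm := by
  ext p
  rw [onPlane, Function.comp_apply, Complex.measurableEquivRealProd_symm_apply]
  congr 1
  exact (Complex.mk_eq_add_mul_I _ _).symm

theorem preimage_strip : Complex.measurableEquivRealProd.symm ⁻¹' strip m
    = Set.Ioo (stripL m) (stripR m) ×ˢ Set.univ := by
  ext p
  rw [Set.mem_preimage, mem_strip_iff, Complex.measurableEquivRealProd_symm_apply]
  simp

variable {E : Type*} [NormedAddCommGroup E]

theorem integrableOn_strip_iff (h : ℂ → E) : IntegrableOn h (strip m)
    ↔ IntegrableOn (onPlane h) (Set.Ioo (stripL m) (stripR m) ×ˢ Set.univ) := by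
  rw [← (Complex.volume_preserving_equiv_real_prod.symm _).integrableOn_comp_preimage
    (MeasurableEquiv.measurableEmbedding _), preimage_strip, onPlane_eq]

theorem setIntegral_strip_eq [NormedSpace ℝ E] (h : ℂ → E) : ∫ z in strip m, h z
    = ∫ p in Set.Ioo (stripL m) (stripR m) ×ˢ (Set.univ : Set ℝ), onPlane h p := by
  rw [← (Complex.volume_preserving_equiv_real_prod.symm _).setIntegral_preimage_emb
    (MeasurableEquiv.measurableEmbedding _), preimage_strip, onPlane_eq]
  rfl

/-- Exhausting the strip by rectangles gives the iterated integrals in which Green's formula on a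
rectangle is stated. -/
theorem tendsto_iterated_strip [NormedSpace ℝ E] [CompleteSpace E] {h : ℂ → E}
    (hh : IntegrableOn h (strip m)) :
    Tendsto (fun n : ℕ => ∫ x in stripL m..stripR m, ∫ y in (-(n : ℝ))..n,
      h (x + y * Complex.I)) atTop (𝓝 (∫ z in strip m, h z)) := by
  have hi := (integrableOn_strip_iff h).mp hh
  have e : ∀ n : ℕ, ∫ x in stripL m..stripR m, ∫ y in (-(n : ℝ))..n, h (x + y * Complex.I)
      = ∫ p in Set.Ioo (stripL m) (stripR m) ×ˢ Set.Ioc (-(n : ℝ)) n, onPlane h p := by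
    intro n
    have hsub : Set.Ioo (stripL m) (stripR m) ×ˢ Set.Ioc (-(n : ℝ)) n
      ⊆ Set.Ioo (stripL m) (stripR m) ×ˢ Set.univ := Set.prod_mono le_rfl (Set.subset_univ _)
    rw [Measure.volume_eq_prod, setIntegral_prod _ (by
      rw [← Measure.volume_eq_prod]; exact hi.mono_set hsub),
      intervalIntegral.integral_of_le (stripL_le_stripR m), integral_Ioc_eq_integral_Ioo]
    refine setIntegral_congr_fun measurableSet_Ioo fun x _ => ?_
    have hn : -(n : ℝ) ≤ n := by have : (0 : ℝ) ≤ n := n.cast_nonneg; linarith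
    exact intervalIntegral.integral_of_le hn
  simp only [e]
  rw [setIntegral_strip_eq]
  have hU : (⋃ n : ℕ, Set.Ioo (stripL m) (stripR m) ×ˢ Set.Ioc (-(n : ℝ)) n)
      = Set.Ioo (stripL m) (stripR m) ×ˢ (Set.univ : Set ℝ) := by
    rw [← Set.prod_iUnion]
    congr 1
    refine Set.eq_univ_of_forall fun y => ?_
    obtain ⟨n, hn⟩ := exists_nat_gt |y|
    have := abs_lt.mp hn
    exact Set.mem_iUnion.mpr ⟨n, this.1, this.2.le⟩
  rw [← hU]
  refine tendsto_setIntegral_of_monotone (fun n => measurableSet_Ioo.prod measurableSet_Ioc) ?_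
    (by rw [hU]; exact hi)
  intro i j hij
  have hij' : (i : ℝ) ≤ j := by exact_mod_cast hij
  exact Set.prod_mono le_rfl (Set.Ioc_subset_Ioc (by linarith) hij')

theorem integrableOn_strip_of_le {h : ℂ → E} {p q : ℝ → ℝ}
    (hm : AEStronglyMeasurable h (volume.restrict (strip m)))
    (hp : IntegrableOn p (Set.Ioo (stripL m) (stripR m))) (hq : Integrable q)
    (hle : ∀ z ∈ strip m, ‖h z‖ ≤ p z.re * q z.im) : IntegrableOn h (strip m) := by
  have h1 : IntegrableOn (fun z : ℂ => p z.re * q z.im) (strip m) := by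
    rw [integrableOn_strip_iff, IntegrableOn, Measure.volume_eq_prod, ← Measure.prod_restrict,
      Measure.restrict_univ]
    have := Integrable.mul_prod hp hq
    refine this.congr (Eventually.of_forall fun z => ?_)
    simp [onPlane]
  exact h1.mono' hm ((ae_restrict_iff' (measurableSet_strip m)).mpr (Eventually.of_forall hle))

end StripIntegral

/-! ### Bounds for the sine on the strip -/

section SinBounds

variable {m : ℕ}

theorem norm_sin_sq (z : ℂ) :
    ‖Complex.sin z‖ ^ 2 = Real.sin z.re ^ 2 + Real.sinh z.im ^ 2 := by
  rw [← Complex.normSq_eq_norm_sq, Complex.normSq_apply, Complex.sin_eq]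
  simp only [← Complex.ofReal_sin, ← Complex.ofReal_cos, ← Complex.ofReal_sinh,
    ← Complex.ofReal_cosh, Complex.add_re, Complex.add_im, Complex.mul_re, Complex.mul_im,
    Complex.ofReal_re, Complex.ofReal_im, Complex.I_re, Complex.I_im]
  have h1 := Real.cosh_sq z.im
  have h2 := Real.cos_sq' z.re
  ring_nf
  rw [h1, h2]
  ring

/-- From |sin z|² = sin²x + sinh²y, with sin²x ≥ 1/2 in this range and |sinh y| ≥ |y|. Quadratic
growth is enough for integrability in the vertical direction. -/
theorem le_norm_sin_sq {z : ℂ} (hz : z.re ∈ Set.Icc (Real.pi / 4) (3 * Real.pi / 4)) :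
    (1 + z.im ^ 2) / 2 ≤ ‖Complex.sin z‖ ^ 2 := by
  rw [norm_sin_sq]
  have h1 : z.im ^ 2 ≤ Real.sinh z.im ^ 2 := by
    rw [← sq_abs, ← sq_abs (Real.sinh _), Real.abs_sinh]
    have : |z.im| ≤ Real.sinh |z.im| := Real.self_le_sinh_iff.mpr (abs_nonneg _)
    gcongr
  have h2 : 1 / 2 ≤ Real.sin z.re ^ 2 := by
    have h3 : Real.cos (2 * z.re) ≤ 0 := by
      refine Real.cos_nonpos_of_pi_div_two_le_of_le ?_ ?_ <;> linarith [hz.1, hz.2]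
    rw [Real.sin_sq_eq_half_sub]
    linarith
  nlinarith [sq_nonneg z.im]

theorem closedStrip_subset (hm : 2 ≤ m) {x : ℝ} (hx : x ∈ Set.Icc (stripL m) (stripR m)) :
    x ∈ Set.Icc (Real.pi / 4) (3 * Real.pi / 4) := by
  have h : Real.pi / (2 * m) ≤ Real.pi / 4 := by
    have : (2 : ℝ) ≤ m := by exact_mod_cast hm
    gcongr
    linarith
  rw [stripL, stripR] at hx
  constructor <;> linarith [hx.1, hx.2]

theorem sin_ne_zero_of_closedStrip (hm : 2 ≤ m) {z : ℂ}
    (hz : z.re ∈ Set.Icc (stripL m) (stripR m)) : Complex.sin z ≠ 0 := by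
  have := closedStrip_subset hm hz
  exact sin_ne_zero_of_re (by linarith [Real.pi_pos, this.1]) (by linarith [Real.pi_pos, this.2])

end SinBounds

/-! ### Green's formula on the strip -/

section Green

/-- `f` is real differentiable at `z` with `2 i ∂f/∂z̄ = d`. -/
def HasDbarAt (f : ℂ → ℂ) (d z : ℂ) : Prop :=
  ∃ f' : ℂ →L[ℝ] ℂ, HasFDerivAt f f' z ∧ Complex.I • f' 1 - f' Complex.I = d

variable {f g : ℂ → ℂ} {d e z : ℂ}

theorem HasDbarAt.add (hf : HasDbarAt f d z) (hg : HasDbarAt g e z) :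
    HasDbarAt (fun w => f w + g w) (d + e) z := by
  obtain ⟨f', hf1, hf2⟩ := hf
  obtain ⟨g', hg1, hg2⟩ := hg
  refine ⟨f' + g', hf1.add hg1, ?_⟩
  simp only [add_apply, smul_eq_mul] at *
  rw [← hf2, ← hg2]; ring

theorem hasDbarAt_of_differentiableAt (hf : DifferentiableAt ℂ f z) : HasDbarAt f 0 z := by
  refine ⟨_, hf.hasDerivAt.complexToReal_fderiv, ?_⟩
  simp [mul_comm]

/-- In z̄ the real derivative is f' in direction 1 and -i f' in direction i, and i f' + i f' = 2i
f'. -/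
theorem hasDbarAt_comp_conj {f' : ℂ} (hf : HasDerivAt f f' (starRingEnd ℂ z)) :
    HasDbarAt (fun w => f (starRingEnd ℂ w)) (2 * Complex.I * f') z := by
  have h := hf.complexToReal_fderiv.comp z
    (Complex.conjCLE.toContinuousLinearMap.hasFDerivAt (x := z))
  refine ⟨_, h, ?_⟩
  simp
  ring

theorem HasDbarAt.hol_mul (hg : DifferentiableAt ℂ g z) (hf : HasDbarAt f d z) :
    HasDbarAt (fun w => g w * f w) (g z * d) z := by
  obtain ⟨f', hf1, hf2⟩ := hf
  refine ⟨_, hg.hasDerivAt.complexToReal_fderiv.mul hf1, ?_⟩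
  simp only [add_apply, smul_apply, smul_eq_mul,
    one_apply_eq_self] at *
  rw [← hf2]
  ring

theorem HasDbarAt.continuousAt (hf : HasDbarAt f d z) : ContinuousAt f z :=
  hf.choose_spec.1.continuousAt

/-- If `f` tends to `L` at the top of the plane, so do its averages over horizontal segments. -/
theorem tendsto_horizontal {l : Filter ℝ} {L : ℂ} {a b : ℝ} (hab : a ≤ b)
    (hf : Tendsto f (comap Complex.im l ⊓ 𝓟 {z | z.re ∈ Set.Icc a b}) (𝓝 L)) {t : ℕ → ℝ} (ht : Tendsto t atTop l)
    (hi : ∀ n, IntervalIntegrable (fun x : ℝ => f (x + t n * Complex.I)) volume a b) :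
    Tendsto (fun n => ∫ x in a..b, f (x + t n * Complex.I)) atTop (𝓝 ((b - a) * L)) := by
  rw [Metric.tendsto_atTop]
  intro ε hε
  have hpos : 0 < |b - a| + 1 := by positivity
  have h1 : ∀ᶠ y in l, ∀ z : ℂ, z.im = y → z.re ∈ Set.Icc a b → ‖f z - L‖ < ε / (|b - a| + 1) := by
    have := hf (Metric.ball_mem_nhds L (div_pos hε hpos))
    rw [mem_map, mem_inf_principal, mem_comap] at this
    obtain ⟨s, hs, hs'⟩ := this
    filter_upwards [hs] with y hy z hz hzr
    have : z ∈ Complex.im ⁻¹' s := by rw [Set.mem_preimage, hz]; exact hy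
    simpa [dist_eq_norm] using hs' this hzr
  obtain ⟨N, hN⟩ := eventually_atTop.mp (ht.eventually h1)
  refine ⟨N, fun n hn => ?_⟩
  have e : (b - a : ℂ) * L = ∫ _ in a..b, L := by
    rw [intervalIntegral.integral_const, Complex.real_smul]; push_cast; rfl
  rw [dist_eq_norm, e, ← intervalIntegral.integral_sub (hi n) intervalIntegrable_const]
  have h2 := intervalIntegral.norm_integral_le_of_norm_le_const (a := a) (b := b)
    (f := fun x : ℝ => f (x + t n * Complex.I) - L) (C := ε / (|b - a| + 1))
    (fun x hx => (hN n hn _ (by simp) (by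
      rw [Set.uIoc_of_le hab] at hx
      simpa using Set.Ioc_subset_Icc_self hx)).le)
  refine h2.trans_lt ?_
  rw [div_mul_eq_mul_div, div_lt_iff₀ hpos]
  nlinarith [abs_nonneg (b - a)]

/-- Green's formula for a function on the strip that takes the same values on its two edges. -/
theorem green_strip {m : ℕ} {f d : ℂ → ℂ} {Lt Lb : ℂ}
    (hd : ∀ z : ℂ, z.re ∈ Set.Icc (stripL m) (stripR m) → HasDbarAt f (d z) z)
    (hdc : ContinuousOn d {z | z.re ∈ Set.Icc (stripL m) (stripR m)})
    (hdi : IntegrableOn d (strip m))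
    (hper : ∀ y : ℝ, f (stripL m + y * Complex.I) = f (stripR m + y * Complex.I))
    (ht : Tendsto f (comap Complex.im atTop ⊓ 𝓟 {z | z.re ∈ Set.Icc (stripL m) (stripR m)})
      (𝓝 Lt))
    (hb : Tendsto f (comap Complex.im atBot ⊓ 𝓟 {z | z.re ∈ Set.Icc (stripL m) (stripR m)})
      (𝓝 Lb)) :
    ∫ z in strip m, d z = (stripR m - stripL m) * (Lb - Lt) := by
  have hle := stripL_le_stripR m
  have hd' : ∀ z : ℂ, ∃ f' : ℂ →L[ℝ] ℂ, z.re ∈ Set.Icc (stripL m) (stripR m) →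
      HasFDerivAt f f' z ∧ Complex.I • f' 1 - f' Complex.I = d z := by
    intro z
    by_cases hz : z.re ∈ Set.Icc (stripL m) (stripR m)
    · obtain ⟨f', hf'⟩ := hd z hz
      exact ⟨f', fun _ => hf'⟩
    · exact ⟨0, fun h => absurd h hz⟩
  choose f' hf' using hd'
  have hcont : ContinuousOn f {z | z.re ∈ Set.Icc (stripL m) (stripR m)} :=
    fun z hz => (hd z hz).continuousAt.continuousWithinAt
  have hhor : ∀ y : ℝ, IntervalIntegrable (fun x : ℝ => f (x + y * Complex.I)) volume
      (stripL m) (stripR m) := by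
    intro y
    refine ContinuousOn.intervalIntegrable ?_
    rw [Set.uIcc_of_le hle]
    refine hcont.comp (by fun_prop) fun x hx => ?_
    simpa using hx
  refine tendsto_nhds_unique (tendsto_iterated_strip hdi) ?_
  have key : ∀ n : ℕ, ∫ x in stripL m..stripR m, ∫ y in (-(n : ℝ))..n, d (x + y * Complex.I)
      = (∫ x in stripL m..stripR m, f (x + (-(n : ℝ) : ℝ) * Complex.I))
        - ∫ x in stripL m..stripR m, f (x + (n : ℝ) * Complex.I) := by
    intro n
    have hmem : ∀ z : ℂ, z ∈ (Set.uIcc (stripL m) (stripR m) ×ℂ Set.uIcc (-(n : ℝ)) n) →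
        z.re ∈ Set.Icc (stripL m) (stripR m) := by
      intro z hz
      rw [← Set.uIcc_of_le hle]
      exact hz.1
    have hcpt : IsCompact (Set.uIcc (stripL m) (stripR m) ×ℂ Set.uIcc (-(n : ℝ)) n) :=
      isCompact_uIcc.reProdIm isCompact_uIcc
    have hmeas := hcpt.measurableSet
    have g := Complex.integral_boundary_rect_of_hasFDerivAt_real_off_countable f f'
      ⟨stripL m, -(n : ℝ)⟩ ⟨stripR m, n⟩ ∅ Set.countable_empty
      (hcont.mono fun z hz => hmem z hz) (fun z hz => (hf' z ?_).1) ?_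
    -- Equal values on the two edges cancel the vertical sides of the rectangle.
    · simp only [hper] at g
      rw [add_sub_cancel_right] at g
      rw [g]
      refine intervalIntegral.integral_congr fun x hx => ?_
      refine intervalIntegral.integral_congr fun y _ => ?_
      rw [Set.uIcc_of_le hle] at hx
      exact ((hf' (x + y * Complex.I) (by simpa using hx)).2).symm
    · have := hz.1.1
      rw [min_eq_left hle, max_eq_right hle] at this
      exact Set.Ioo_subset_Icc_self this
    · refine IntegrableOn.congr_fun (f := d) ?_ (fun z hz => ((hf' z (hmem z hz)).2).symm) hmeas
      exact (hdc.mono fun z hz => hmem z hz).integrableOn_compact hcpt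
  simp only [key]
  have h1 := tendsto_horizontal hle hb (t := fun n : ℕ => -(n : ℝ))
    (tendsto_neg_atTop_atBot.comp tendsto_natCast_atTop_atTop) (fun n => hhor _)
  have h2 := tendsto_horizontal hle ht (t := fun n : ℕ => (n : ℝ))
    tendsto_natCast_atTop_atTop (fun n => hhor _)
  have := h1.sub h2
  rw [← mul_sub] at this
  exact this

end Green

end

end XXZ

namespace XXZ

noncomputable section

/-! ### The cotangent at the ends of the strip -/

section Cot

/-- The cotangent. -/
def cotan (z : ℂ) : ℂ := Complex.cos z / Complex.sin z

theorem hasDerivAt_cotan {z : ℂ} (hz : Complex.sin z ≠ 0) :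
    HasDerivAt cotan (-(1 / Complex.sin z ^ 2)) z := by
  have h := (Complex.hasDerivAt_cos z).div (Complex.hasDerivAt_sin z) hz
  refine h.congr_deriv ?_
  have := Complex.sin_sq_add_cos_sq z
  field_simp
  linear_combination -this

theorem one_add_cotan_sq {z : ℂ} (hz : Complex.sin z ≠ 0) :
    1 + cotan z ^ 2 = 1 / Complex.sin z ^ 2 := by
  have := Complex.sin_sq_add_cos_sq z
  rw [cotan]
  field_simp
  linear_combination this

theorem cotan_neg (z : ℂ) : cotan (-z) = -cotan z := by
  simp [cotan, div_neg]

theorem abs_im_le_norm_sin (z : ℂ) : |z.im| ≤ ‖Complex.sin z‖ := by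
  have h1 : z.im ^ 2 ≤ Real.sinh z.im ^ 2 := by
    rw [← sq_abs, ← sq_abs (Real.sinh _), Real.abs_sinh]
    have : |z.im| ≤ Real.sinh |z.im| := Real.self_le_sinh_iff.mpr (abs_nonneg _)
    gcongr
  refine abs_le_of_sq_le_sq ?_ (norm_nonneg _)
  rw [norm_sin_sq]
  nlinarith [sq_nonneg (Real.sin z.re)]

theorem tendsto_inv_sin_top :
    Tendsto (fun z => (Complex.sin z)⁻¹) (comap Complex.im atTop) (𝓝 0) := by
  refine tendsto_inv₀_cobounded.comp (tendsto_norm_atTop_iff_cobounded.mp ?_)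
  refine tendsto_atTop_mono (fun z => (le_abs_self _).trans (abs_im_le_norm_sin z)) tendsto_comap

theorem tendsto_neg_bot : Tendsto (fun z : ℂ => -z) (comap Complex.im atBot)
    (comap Complex.im atTop) := by
  rw [tendsto_comap_iff]
  exact tendsto_neg_atBot_atTop.comp tendsto_comap

theorem tendsto_inv_sin_bot :
    Tendsto (fun z => (Complex.sin z)⁻¹) (comap Complex.im atBot) (𝓝 0) := by
  have := (tendsto_inv_sin_top.comp tendsto_neg_bot).neg
  simpa [Function.comp_def, inv_neg] using this

theorem eventually_sin_ne_zero_top : ∀ᶠ z in comap Complex.im atTop, Complex.sin z ≠ 0 := by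
  filter_upwards [tendsto_comap.eventually (eventually_gt_atTop (0 : ℝ))] with z hz h
  have := abs_im_le_norm_sin z
  rw [h, norm_zero] at this
  exact absurd (abs_nonpos_iff.mp this) hz.ne'

theorem eventually_sin_ne_zero_bot : ∀ᶠ z in comap Complex.im atBot, Complex.sin z ≠ 0 := by
  filter_upwards [tendsto_neg_bot.eventually eventually_sin_ne_zero_top] with z hz
  simpa using hz

/-- cot z = -i + e^{iz}/sin z, where e^{iz} is bounded in the upper half plane and 1/sin z tends to
0. -/
theorem tendsto_cotan_top : Tendsto cotan (comap Complex.im atTop) (𝓝 (-Complex.I)) := by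
  have h1 : Tendsto (fun z => Complex.exp (Complex.I * z) * (Complex.sin z)⁻¹)
      (comap Complex.im atTop) (𝓝 0) := by
    refine squeeze_zero_norm' ?_ (tendsto_inv_sin_top.norm.trans (by simp))
    filter_upwards [tendsto_comap.eventually (eventually_gt_atTop (0 : ℝ))] with z hz
    rw [norm_mul]
    refine mul_le_of_le_one_left (norm_nonneg _) ?_
    rw [Complex.norm_exp]
    simpa using hz.le
  have h2 := h1.const_add (-Complex.I)
  rw [add_zero] at h2
  refine h2.congr' ?_
  filter_upwards [eventually_sin_ne_zero_top] with z hz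
  rw [cotan, mul_comm Complex.I z, Complex.exp_mul_I]
  field_simp
  ring

theorem tendsto_cotan_bot : Tendsto cotan (comap Complex.im atBot) (𝓝 Complex.I) := by
  have := (tendsto_cotan_top.comp tendsto_neg_bot).neg
  simpa [Function.comp_def, cotan_neg] using this

theorem tendsto_conj_top : Tendsto (starRingEnd ℂ) (comap Complex.im atTop)
    (comap Complex.im atBot) := by
  rw [tendsto_comap_iff]
  exact tendsto_neg_atTop_atBot.comp tendsto_comap

theorem tendsto_conj_bot : Tendsto (starRingEnd ℂ) (comap Complex.im atBot)
    (comap Complex.im atTop) := by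
  rw [tendsto_comap_iff]
  exact tendsto_neg_atBot_atTop.comp tendsto_comap

theorem tendsto_affine_top {m : ℕ} (hm : 1 ≤ m) (φ : ℂ) :
    Tendsto (fun z : ℂ => m * (φ + z)) (comap Complex.im atTop) (comap Complex.im atTop) := by
  rw [tendsto_comap_iff]
  have hm' : (0 : ℝ) < m := by exact_mod_cast hm
  have h := (tendsto_atTop_add_const_left _ φ.im
    (tendsto_comap : Tendsto Complex.im (comap Complex.im atTop) atTop)).const_mul_atTop hm'
  refine h.congr fun z => ?_
  simp

theorem tendsto_affine_bot {m : ℕ} (hm : 1 ≤ m) (φ : ℂ) :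
    Tendsto (fun z : ℂ => m * (φ + z)) (comap Complex.im atBot) (comap Complex.im atBot) := by
  rw [tendsto_comap_iff]
  have hm' : (0 : ℝ) < m := by exact_mod_cast hm
  have h := (tendsto_atBot_add_const_left _ φ.im
    (tendsto_comap : Tendsto Complex.im (comap Complex.im atBot) atBot)).const_mul_atBot hm'
  refine h.congr fun z => ?_
  simp

end Cot

/-! ### Explicit integrals over the strip. -/

section Strip

variable {m : ℕ}

theorem stripR_sub_stripL (m : ℕ) : stripR m - stripL m = Real.pi / m := by
  rw [stripR, stripL]; field_simp; ring

theorem stripL_add_stripR (m : ℕ) : stripL m + stripR m = Real.pi := by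
  rw [stripR, stripL]; ring

/-- The strip is symmetric about Re z = π/2. On the edges the dependence on z̄ thus turns into a
holomorphic dependence on the opposite edge point, so the edge condition of Green's formula becomes
a trigonometric identity. -/
theorem conj_left_edge (y : ℝ) : starRingEnd ℂ (stripL m + y * Complex.I)
    = Real.pi - (stripR m + y * Complex.I) := by
  rw [← stripL_add_stripR m]
  simp
  ring

theorem conj_right_edge (y : ℝ) : starRingEnd ℂ (stripR m + y * Complex.I)
    = Real.pi - (stripL m + y * Complex.I) := by
  rw [← stripL_add_stripR m]
  simp
  ring

theorem cotan_pi_sub (z : ℂ) : cotan (Real.pi - z) = -cotan z := by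
  rw [cotan, Complex.cos_pi_sub, Complex.sin_pi_sub, neg_div, cotan]

theorem sin_conj_ne_zero {z : ℂ} (hz : Complex.sin z ≠ 0) :
    Complex.sin (starRingEnd ℂ z) ≠ 0 := by
  rw [Complex.sin_conj]; simpa using hz

theorem continuousOn_sin_conj_inv (hm : 2 ≤ m) : ContinuousOn
    (fun z : ℂ => 1 / Complex.sin (starRingEnd ℂ z) ^ 2)
    {z | z.re ∈ Set.Icc (stripL m) (stripR m)} := by
  refine ContinuousOn.div (by fun_prop) ?_ fun z hz =>
    pow_ne_zero 2 (sin_conj_ne_zero (sin_ne_zero_of_closedStrip hm hz))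
  exact ((Complex.continuous_sin.comp Complex.continuous_conj).pow 2).continuousOn

theorem strip_subset_closedStrip : strip m ⊆ {z | z.re ∈ Set.Icc (stripL m) (stripR m)} :=
  fun _ hz => Set.Ioo_subset_Icc_self (mem_strip_iff.mp hz)

theorem one_div_norm_sin_sq_le {z : ℂ} (hm : 2 ≤ m) (hz : z ∈ strip m) :
    1 / ‖Complex.sin z‖ ^ 2 ≤ 2 * (1 + z.im ^ 2)⁻¹ := by
  have h := le_norm_sin_sq (closedStrip_subset hm (strip_subset_closedStrip hz))
  have h0 : 0 < 1 + z.im ^ 2 := by positivity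
  calc 1 / ‖Complex.sin z‖ ^ 2 ≤ 1 / ((1 + z.im ^ 2) / 2) :=
        one_div_le_one_div_of_le (by positivity) h
    _ = _ := by field_simp

/-- A bounded continuous function times `1 / sin² z̄` is integrable on the strip. -/
theorem integrableOn_mul_sin_conj_inv (hm : 2 ≤ m) {S : ℂ → ℂ}
    (hS : ContinuousOn S {z | z.re ∈ Set.Icc (stripL m) (stripR m)}) {M : ℝ}
    (hM : ∀ z ∈ strip m, ‖S z‖ ≤ M) :
    IntegrableOn (fun z => S z * (1 / Complex.sin (starRingEnd ℂ z) ^ 2)) (strip m) := by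
  refine integrableOn_strip_of_le (p := fun _ => M * 2) (q := fun y => (1 + y ^ 2)⁻¹) ?_ ?_ ?_ ?_
  · exact ((hS.mul (continuousOn_sin_conj_inv hm)).mono
      strip_subset_closedStrip).aestronglyMeasurable (measurableSet_strip m)
  · exact integrableOn_const (by simp)
  · exact integrable_inv_one_add_sq
  · intro z hz
    rw [norm_mul, norm_div, norm_one, norm_pow, Complex.sin_conj, RCLike.norm_conj, mul_assoc]
    exact mul_le_mul (hM z hz) (one_div_norm_sin_sq_le hm hz) (by positivity)
      ((norm_nonneg _).trans (hM z hz))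

/-- The limits control the two ends of the strip, and the remaining part lies in a compact
rectangle. -/
theorem closedStrip_bounded {S : ℂ → ℂ}
    (hS : ContinuousOn S {z | z.re ∈ Set.Icc (stripL m) (stripR m)}) {Lt Lb : ℂ}
    (ht : Tendsto S (comap Complex.im atTop) (𝓝 Lt))
    (hb : Tendsto S (comap Complex.im atBot) (𝓝 Lb)) :
    ∃ M, ∀ z ∈ strip m, ‖S z‖ ≤ M := by
  have key : ∀ {l : Filter ℝ} {L : ℂ}, Tendsto S (comap Complex.im l) (𝓝 L) →
      ∀ᶠ y in l, ∀ z : ℂ, z.im = y → ‖S z‖ ≤ ‖L‖ + 1 := by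
    intro l L h
    have h1 : ∀ᶠ z in comap Complex.im l, ‖S z‖ ≤ ‖L‖ + 1 :=
      (h.norm.eventually_lt_const (lt_add_one _)).mono fun _ h => h.le
    rw [eventually_comap] at h1
    exact h1
  obtain ⟨y1, h1⟩ := eventually_atTop.mp (key ht)
  obtain ⟨y2, h2⟩ := eventually_atBot.mp (key hb)
  have hcpt : IsCompact (Set.Icc (stripL m) (stripR m) ×ℂ Set.Icc y2 y1) :=
    isCompact_Icc.reProdIm isCompact_Icc
  obtain ⟨M, hM⟩ := hcpt.exists_bound_of_continuousOn (hS.mono fun z hz => hz.1)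
  refine ⟨max M (max (‖Lt‖ + 1) (‖Lb‖ + 1)), fun z hz => ?_⟩
  rcases le_total y1 z.im with h | h
  · exact (h1 _ h z rfl).trans ((le_max_left _ _).trans (le_max_right _ _))
  rcases le_total z.im y2 with h' | h'
  · exact (h2 _ h' z rfl).trans ((le_max_right _ _).trans (le_max_right _ _))
  · exact (hM z ⟨strip_subset_closedStrip hz, h', h⟩).trans (le_max_left _ _)

/-- Green's formula for cot z̄ - cot z. On either edge its value is minus the sum of the cotangents
of the two edge points at that height, and its limits are 2i at the top and -2i at the bottom. -/
theorem integral_sin_conj_inv (hm : 2 ≤ m) :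
    ∫ z in strip m, 1 / Complex.sin (starRingEnd ℂ z) ^ 2 = 2 * ((Real.pi / m : ℝ) : ℂ) := by
  have hint : IntegrableOn (fun z => 1 / Complex.sin (starRingEnd ℂ z) ^ 2) (strip m) := by
    simpa using integrableOn_mul_sin_conj_inv hm (S := fun _ => 1) continuousOn_const (M := 1)
      (by simp)
  have h := green_strip (m := m) (f := fun z => cotan (starRingEnd ℂ z) + -cotan z)
    (d := fun z => 2 * Complex.I * -(1 / Complex.sin (starRingEnd ℂ z) ^ 2) + 0)
    (Lt := Complex.I + -(-Complex.I)) (Lb := -Complex.I + -Complex.I)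
    (fun z hz => ?_) ?_ ?_ (fun y => ?_) ?_ ?_
  · simp only [add_zero] at h
    rw [integral_const_mul, integral_neg, ← Complex.ofReal_sub, stripR_sub_stripL] at h
    have h2 : 2 * Complex.I * (∫ z in strip m, 1 / Complex.sin (starRingEnd ℂ z) ^ 2)
        = 2 * Complex.I * (2 * ((Real.pi / m : ℝ) : ℂ)) := by
      linear_combination -h
    exact mul_left_cancel₀ (mul_ne_zero two_ne_zero Complex.I_ne_zero) h2
  · have hs := sin_ne_zero_of_closedStrip hm hz
    exact (hasDbarAt_comp_conj (hasDerivAt_cotan (sin_conj_ne_zero hs))).add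
      (hasDbarAt_of_differentiableAt (hasDerivAt_cotan hs).differentiableAt.neg)
  · exact ((continuousOn_sin_conj_inv hm).neg.const_mul _).add continuousOn_const
  · simpa [IntegrableOn] using hint.neg.const_mul (2 * Complex.I)
  · simp only [conj_left_edge, conj_right_edge, cotan_pi_sub]
    ring
  · exact ((tendsto_cotan_bot.comp tendsto_conj_top).add tendsto_cotan_top.neg).mono_left inf_le_left
  · exact ((tendsto_cotan_top.comp tendsto_conj_bot).add tendsto_cotan_bot.neg).mono_left inf_le_left

theorem norm_sin_pow_four (z : ℂ) : ((‖Complex.sin z‖ ^ 4 : ℝ) : ℂ)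
    = Complex.sin z ^ 2 * Complex.sin (starRingEnd ℂ z) ^ 2 := by
  rw [Complex.sin_conj, ← mul_pow, Complex.mul_conj, Complex.normSq_eq_norm_sq]
  push_cast; ring

/-- The subtraction formula for the cotangent, as the edge points differ by π/m. It is the only
relation between the two edges used in the next integral. -/
theorem cotan_edge (y : ℝ) (hm : 2 ≤ m) : cotan ((Real.pi / m : ℝ) : ℂ) *
    (cotan (stripL m + y * Complex.I) - cotan (stripR m + y * Complex.I))
      = 1 + cotan (stripL m + y * Complex.I) * cotan (stripR m + y * Complex.I) := by
  have hl : Complex.sin (stripL m + y * Complex.I) ≠ 0 :=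
    sin_ne_zero_of_closedStrip hm (by simpa using stripL_le_stripR m)
  have hr : Complex.sin (stripR m + y * Complex.I) ≠ 0 :=
    sin_ne_zero_of_closedStrip hm (by simpa using stripL_le_stripR m)
  have ha : Complex.sin ((Real.pi / m : ℝ) : ℂ) ≠ 0 := by
    exact_mod_cast (sin_pi_div_pos hm).ne'
  set zl := (stripL m : ℂ) + y * Complex.I with hzl
  set zr := (stripR m : ℂ) + y * Complex.I with hzr
  have e : ((Real.pi / m : ℝ) : ℂ) = zr - zl := by
    rw [← stripR_sub_stripL, hzl, hzr]; push_cast; ring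
  rw [e] at ha ⊢
  have h1 : cotan zl - cotan zr = Complex.sin (zr - zl) / (Complex.sin zl * Complex.sin zr) := by
    rw [Complex.sin_sub, cotan, cotan]; field_simp
  have h2 : 1 + cotan zl * cotan zr
      = Complex.cos (zr - zl) / (Complex.sin zl * Complex.sin zr) := by
    rw [Complex.cos_sub, cotan, cotan]; field_simp; ring
  rw [h1, h2, cotan]
  field_simp

/-- The natural primitive cot z̄ / sin² z has different values on the two edges, and the mismatch is
removed with the help of (z + z̄ - π)/sin² z, since z + z̄ - π equals -π/m on the left edge and π/m
on the right. This term is not holomorphic; its contribution is a multiple of the integral of 1/sin²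
z, which is the conjugate of the preceding one. A multiple of cot z removes the rest and supplies
the limits at ±i∞. -/
theorem integral_sin_inv_pow_four (hm : 2 ≤ m) :
    IntegrableOn (fun z => 1 / ‖Complex.sin z‖ ^ 4) (strip m) ∧
    ∫ z in strip m, 1 / ‖Complex.sin z‖ ^ 4
      = (2 * (Real.pi / m) - 2 * Real.sin (Real.pi / m) * Real.cos (Real.pi / m)) /
        Real.sin (Real.pi / m) ^ 2 := by
  set a : ℝ := Real.pi / m with ha
  have ha0 : a ≠ 0 := by
    have : (0 : ℝ) < m := by exact_mod_cast (by omega : 0 < m)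
    exact (div_pos Real.pi_pos this).ne'
  have hsa : Complex.sin (a : ℂ) ≠ 0 := by exact_mod_cast (sin_pi_div_pos hm).ne'
  have hac : (a : ℂ) ≠ 0 := by exact_mod_cast ha0
  -- Chosen so that q(z + z̄ - π) = ∓cot a on the edges, which `cotan_edge` can cancel.
  set q : ℂ := cotan (a : ℂ) / a with hq
  have hcsc : ContinuousOn (fun z : ℂ => 1 / Complex.sin z ^ 2)
      {z | z.re ∈ Set.Icc (stripL m) (stripR m)} :=
    continuousOn_const.div (Complex.continuous_sin.pow 2).continuousOn fun z hz =>
      pow_ne_zero 2 (sin_ne_zero_of_closedStrip hm hz)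
  have hcscT : Tendsto (fun z : ℂ => 1 / Complex.sin z ^ 2) (comap Complex.im atTop) (𝓝 0) := by
    simpa using tendsto_inv_sin_top.pow 2
  have hcscB : Tendsto (fun z : ℂ => 1 / Complex.sin z ^ 2) (comap Complex.im atBot) (𝓝 0) := by
    simpa using tendsto_inv_sin_bot.pow 2
  obtain ⟨M, hM⟩ := closedStrip_bounded hcsc hcscT hcscB
  have hint4 : IntegrableOn (fun z => 1 / Complex.sin z ^ 2 *
      (1 / Complex.sin (starRingEnd ℂ z) ^ 2)) (strip m) :=
    integrableOn_mul_sin_conj_inv hm hcsc hM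
  have hint2' : IntegrableOn (fun z => 1 / Complex.sin (starRingEnd ℂ z) ^ 2) (strip m) := by
    simpa using integrableOn_mul_sin_conj_inv hm (S := fun _ => 1) continuousOn_const (M := 1)
      (by simp)
  have econj : (fun z : ℂ => 1 / Complex.sin z ^ 2)
      = fun z => starRingEnd ℂ (1 / Complex.sin (starRingEnd ℂ z) ^ 2) := by
    ext z; simp [Complex.sin_conj]
  have hint2 : IntegrableOn (fun z => 1 / Complex.sin z ^ 2) (strip m) := by
    rw [econj]
    exact (Complex.conjLIE.integrable_comp_iff).mpr hint2'
  have hval2 : ∫ z in strip m, 1 / Complex.sin z ^ 2 = 2 * (a : ℂ) := by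
    rw [econj, integral_conj, integral_sin_conj_inv hm, ha, map_mul, Complex.conj_ofReal, map_ofNat]
  -- The combination contains z + z̄ - π = 2 Re z - π, which is bounded by π only inside the strip;
  -- hence the restriction of the filter.
  have hedge : ∀ {l : Filter ℝ}, Tendsto (fun z : ℂ => 1 / Complex.sin z ^ 2)
      (comap Complex.im l) (𝓝 0) → Tendsto (fun z : ℂ => -q / Complex.sin z ^ 2 * starRingEnd ℂ z
        + -q * (z - Real.pi) / Complex.sin z ^ 2)
      (comap Complex.im l ⊓ 𝓟 {z | z.re ∈ Set.Icc (stripL m) (stripR m)}) (𝓝 0) := by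
    intro l hl
    have h1 := (hl.mono_left (inf_le_left (b := 𝓟 {z | z.re ∈ Set.Icc (stripL m)
      (stripR m)}))).norm.mul_const (‖q‖ * Real.pi)
    rw [norm_zero, zero_mul] at h1
    refine squeeze_zero_norm' ?_ h1
    filter_upwards [mem_inf_of_right (mem_principal_self _)] with z hz
    have hre := closedStrip_subset hm hz
    have e1 : -q / Complex.sin z ^ 2 * starRingEnd ℂ z + -q * (z - Real.pi) / Complex.sin z ^ 2
        = 1 / Complex.sin z ^ 2 * (-q * ((2 * z.re - Real.pi : ℝ) : ℂ)) := by
      have := Complex.add_conj z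
      push_cast at this ⊢
      linear_combination (-q / Complex.sin z ^ 2) * this
    rw [e1, norm_mul, norm_mul, norm_neg, Complex.norm_real]
    gcongr
    rw [Real.norm_eq_abs, abs_le]
    constructor <;> linarith [hre.1, hre.2, Real.pi_pos]
  -- Green's formula
  have h := green_strip (m := m) (f := fun z => 1 / Complex.sin z ^ 2 * cotan (starRingEnd ℂ z)
      + (-q / Complex.sin z ^ 2 * starRingEnd ℂ z
        + (-q * (z - Real.pi) / Complex.sin z ^ 2 - 2 / Complex.sin (a : ℂ) ^ 2 * cotan z)))
    (d := fun z => 1 / Complex.sin z ^ 2 *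
        (2 * Complex.I * -(1 / Complex.sin (starRingEnd ℂ z) ^ 2))
      + (-q / Complex.sin z ^ 2 * (2 * Complex.I * 1) + 0))
    (Lt := -(2 / Complex.sin (a : ℂ) ^ 2 * -Complex.I))
    (Lb := -(2 / Complex.sin (a : ℂ) ^ 2 * Complex.I))
    (fun z hz => ?_) ?_ ?_ (fun y => ?_) ?_ ?_
  · have e1 : (fun z => 1 / Complex.sin z ^ 2 *
        (2 * Complex.I * -(1 / Complex.sin (starRingEnd ℂ z) ^ 2))
      + (-q / Complex.sin z ^ 2 * (2 * Complex.I * 1) + 0))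
        = fun z => -(2 * Complex.I) * (1 / Complex.sin z ^ 2 *
            (1 / Complex.sin (starRingEnd ℂ z) ^ 2))
          + -(2 * Complex.I * q) * (1 / Complex.sin z ^ 2) := by
      ext z; ring
    rw [e1, integral_add (hint4.const_mul _) (hint2.const_mul _), integral_const_mul,
      integral_const_mul, hval2, ← Complex.ofReal_sub, stripR_sub_stripL, ← ha] at h
    have e2 : ∀ z : ℂ, 1 / Complex.sin z ^ 2 * (1 / Complex.sin (starRingEnd ℂ z) ^ 2)
        = ((1 / ‖Complex.sin z‖ ^ 4 : ℝ) : ℂ) := by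
      intro z
      have h4 := norm_sin_pow_four z
      rw [Complex.ofReal_div, h4, one_div_mul_one_div]; simp
    simp only [e2] at h hint4
    refine ⟨?_, ?_⟩
    · exact Integrable.congr hint4.re (Eventually.of_forall fun z => Complex.ofReal_re _)
    · rw [integral_complex_ofReal] at h
      have h3 : 2 * Complex.I * ((∫ z in strip m, 1 / ‖Complex.sin z‖ ^ 4 : ℝ) : ℂ)
          = 2 * Complex.I * (((2 * a - 2 * Real.sin a * Real.cos a) / Real.sin a ^ 2 : ℝ) : ℂ) := by
        rw [hq, cotan] at h
        push_cast at h ⊢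
        field_simp at h ⊢
        linear_combination -h
      exact_mod_cast mul_left_cancel₀ (mul_ne_zero two_ne_zero Complex.I_ne_zero) h3
  · have hs := sin_ne_zero_of_closedStrip hm hz
    have hd2 : DifferentiableAt ℂ (fun z => 1 / Complex.sin z ^ 2) z :=
      (differentiableAt_const _).div (Complex.differentiableAt_sin.pow 2) (pow_ne_zero 2 hs)
    refine HasDbarAt.add ((hasDbarAt_comp_conj
      (hasDerivAt_cotan (sin_conj_ne_zero hs))).hol_mul hd2) (HasDbarAt.add
      (HasDbarAt.hol_mul ?_ (hasDbarAt_comp_conj (f := id) (hasDerivAt_id _)))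
      (hasDbarAt_of_differentiableAt ?_))
    · exact (differentiableAt_const _).div (Complex.differentiableAt_sin.pow 2) (pow_ne_zero 2 hs)
    · refine DifferentiableAt.sub (DifferentiableAt.div (by fun_prop)
        (Complex.differentiableAt_sin.pow 2) (pow_ne_zero 2 hs)) ?_
      exact (hasDerivAt_cotan hs).differentiableAt.const_mul _
  · refine (hcsc.mul ((continuousOn_sin_conj_inv hm).neg.const_mul _)).add
      (ContinuousOn.add ?_ continuousOn_const)
    simp only [neg_div]
    simpa [div_eq_mul_inv] using ((hcsc.const_mul q).neg.mul_const (2 * Complex.I * 1))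
  · have h1 := (hint4.const_mul (-(2 * Complex.I))).add (hint2.const_mul (-(2 * Complex.I * q)))
    refine h1.congr (Eventually.of_forall fun z => ?_)
    simp only [Pi.add_apply]
    ring
  · have hl : Complex.sin (stripL m + y * Complex.I) ≠ 0 :=
      sin_ne_zero_of_closedStrip hm (by simpa using stripL_le_stripR m)
    have hr : Complex.sin (stripR m + y * Complex.I) ≠ 0 :=
      sin_ne_zero_of_closedStrip hm (by simpa using stripL_le_stripR m)
    have hk := cotan_edge y hm
    simp only [conj_left_edge, conj_right_edge, cotan_pi_sub]
    set zl := (stripL m : ℂ) + y * Complex.I with hzl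
    set zr := (stripR m : ℂ) + y * Complex.I with hzr
    have e : (a : ℂ) = zr - zl := by
      rw [ha, ← stripR_sub_stripL, hzl, hzr]; push_cast; ring
    have hqa : q * (zr - zl) = cotan (a : ℂ) := by rw [hq, ← e]; field_simp
    rw [← ha] at hk
    clear_value zl zr q
    have el : ∀ x, x / Complex.sin zl ^ 2 = x * (1 + cotan zl ^ 2) := fun x => by
      rw [one_add_cotan_sq hl, mul_one_div]
    have er : ∀ x, x / Complex.sin zr ^ 2 = x * (1 + cotan zr ^ 2) := fun x => by
      rw [one_add_cotan_sq hr, mul_one_div]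
    have ea : ∀ x, x / Complex.sin (a : ℂ) ^ 2 = x * (1 + cotan (a : ℂ) ^ 2) := fun x => by
      rw [one_add_cotan_sq hsa, mul_one_div]
    simp only [el, er, ea]
    linear_combination (cotan zl - cotan zr - 2 * cotan (a : ℂ)) * hk
      + (2 + cotan zl ^ 2 + cotan zr ^ 2) * hqa
  · have h1 := hcscT.mul (tendsto_cotan_bot.comp tendsto_conj_top)
    have h2 := tendsto_cotan_top.const_mul (2 / Complex.sin (a : ℂ) ^ 2)
    have h3 := ((h1.mono_left inf_le_left).add (hedge hcscT)).sub (h2.mono_left inf_le_left)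
    rw [zero_mul, zero_add, zero_sub] at h3
    refine h3.congr fun z => ?_
    simp only [Function.comp_apply]
    ring
  · have h1 := hcscB.mul (tendsto_cotan_top.comp tendsto_conj_bot)
    have h2 := tendsto_cotan_bot.const_mul (2 / Complex.sin (a : ℂ) ^ 2)
    have h3 := ((h1.mono_left inf_le_left).add (hedge hcscB)).sub (h2.mono_left inf_le_left)
    rw [zero_mul, zero_add, zero_sub] at h3
    refine h3.congr fun z => ?_
    simp only [Function.comp_apply]
    ring

end Strip

end

end XXZ

namespace XXZ

noncomputable section

/-! ### The Fredholm equation -/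

section Fredholm

variable {m : ℕ} {φ : ℂ}

/-- The holomorphic part of the integrand of the Fredholm equation. -/
def fredholmS (m : ℕ) (φ z : ℂ) : ℂ :=
  chebU (φ + z) ((m : ℤ) - 2) / chebU (φ + z) ((m : ℤ) - 1) / Complex.sin z

/-- The holomorphic correction that makes the boundary terms of Green's formula cancel. -/
def fredholmG (m : ℕ) (φ z : ℂ) : ℂ :=
  Complex.sin φ * cotan z + Complex.cos φ * (Complex.cos (m * (φ + z)) /
    (chebU (φ + z) ((m : ℤ) - 1) * Complex.sin z * Complex.sin φ))

theorem re_add_of_mem_closedStrip {z : ℂ} (hφ : φ ∈ strip m)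
    (hz : z.re ∈ Set.Icc (stripL m) (stripR m)) :
    |(φ + z).re - Real.pi| < Real.pi / m := by
  have h := mem_strip_iff.mp hφ
  have h1 := stripL_add_stripR m
  have h2 := stripR_sub_stripL m
  rw [abs_lt, Complex.add_re]
  constructor <;> linarith [h.1, h.2, hz.1, hz.2]

theorem differentiable_chebU (j : ℤ) : Differentiable ℂ fun u => chebU u j :=
  (Polynomial.differentiable (Polynomial.Chebyshev.U ℂ j)).comp Complex.differentiable_cos

theorem differentiableAt_fredholmS (hm : 2 ≤ m) (hφ : φ ∈ strip m) {z : ℂ}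
    (hz : z.re ∈ Set.Icc (stripL m) (stripR m)) : DifferentiableAt ℂ (fredholmS m φ) z := by
  have hU := chebU_ne_zero (by omega) (re_add_of_mem_closedStrip hφ hz)
  have h : ∀ j, DifferentiableAt ℂ (fun z => chebU (φ + z) j) z := fun j =>
    (differentiable_chebU j).comp (differentiable_id.const_add φ) |>.differentiableAt
  exact ((h _).div (h _) hU).div Complex.differentiableAt_sin (sin_ne_zero_of_closedStrip hm hz)

theorem differentiableAt_fredholmG (hm : 2 ≤ m) (hφ : φ ∈ strip m) {z : ℂ}
    (hz : z.re ∈ Set.Icc (stripL m) (stripR m)) : DifferentiableAt ℂ (fredholmG m φ) z := by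
  have hU := chebU_ne_zero (by omega) (re_add_of_mem_closedStrip hφ hz)
  have hs := sin_ne_zero_of_closedStrip hm hz
  have h : ∀ j, DifferentiableAt ℂ (fun z => chebU (φ + z) j) z := fun j =>
    (differentiable_chebU j).comp (differentiable_id.const_add φ) |>.differentiableAt
  refine DifferentiableAt.add ((hasDerivAt_cotan hs).differentiableAt.const_mul _)
    (DifferentiableAt.const_mul (DifferentiableAt.div (by fun_prop)
      (((h _).mul Complex.differentiableAt_sin).mul_const _) ?_) _)
  exact mul_ne_zero (mul_ne_zero hU hs) (sin_ne_zero_of_mem_strip hm hφ)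

theorem chebU_sub_one_eq {u : ℂ} (hmu : Complex.sin (m * u) ≠ 0) :
    Complex.sin u ≠ 0 ∧ chebU u ((m : ℤ) - 1) = Complex.sin (m * u) / Complex.sin u ∧
      chebU u ((m : ℤ) - 2) = (Complex.sin (m * u) * Complex.cos u
        - Complex.cos (m * u) * Complex.sin u) / Complex.sin u := by
  have h1 := chebU_mul_sin u ((m : ℤ) - 1)
  have h2 := chebU_mul_sin u ((m : ℤ) - 2)
  push_cast at h1 h2
  rw [show ((m : ℂ) - 1 + 1) * u = m * u by ring] at h1
  rw [show ((m : ℂ) - 2 + 1) * u = m * u - u by ring, Complex.sin_sub] at h2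
  have hsu : Complex.sin u ≠ 0 := by
    intro h0; rw [h0, mul_zero] at h1; exact hmu h1.symm
  exact ⟨hsu, by rw [← h1]; field_simp, by rw [← h2]; field_simp⟩

/-- Where sin(m(φ + z)) ≠ 0 everything is polynomial in cot z and cot(m(φ + z)). The latter agrees
on the two edges and both have limits ∓i, so edge values and limits can be read off. -/
theorem fredholmS_eq {z : ℂ} (hz : Complex.sin z ≠ 0) (hmu : Complex.sin (m * (φ + z)) ≠ 0) :
    fredholmS m φ z = Complex.cos φ * cotan z - Complex.sin φ
      - cotan (m * (φ + z)) * (Complex.sin φ * cotan z + Complex.cos φ) := by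
  obtain ⟨h0, h1, h2⟩ := chebU_sub_one_eq hmu
  rw [fredholmS, h1, h2, cotan, cotan]
  field_simp
  rw [Complex.cos_add, Complex.sin_add]
  ring

theorem fredholmG_eq {z : ℂ} (hφ : Complex.sin φ ≠ 0) (hz : Complex.sin z ≠ 0)
    (hmu : Complex.sin (m * (φ + z)) ≠ 0) :
    fredholmG m φ z = Complex.sin φ * cotan z
      + Complex.cos φ * (cotan (m * (φ + z)) * (cotan z + cotan φ)) := by
  obtain ⟨h0, h1, -⟩ := chebU_sub_one_eq hmu
  rw [fredholmG, h1, cotan, cotan, cotan]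
  congr 2
  field_simp
  rw [Complex.sin_add]
  ring

theorem tendsto_fredholmS_top (hm : 2 ≤ m) (φ : ℂ) :
    Tendsto (fredholmS m φ) (comap Complex.im atTop) (𝓝 0) := by
  have ha := tendsto_affine_top (m := m) (by omega) φ
  have h1 := tendsto_cotan_top
  have h2 := tendsto_cotan_top.comp ha
  have h := ((h1.const_mul (Complex.cos φ)).sub_const (Complex.sin φ)).sub
    (h2.mul ((h1.const_mul (Complex.sin φ)).add_const (Complex.cos φ)))
  rw [show Complex.cos φ * -Complex.I - Complex.sin φ
    - -Complex.I * (Complex.sin φ * -Complex.I + Complex.cos φ) = 0 by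
      linear_combination -Complex.sin φ * Complex.I_mul_I] at h
  refine h.congr' ?_
  filter_upwards [eventually_sin_ne_zero_top, ha.eventually eventually_sin_ne_zero_top]
    with z hz hmu
  exact (fredholmS_eq hz hmu).symm

theorem tendsto_fredholmS_bot (hm : 2 ≤ m) (φ : ℂ) :
    Tendsto (fredholmS m φ) (comap Complex.im atBot) (𝓝 0) := by
  have ha := tendsto_affine_bot (m := m) (by omega) φ
  have h1 := tendsto_cotan_bot
  have h2 := tendsto_cotan_bot.comp ha
  have h := ((h1.const_mul (Complex.cos φ)).sub_const (Complex.sin φ)).sub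
    (h2.mul ((h1.const_mul (Complex.sin φ)).add_const (Complex.cos φ)))
  rw [show Complex.cos φ * Complex.I - Complex.sin φ
    - Complex.I * (Complex.sin φ * Complex.I + Complex.cos φ) = 0 by
      linear_combination -Complex.sin φ * Complex.I_mul_I] at h
  refine h.congr' ?_
  filter_upwards [eventually_sin_ne_zero_bot, ha.eventually eventually_sin_ne_zero_bot]
    with z hz hmu
  exact (fredholmS_eq hz hmu).symm

theorem tendsto_fredholmG_top (hm : 2 ≤ m) (hφ : Complex.sin φ ≠ 0) :
    Tendsto (fredholmG m φ) (comap Complex.im atTop) (𝓝 (Complex.sin φ * -Complex.I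
      + Complex.cos φ * (-Complex.I * (-Complex.I + cotan φ)))) := by
  have ha := tendsto_affine_top (m := m) (by omega) φ
  have h1 := tendsto_cotan_top
  have h := (h1.const_mul (Complex.sin φ)).add
    (((tendsto_cotan_top.comp ha).mul (h1.add_const (cotan φ))).const_mul (Complex.cos φ))
  refine h.congr' ?_
  filter_upwards [eventually_sin_ne_zero_top, ha.eventually eventually_sin_ne_zero_top]
    with z hz hmu
  exact (fredholmG_eq hφ hz hmu).symm

theorem tendsto_fredholmG_bot (hm : 2 ≤ m) (hφ : Complex.sin φ ≠ 0) :
    Tendsto (fredholmG m φ) (comap Complex.im atBot) (𝓝 (Complex.sin φ * Complex.I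
      + Complex.cos φ * (Complex.I * (Complex.I + cotan φ)))) := by
  have ha := tendsto_affine_bot (m := m) (by omega) φ
  have h1 := tendsto_cotan_bot
  have h := (h1.const_mul (Complex.sin φ)).add
    (((tendsto_cotan_bot.comp ha).mul (h1.add_const (cotan φ))).const_mul (Complex.cos φ))
  refine h.congr' ?_
  filter_upwards [eventually_sin_ne_zero_bot, ha.eventually eventually_sin_ne_zero_bot]
    with z hz hmu
  exact (fredholmG_eq hφ hz hmu).symm

theorem continuousOn_fredholmS (hm : 2 ≤ m) (hφ : φ ∈ strip m) :
    ContinuousOn (fredholmS m φ) {z | z.re ∈ Set.Icc (stripL m) (stripR m)} :=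
  fun _ hz => (differentiableAt_fredholmS hm hφ hz).continuousAt.continuousWithinAt

theorem integrableOn_fredholm (hm : 2 ≤ m) (hφ : φ ∈ strip m) :
    IntegrableOn (fun z => fredholmS m φ z * (1 / Complex.sin (starRingEnd ℂ z) ^ 2))
      (strip m) := by
  obtain ⟨M, hM⟩ := closedStrip_bounded (continuousOn_fredholmS hm hφ)
    (tendsto_fredholmS_top hm φ) (tendsto_fredholmS_bot hm φ)
  exact integrableOn_mul_sin_conj_inv hm (continuousOn_fredholmS hm hφ) hM

/-- The strip has width π/m, so the two arguments differ by a period π of the cotangent. -/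
theorem cotan_mul_edge (hm : 2 ≤ m) (φ : ℂ) (y : ℝ) :
    cotan (m * (φ + (stripR m + y * Complex.I))) = cotan (m * (φ + (stripL m + y * Complex.I))) := by
  have hmc : (m : ℂ) ≠ 0 := by exact_mod_cast (by omega : m ≠ 0)
  have e : (m : ℂ) * (φ + (stripR m + y * Complex.I))
      = m * (φ + (stripL m + y * Complex.I)) + Real.pi := by
    have h : (stripR m : ℂ) = stripL m + Real.pi / m := by
      have := stripR_sub_stripL m
      have h2 : stripR m = stripL m + Real.pi / m := by linarith
      rw [h2]; push_cast; ring
    rw [h]; field_simp; ring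
  rw [e, cotan, Complex.cos_add_pi, Complex.sin_add_pi, neg_div_neg_eq, cotan]

/-- Green's formula for `fredholmS` times cot z̄ plus `fredholmG`. The first factor vanishes at both
ends of the strip, so only the limits of `fredholmG` count, and they differ by 2i(sin φ + cos φ cot
φ) = 2i/sin φ. -/
theorem integral_fredholm (hm : 2 ≤ m) (hφ : φ ∈ strip m) :
    ∫ z in strip m, fredholmS m φ z * (1 / Complex.sin (starRingEnd ℂ z) ^ 2)
      = -((Real.pi / m : ℝ) : ℂ) / Complex.sin φ := by
  have hsφ := sin_ne_zero_of_mem_strip hm hφ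
  have hint := integrableOn_fredholm hm hφ
  have h := green_strip (m := m)
    (f := fun z => fredholmS m φ z * cotan (starRingEnd ℂ z) + fredholmG m φ z)
    (d := fun z => fredholmS m φ z *
      (2 * Complex.I * -(1 / Complex.sin (starRingEnd ℂ z) ^ 2)) + 0)
    (fun z hz => ?_) ?_ ?_ (fun y => ?_)
    (((tendsto_fredholmS_top hm φ).mul (tendsto_cotan_bot.comp tendsto_conj_top)).add
      (tendsto_fredholmG_top hm hsφ) |>.mono_left inf_le_left)
    (((tendsto_fredholmS_bot hm φ).mul (tendsto_cotan_top.comp tendsto_conj_bot)).add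
      (tendsto_fredholmG_bot hm hsφ) |>.mono_left inf_le_left)
  · have e : (fun z => fredholmS m φ z *
        (2 * Complex.I * -(1 / Complex.sin (starRingEnd ℂ z) ^ 2)) + 0)
        = fun z => -(2 * Complex.I) *
          (fredholmS m φ z * (1 / Complex.sin (starRingEnd ℂ z) ^ 2)) := by
      ext z; ring
    rw [e, integral_const_mul, ← Complex.ofReal_sub, stripR_sub_stripL] at h
    refine mul_left_cancel₀ (neg_ne_zero.mpr (mul_ne_zero two_ne_zero Complex.I_ne_zero)) ?_
    rw [h, cotan]
    have := Complex.sin_sq_add_cos_sq φ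
    field_simp
    linear_combination (2 * ((Real.pi / m : ℝ) : ℂ)) * this
  · have hs := sin_ne_zero_of_closedStrip hm hz
    exact HasDbarAt.add ((hasDbarAt_comp_conj (hasDerivAt_cotan (sin_conj_ne_zero hs))).hol_mul
      (differentiableAt_fredholmS hm hφ hz))
      (hasDbarAt_of_differentiableAt (differentiableAt_fredholmG hm hφ hz))
  · exact ((continuousOn_fredholmS hm hφ).mul
      ((continuousOn_sin_conj_inv hm).neg.const_mul _)).add continuousOn_const
  · refine (hint.const_mul (-(2 * Complex.I))).congr (Eventually.of_forall fun z => ?_)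
    simp only
    ring
  · have hmem : ∀ t : ℝ, t ∈ Set.Icc (stripL m) (stripR m) →
        ((t : ℂ) + y * Complex.I).re ∈ Set.Icc (stripL m) (stripR m) := fun t ht => by simpa using ht
    have hl := hmem _ (Set.left_mem_Icc.mpr (stripL_le_stripR m))
    have hr := hmem _ (Set.right_mem_Icc.mpr (stripL_le_stripR m))
    have hsl := sin_ne_zero_of_closedStrip hm hl
    have hsr := sin_ne_zero_of_closedStrip hm hr
    have hφ' := mem_strip_iff.mp hφ
    have hsum := stripL_add_stripR m
    -- A zero on an edge would force φ + z = π and put φ on the opposite edge, but φ is interior.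
    have hmu : ∀ t : ℝ, (t = stripL m ∨ t = stripR m) →
        Complex.sin (m * (φ + (t + y * Complex.I))) ≠ 0 := by
      intro t ht h0
      have htm : t ∈ Set.Icc (stripL m) (stripR m) := by
        rcases ht with rfl | rfl
        · exact Set.left_mem_Icc.mpr (stripL_le_stripR m)
        · exact Set.right_mem_Icc.mpr (stripL_le_stripR m)
      have h1 := eq_pi_of_sin_eq_zero (by omega)
        (re_add_of_mem_closedStrip hφ (hmem t htm)) h0
      have h2 := congrArg Complex.re h1
      simp at h2
      rcases ht with rfl | rfl <;> linarith [hφ'.1, hφ'.2]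
    simp only [conj_left_edge, conj_right_edge, cotan_pi_sub]
    rw [fredholmS_eq hsl (hmu _ (Or.inl rfl)), fredholmS_eq hsr (hmu _ (Or.inr rfl)),
      fredholmG_eq hsφ hsl (hmu _ (Or.inl rfl)), fredholmG_eq hsφ hsr (hmu _ (Or.inr rfl)),
      cotan_mul_edge hm]
    ring

/-- The normalization `2 m sin² (π l / m) / π` of the solution of the Fredholm equation. -/
def weightConst (l m : ℕ) : ℝ := 2 * m * Real.sin (Real.pi * l / m) ^ 2 / Real.pi

/-- |sin z|⁴ = sin² z · sin² z̄, and one factor sin z cancels against the kernel. The rest is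
holomorphic apart from 1/sin² z̄. -/
theorem kernel_mul_weight {l : ℕ} (hm : 2 ≤ m) (hl : Real.sin (Real.pi * l / m) ≠ 0)
    (hφ : φ ∈ strip m) {z : ℂ} (hz : z ∈ strip m) :
    kernel l m φ z * (weight (weightConst l m) z : ℂ)
      = -(m * Complex.sin φ / Real.pi) *
        (fredholmS m φ z * (1 / Complex.sin (starRingEnd ℂ z) ^ 2)) := by
  have hs := sin_ne_zero_of_mem_strip hm hz
  have hs' := sin_conj_ne_zero hs
  have hlc : (Real.sin (Real.pi * l / m) : ℂ) ≠ 0 := by exact_mod_cast hl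
  have hpi : (Real.pi : ℂ) ≠ 0 := by exact_mod_cast Real.pi_ne_zero
  rw [kernel_eq l hm (re_add_of_mem_strip hφ hz), weight, weightConst, Complex.ofReal_div _ (_ ^ 4),
    norm_sin_pow_four, fredholmS]
  rw [Complex.ofReal_div, Complex.ofReal_mul, Complex.ofReal_mul, Complex.ofReal_pow]
  generalize (Real.sin (Real.pi * l / m) : ℂ) = s at *
  generalize chebU (φ + z) ((m : ℤ) - 2) / chebU (φ + z) ((m : ℤ) - 1) = q
  push_cast
  field_simp

theorem weightConst_pos {l : ℕ} (hm : 2 ≤ m) (hl : Real.sin (Real.pi * l / m) ≠ 0) :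
    0 < weightConst l m := by
  have : (0 : ℝ) < m := by exact_mod_cast (by omega : 0 < m)
  have := Real.pi_pos
  rw [weightConst]
  positivity

theorem solvesFredholm {l : ℕ} (hm : 2 ≤ m) (hl : Real.sin (Real.pi * l / m) ≠ 0) :
    SolvesFredholm l m (weight (weightConst l m)) := by
  intro φ hφ
  have he := fun z (hz : z ∈ strip m) => kernel_mul_weight hm hl hφ hz
  have hsφ := sin_ne_zero_of_mem_strip hm hφ
  have hpi : (Real.pi : ℂ) ≠ 0 := by exact_mod_cast Real.pi_ne_zero
  have hmc : (m : ℂ) ≠ 0 := by exact_mod_cast (by omega : m ≠ 0)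
  constructor
  · refine IntegrableOn.congr_fun ((integrableOn_fredholm hm hφ).const_mul _)
      (fun z hz => (he z hz).symm) (measurableSet_strip m)
  · rw [setIntegral_congr_fun (measurableSet_strip m) he, integral_const_mul,
      integral_fredholm hm hφ]
    push_cast
    field_simp

theorem integrableOn_weight (hm : 2 ≤ m) (c : ℝ) : IntegrableOn (weight c) (strip m) := by
  refine ((integral_sin_inv_pow_four hm).1.const_mul c).congr (Eventually.of_forall fun z => ?_)
  simp [weight, div_eq_mul_inv]

theorem integral_weight (l : ℕ) (hm : 2 ≤ m) :
    (1 / 4 : ℝ) * ∫ z in strip m, weight (weightConst l m) z = drudeBound l m := by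
  have e : (fun z => weight (weightConst l m) z)
      = fun z => weightConst l m * (1 / ‖Complex.sin z‖ ^ 4) := by
    ext z; rw [weight, mul_one_div]
  have hs := (sin_pi_div_pos hm).ne'
  have hm0 : (m : ℝ) ≠ 0 := by exact_mod_cast (by omega : m ≠ 0)
  have hpi := Real.pi_ne_zero
  have e2 : 2 * Real.pi / m = 2 * (Real.pi / m) := by ring
  rw [e, integral_const_mul, (integral_sin_inv_pow_four hm).2, weightConst, drudeBound, e2,
    Real.sin_two_mul]
  field_simp
  ring

end Fredholm

end

end XXZ

namespace XXZ

noncomputable section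

/-! ### The overlap of the charges with the current -/

section CurrentOverlap

variable (γ : ℝ) (φ : ℂ)

/-- The string with `α` at `x`, `β` at `x + 1`, and `0` elsewhere. -/
def bondString (n x : ℕ) (α β : SpinLabel) : Fin n → SpinLabel :=
  fun y => if (y : ℕ) = x then α else if (y : ℕ) = x + 1 then β else .zero

theorem siteOp_mul_siteOp (n x : ℕ) (α β : SpinLabel) :
    siteOp n x α * siteOp n (x + 1) β = tensor fun y => pauli (bondString n x α β y) := by
  rw [siteOp, siteOp, tensor_mul_tensor]
  congr 1
  ext1 y
  rw [bondString]
  split_ifs with h1 h2 h3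
  · omega
  · rw [mul_one]
  · rw [one_mul]
  · rw [one_mul, pauli]

theorem bondString_succ (n x : ℕ) (α β : SpinLabel) :
    bondString (n + 1) (x + 1) α β
      = (Fin.cons .zero (bondString n x α β) : Fin (n + 1) → SpinLabel) := by
  ext1 y
  refine Fin.cases ?_ (fun y => ?_) y
  · simp [bondString]
  · simp [bondString]

theorem bondString_zero (n : ℕ) (α β : SpinLabel) :
    bondString (n + 2) 0 α β
      = (Fin.cons α (Fin.cons β fun _ => .zero : Fin (n + 1) → SpinLabel) :
        Fin (n + 2) → SpinLabel) := by
  ext1 y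
  refine Fin.cases ?_ (fun y => Fin.cases ?_ (fun y => ?_) y) y
  · simp [bondString]
  · simp [bondString]
  · simp [bondString]

theorem laxVec_zeros (n : ℕ) : laxVec γ φ (fun _ : Fin n => .zero) = ket .right := by
  induction n with
  | zero => exact laxVec_zero γ φ _
  | succ n ih =>
    have e : (fun _ : Fin (n + 1) => SpinLabel.zero)
        = (Fin.cons .zero fun _ => .zero : Fin (n + 1) → SpinLabel) := by
      ext1 y
      refine Fin.cases ?_ (fun y => ?_) y <;> simp
    rw [e, laxVec_cons, ih, lax_ket]
    rfl

/-- The identity letter fixes |R⟩ and the coordinate along |L⟩, so the amplitude does not depend on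
the position of the bond. -/
theorem laxVec_bondString {n x : ℕ} (hx : x + 1 < n) (α β : SpinLabel) :
    laxVec γ φ (bondString n x α β) .left = laxCoord γ φ (lax γ φ β (ket .right)) α .left := by
  induction n generalizing x with
  | zero => omega
  | succ n ih =>
    rcases x with _ | x
    · obtain ⟨n, rfl⟩ : ∃ k, n = k + 1 := ⟨n - 1, by omega⟩
      rw [bondString_zero, laxVec_cons, laxVec_cons, laxVec_zeros, lax_apply]
    · rw [bondString_succ, laxVec_cons, lax_apply, laxCoord, ih (by omega)]

theorem prod_pauliWeight_bondString {n x : ℕ} (hx : x + 1 < n) (α β : SpinLabel) :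
    ∏ y, pauliWeight (bondString n x α β y) = pauliWeight α * pauliWeight β := by
  induction n generalizing x with
  | zero => omega
  | succ n ih =>
    rcases x with _ | x
    · obtain ⟨n, rfl⟩ : ∃ k, n = k + 1 := ⟨n - 1, by omega⟩
      rw [bondString_zero, Fin.prod_univ_succ, Fin.prod_univ_succ]
      simp [pauliWeight]
    · rw [bondString_succ, Fin.prod_univ_succ]
      rw [← ih (x := x) (by omega)]
      simp only [Fin.cons_zero, Fin.cons_succ]
      rw [show pauliWeight .zero = 1 from rfl, one_mul]

theorem hsInner_tensor_charge {n : ℕ} (s : Fin n → SpinLabel) :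
    hsInner n (tensor fun y => pauli (s y)) (charge γ n φ)
      = laxVec γ φ s .left * ∏ y, pauliWeight (s y) := by
  rw [charge_eq, hsInner_sum_right, Finset.sum_eq_single s]
  · simp only [hsInner_smul_right, hsInner_tensor, trace_pauli_conjTranspose_mul, if_true]
  · intro β _ hβ
    obtain ⟨x, hx⟩ := Function.ne_iff.mp hβ
    rw [hsInner_smul_right, hsInner_tensor, Finset.prod_eq_zero (Finset.mem_univ x), mul_zero]
    rw [trace_pauli_conjTranspose_mul, if_neg (Ne.symm hx)]
  · simp

/-- On a bond only the order σ⁻ ⊗ σ⁺ has a nonzero amplitude, ⟨L|L⁻L⁺|R⟩ = 1. With norm weight 1/4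
and conjugated prefactor -4i each bond contributes i. -/
theorem hsInner_current_charge (n : ℕ) (hn : 1 ≤ n) :
    hsInner n (current n) (charge γ n φ) = Complex.I * ((n : ℂ) - 1) := by
  rw [current, hsInner_sum_left]
  have h : ∀ x ∈ Finset.range (n - 1), hsInner n ((4 * Complex.I) •
      (siteOp n x .plus * siteOp n (x + 1) .minus - siteOp n x .minus * siteOp n (x + 1) .plus))
      (charge γ n φ) = Complex.I := by
    intro x hx
    have hx' : x + 1 < n := by have := Finset.mem_range.mp hx; omega
    rw [hsInner_smul_left, hsInner_sub_left, siteOp_mul_siteOp, siteOp_mul_siteOp,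
      hsInner_tensor_charge, hsInner_tensor_charge, laxVec_bondString γ φ hx',
      laxVec_bondString γ φ hx', prod_pauliWeight_bondString hx',
      prod_pauliWeight_bondString hx']
    simp only [laxCoord, lax_apply, pauliWeight, map_mul, map_ofNat, Complex.conj_I]
    rw [ket]
    simp
    ring
  rw [Finset.sum_congr rfl h, Finset.sum_const, Finset.card_range, nsmul_eq_mul,
    Nat.cast_sub hn]
  push_cast
  ring

end CurrentOverlap

end

end XXZ

namespace XXZ

noncomputable section

/-! ### The Hilbert-Schmidt norm -/

section HSNorm

variable {n : ℕ}

/-- The Hilbert-Schmidt norm `√(A, A)`. -/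
def hsNorm (n : ℕ) (A : ChainOp n) : ℝ := Real.sqrt (hsInner n A A).re

theorem hsNorm_nonneg (A : ChainOp n) : 0 ≤ hsNorm n A := Real.sqrt_nonneg _

theorem hsNorm_sq (A : ChainOp n) : hsNorm n A ^ 2 = (hsInner n A A).re :=
  Real.sq_sqrt (hsInner_self_re_nonneg A)

theorem norm_hsInner_le (A B : ChainOp n) : ‖hsInner n A B‖ ≤ hsNorm n A * hsNorm n B := by
  refine abs_le_of_sq_le_sq' ?_ (mul_nonneg (hsNorm_nonneg A) (hsNorm_nonneg B)) |>.2
  rw [mul_pow, hsNorm_sq, hsNorm_sq]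
  exact norm_hsInner_sq_le A B

theorem hsNorm_smul (c : ℂ) (A : ChainOp n) : hsNorm n (c • A) = ‖c‖ * hsNorm n A := by
  have h : (hsInner n (c • A) (c • A)).re = ‖c‖ ^ 2 * (hsInner n A A).re := by
    rw [hsInner_smul_left, hsInner_smul_right, ← mul_assoc, mul_comm (starRingEnd ℂ c),
      Complex.mul_conj, Complex.normSq_eq_norm_sq, Complex.re_ofReal_mul]
  rw [hsNorm, h, Real.sqrt_mul (sq_nonneg _), Real.sqrt_sq (norm_nonneg _), hsNorm]

theorem hsNorm_add_le (A B : ChainOp n) : hsNorm n (A + B) ≤ hsNorm n A + hsNorm n B := by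
  refine abs_le_of_sq_le_sq' ?_ (add_nonneg (hsNorm_nonneg A) (hsNorm_nonneg B)) |>.2
  have h1 := (Complex.re_le_norm _).trans (norm_hsInner_le A B)
  have h2 := (Complex.re_le_norm _).trans (norm_hsInner_le B A)
  rw [hsNorm_sq, hsInner_add_left, hsInner_add_right, hsInner_add_right]
  simp only [Complex.add_re]
  rw [← hsNorm_sq, ← hsNorm_sq]
  nlinarith

theorem hsNorm_zero : hsNorm n (0 : ChainOp n) = 0 := by
  simp [hsNorm, hsInner, tracial]

theorem hsNorm_neg (A : ChainOp n) : hsNorm n (-A) = hsNorm n A := by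
  rw [← neg_one_smul ℂ A, hsNorm_smul]; simp

theorem hsNorm_sub_le (A B : ChainOp n) : hsNorm n (A - B) ≤ hsNorm n A + hsNorm n B := by
  rw [sub_eq_add_neg]
  exact (hsNorm_add_le _ _).trans (by rw [hsNorm_neg])

theorem hsNorm_sum_le {ι : Type*} (s : Finset ι) (f : ι → ChainOp n) :
    hsNorm n (∑ i ∈ s, f i) ≤ ∑ i ∈ s, hsNorm n (f i) := by
  classical
  induction s using Finset.induction_on with
  | empty => simp [hsNorm_zero]
  | insert a s ha ih =>
    rw [Finset.sum_insert ha, Finset.sum_insert ha]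
    exact (hsNorm_add_le _ _).trans (by linarith)

theorem hsNorm_one : hsNorm n (1 : ChainOp n) = 1 := by
  simp [hsNorm, hsInner, tracial_one]

theorem hsInner_conjTranspose (A B : ChainOp n) :
    hsInner n A.conjTranspose B.conjTranspose = hsInner n B A := by
  rw [hsInner, hsInner, Matrix.conjTranspose_conjTranspose, tracial_mul_comm]

theorem hsNorm_conjTranspose (A : ChainOp n) : hsNorm n A.conjTranspose = hsNorm n A := by
  rw [hsNorm, hsInner_conjTranspose, hsNorm]

/-- Pythagoras: ‖A‖² = ‖PA‖² + ‖QA‖². It gives the contraction property without an operator norm. -/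
theorem hsNorm_mul_le_of_add_eq_one {P Q : ChainOp n}
    (h : P.conjTranspose * P + Q.conjTranspose * Q = 1) (A : ChainOp n) :
    hsNorm n (P * A) ≤ hsNorm n A := by
  refine Real.sqrt_le_sqrt ?_
  have e : hsInner n A A = hsInner n (P * A) (P * A) + hsInner n (Q * A) (Q * A) := by
    simp only [hsInner, Matrix.conjTranspose_mul]
    rw [← tracial_add]
    congr 1
    have : A.conjTranspose * A
        = A.conjTranspose * (P.conjTranspose * P + Q.conjTranspose * Q) * A := by
      rw [h, Matrix.mul_one]
    rw [this]
    noncomm_ring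
  rw [e, Complex.add_re]
  have := hsInner_self_re_nonneg (Q * A)
  linarith

end HSNorm

/-! ### Site operators are contractions -/

section SiteOp

variable {n : ℕ}

/-- The one-site matrix `M` at site `x`. -/
def siteMat (n x : ℕ) (M : Matrix (Fin 2) (Fin 2) ℂ) : ChainOp n :=
  tensor fun y : Fin n => if (y : ℕ) = x then M else 1

theorem siteMat_mul (x : ℕ) (M N : Matrix (Fin 2) (Fin 2) ℂ) :
    siteMat n x M * siteMat n x N = siteMat n x (M * N) := by
  rw [siteMat, siteMat, tensor_mul_tensor, siteMat]
  congr 1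
  ext1 y
  split_ifs <;> simp

theorem siteMat_add {x : ℕ} (hx : x < n) (M N : Matrix (Fin 2) (Fin 2) ℂ) :
    siteMat n x M + siteMat n x N = siteMat n x (M + N) := by
  ext σ τ
  simp only [siteMat, tensor, Matrix.add_apply, Matrix.of_apply]
  rw [← Finset.mul_prod_erase _ _ (Finset.mem_univ (⟨x, hx⟩ : Fin n)),
    ← Finset.mul_prod_erase _ _ (Finset.mem_univ (⟨x, hx⟩ : Fin n)),
    ← Finset.mul_prod_erase _ _ (Finset.mem_univ (⟨x, hx⟩ : Fin n))]
  have h : ∀ K : Matrix (Fin 2) (Fin 2) ℂ, ∏ y ∈ Finset.univ.erase (⟨x, hx⟩ : Fin n),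
      (if (y : ℕ) = x then K else 1) (σ y) (τ y)
      = ∏ y ∈ Finset.univ.erase (⟨x, hx⟩ : Fin n),
        (1 : Matrix (Fin 2) (Fin 2) ℂ) (σ y) (τ y) := by
    intro K
    refine Finset.prod_congr rfl fun y hy => ?_
    rw [if_neg]
    intro h
    exact (Finset.ne_of_mem_erase hy) (Fin.ext h)
  rw [h, h, h]
  simp [add_mul]

theorem siteMat_conjTranspose (x : ℕ) (M : Matrix (Fin 2) (Fin 2) ℂ) :
    (siteMat n x M).conjTranspose = siteMat n x M.conjTranspose := by
  rw [siteMat, tensor_conjTranspose, siteMat]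
  congr 1
  ext1 y
  split_ifs <;> simp

theorem siteMat_one (x : ℕ) : siteMat n x 1 = 1 := by
  rw [siteMat, ← tensor_one]
  congr 1
  ext1 y
  split_ifs <;> rfl

theorem siteOp_eq (x : ℕ) (α : SpinLabel) : siteOp n x α = siteMat n x (pauli α) := rfl

/-- The label of the adjoint of `σ^α`. -/
def SpinLabel.adj : SpinLabel → SpinLabel
  | .zero => .zero
  | .plus => .minus
  | .minus => .plus
  | .z => .z

theorem pauli_conjTranspose (α : SpinLabel) : (pauli α).conjTranspose = pauli α.adj := by
  ext i j
  cases α <;> fin_cases i <;> fin_cases j <;>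
    simp [pauli, SpinLabel.adj, Matrix.conjTranspose_apply]

theorem siteOp_conjTranspose (x : ℕ) (α : SpinLabel) :
    (siteOp n x α).conjTranspose = siteOp n x α.adj := by
  rw [siteOp_eq, siteMat_conjTranspose, pauli_conjTranspose, siteOp_eq]

theorem exists_pauli_complement (α : SpinLabel) : ∃ Q : Matrix (Fin 2) (Fin 2) ℂ,
    (pauli α).conjTranspose * pauli α + Q.conjTranspose * Q = 1 := by
  refine ⟨match α with
    | .zero => 0
    | .plus => !![1, 0; 0, 0]
    | .minus => !![0, 0; 0, 1]
    | .z => 0, ?_⟩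
  ext i j
  cases α <;> fin_cases i <;> fin_cases j <;>
    simp [pauli, Matrix.mul_apply, Fin.sum_univ_two, Matrix.conjTranspose_apply]

theorem hsNorm_siteOp_mul_le {x : ℕ} (hx : x < n) (α : SpinLabel) (A : ChainOp n) :
    hsNorm n (siteOp n x α * A) ≤ hsNorm n A := by
  obtain ⟨Q, hQ⟩ := exists_pauli_complement α
  refine hsNorm_mul_le_of_add_eq_one (Q := siteMat n x Q) ?_ A
  rw [siteOp_eq, siteMat_conjTranspose, siteMat_conjTranspose, siteMat_mul, siteMat_mul,
    siteMat_add hx, hQ, siteMat_one]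

end SiteOp

/-! ### Local operators -/

section Local

variable {n : ℕ}

/-- The operators supported on the sites in `S`. -/
def localOps (n : ℕ) (S : Set ℕ) : Submodule ℂ (ChainOp n) :=
  Submodule.span ℂ {A | ∃ a : Fin n → Matrix (Fin 2) (Fin 2) ℂ,
    (∀ x : Fin n, (x : ℕ) ∉ S → a x = 1) ∧ A = tensor a}

theorem tensor_mem_localOps {S : Set ℕ} {a : Fin n → Matrix (Fin 2) (Fin 2) ℂ}
    (h : ∀ x : Fin n, (x : ℕ) ∉ S → a x = 1) : tensor a ∈ localOps n S :=
  Submodule.subset_span ⟨a, h, rfl⟩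

theorem localOps_mono {S T : Set ℕ} (h : S ⊆ T) : localOps n S ≤ localOps n T := by
  refine Submodule.span_mono ?_
  rintro A ⟨a, ha, rfl⟩
  exact ⟨a, fun x hx => ha x fun h' => hx (h h'), rfl⟩

theorem siteOp_mem_localOps {S : Set ℕ} {x : ℕ} (hx : x ∈ S) (α : SpinLabel) :
    siteOp n x α ∈ localOps n S := by
  refine tensor_mem_localOps fun y hy => if_neg ?_
  rintro rfl
  exact hy hx

theorem mul_mem_localOps {S : Set ℕ} {A B : ChainOp n} (hA : A ∈ localOps n S)
    (hB : B ∈ localOps n S) : A * B ∈ localOps n S := by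
  induction hA using Submodule.span_induction with
  | mem A h =>
    obtain ⟨a, ha, rfl⟩ := h
    induction hB using Submodule.span_induction with
    | mem B h =>
      obtain ⟨b, hb, rfl⟩ := h
      rw [tensor_mul_tensor]
      exact tensor_mem_localOps fun x hx => by rw [ha x hx, hb x hx, one_mul]
    | zero => rw [mul_zero]; exact zero_mem _
    | add B C _ _ h1 h2 => rw [mul_add]; exact add_mem h1 h2
    | smul c B _ h => rw [Matrix.mul_smul]; exact Submodule.smul_mem _ _ h
  | zero => rw [zero_mul]; exact zero_mem _
  | add A C _ _ h1 h2 => rw [add_mul]; exact add_mem h1 h2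
  | smul c A _ h => rw [Matrix.smul_mul]; exact Submodule.smul_mem _ _ h

theorem conjTranspose_mem_localOps {S : Set ℕ} {A : ChainOp n} (hA : A ∈ localOps n S) :
    A.conjTranspose ∈ localOps n S := by
  induction hA using Submodule.span_induction with
  | mem A h =>
    obtain ⟨a, ha, rfl⟩ := h
    rw [tensor_conjTranspose]
    exact tensor_mem_localOps fun x hx => by rw [ha x hx, Matrix.conjTranspose_one]
  | zero => rw [Matrix.conjTranspose_zero]; exact zero_mem _
  | add A C _ _ h1 h2 => rw [Matrix.conjTranspose_add]; exact add_mem h1 h2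
  | smul c A _ h => rw [Matrix.conjTranspose_smul]; exact Submodule.smul_mem _ _ h

theorem localOps_commute {S T : Set ℕ} (hST : Disjoint S T) {A B : ChainOp n}
    (hA : A ∈ localOps n S) (hB : B ∈ localOps n T) : A * B = B * A := by
  induction hA using Submodule.span_induction with
  | mem A h =>
    obtain ⟨a, ha, rfl⟩ := h
    induction hB using Submodule.span_induction with
    | mem B h =>
      obtain ⟨b, hb, rfl⟩ := h
      rw [tensor_mul_tensor, tensor_mul_tensor]
      congr 1
      ext1 x
      by_cases hx : (x : ℕ) ∈ S
      · rw [hb x (Set.disjoint_left.mp hST hx), mul_one, one_mul]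
      · rw [ha x hx, mul_one, one_mul]
    | zero => rw [mul_zero, zero_mul]
    | add B C _ _ h1 h2 => rw [mul_add, add_mul, h1, h2]
    | smul c B _ h => rw [Matrix.mul_smul, Matrix.smul_mul, h]
  | zero => rw [mul_zero, zero_mul]
  | add A C _ _ h1 h2 => rw [mul_add, add_mul, h1, h2]
  | smul c A _ h => rw [Matrix.mul_smul, Matrix.smul_mul, h]

theorem tracial_mul_of_disjoint {S T : Set ℕ} (hST : Disjoint S T) {A B : ChainOp n}
    (hA : A ∈ localOps n S) (hB : B ∈ localOps n T) :
    tracial n (A * B) = tracial n A * tracial n B := by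
  induction hA using Submodule.span_induction with
  | mem A h =>
    obtain ⟨a, ha, rfl⟩ := h
    induction hB using Submodule.span_induction with
    | mem B h =>
      obtain ⟨b, hb, rfl⟩ := h
      rw [tensor_mul_tensor, tracial_tensor, tracial_tensor, tracial_tensor,
        ← Finset.prod_mul_distrib]
      refine Finset.prod_congr rfl fun x _ => ?_
      by_cases hx : (x : ℕ) ∈ S
      · rw [hb x (Set.disjoint_left.mp hST hx), mul_one]; simp
      · rw [ha x hx, one_mul]; simp
    | zero => rw [mul_zero, tracial_zero, mul_zero]
    | add B C _ _ h1 h2 => rw [mul_add, tracial_add, tracial_add, mul_add, h1, h2]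
    | smul c B _ h => rw [Matrix.mul_smul, tracial_smul, tracial_smul, h]; ring
  | zero => rw [zero_mul, tracial_zero, zero_mul]
  | add A C _ _ h1 h2 => rw [add_mul, tracial_add, tracial_add, add_mul, h1, h2]
  | smul c A _ h => rw [Matrix.smul_mul, tracial_smul, tracial_smul, h]; ring

/-- The tracial state is a product state, so correlations of disjointly supported operators
factorize. This exact clustering makes all later sums over sites local. -/
theorem hsInner_eq_zero_of_disjoint {S T : Set ℕ} (hST : Disjoint S T) {A B : ChainOp n}
    (hA : A ∈ localOps n S) (hB : B ∈ localOps n T) (h0 : tracial n B = 0) :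
    hsInner n A B = 0 := by
  rw [hsInner, tracial_mul_of_disjoint hST (conjTranspose_mem_localOps hA) hB, h0, mul_zero]

end Local

/-! ### Derivations and local currents -/

section Derivation

variable {n : ℕ} (Δ : ℝ)

/-- The bond energy. -/
def bondH (n x : ℕ) : ChainOp n :=
  (2 : ℂ) • (siteOp n x .plus * siteOp n (x + 1) .minus
        + siteOp n x .minus * siteOp n (x + 1) .plus)
      + (Δ : ℂ) • (siteOp n x .z * siteOp n (x + 1) .z)

/-- The local current. -/
def bondJ (n x : ℕ) : ChainOp n :=
  (4 * Complex.I) • (siteOp n x .plus * siteOp n (x + 1) .minus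
      - siteOp n x .minus * siteOp n (x + 1) .plus)

/-- The Hamiltonian of a set of bonds. -/
def hamOn (n : ℕ) (s : Finset ℕ) : ChainOp n := ∑ b ∈ s, bondH Δ n b

theorem hamiltonian_eq (n : ℕ) : hamiltonian Δ n = hamOn Δ n (Finset.range (n - 1)) := rfl

theorem current_eq (n : ℕ) : current n = ∑ x ∈ Finset.range (n - 1), bondJ n x := rfl

/-- The derivation `A ↦ i [H, A]`. -/
def deriv (H : ChainOp n) : ChainOp n →ₗ[ℂ] ChainOp n where
  toFun A := Complex.I • (H * A - A * H)
  map_add' A B := by rw [mul_add, add_mul, ← smul_add]; congr 1; abel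
  map_smul' c A := by
    rw [Matrix.mul_smul, Matrix.smul_mul, ← smul_sub, smul_comm, RingHom.id_apply]

theorem deriv_apply (H A : ChainOp n) : deriv H A = Complex.I • (H * A - A * H) := rfl

theorem bond_mem_localOps (x : ℕ) (α β : SpinLabel) :
    siteOp n x α * siteOp n (x + 1) β ∈ localOps n {x, x + 1} :=
  mul_mem_localOps (siteOp_mem_localOps (by simp) _) (siteOp_mem_localOps (by simp) _)

theorem bondH_mem (x : ℕ) : bondH Δ n x ∈ localOps n {x, x + 1} :=
  add_mem (Submodule.smul_mem _ _ (add_mem (bond_mem_localOps _ _ _) (bond_mem_localOps _ _ _)))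
    (Submodule.smul_mem _ _ (bond_mem_localOps _ _ _))

theorem bondJ_mem (x : ℕ) : bondJ n x ∈ localOps n {x, x + 1} :=
  Submodule.smul_mem _ _ (sub_mem (bond_mem_localOps _ _ _) (bond_mem_localOps _ _ _))

theorem bond_adj (x : ℕ) (α β : SpinLabel) :
    (siteOp n x α * siteOp n (x + 1) β).conjTranspose
      = siteOp n x α.adj * siteOp n (x + 1) β.adj := by
  rw [Matrix.conjTranspose_mul, siteOp_conjTranspose, siteOp_conjTranspose]
  exact localOps_commute (S := {x + 1}) (T := {x}) (by simp)
    (siteOp_mem_localOps (by simp) _) (siteOp_mem_localOps (by simp) _)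

theorem bondH_conjTranspose (x : ℕ) : (bondH Δ n x).conjTranspose = bondH Δ n x := by
  rw [bondH, Matrix.conjTranspose_add, Matrix.conjTranspose_smul, Matrix.conjTranspose_smul,
    Matrix.conjTranspose_add, bond_adj, bond_adj, bond_adj]
  simp only [SpinLabel.adj]
  simp [add_comm]

theorem bondJ_conjTranspose (x : ℕ) : (bondJ n x).conjTranspose = bondJ n x := by
  rw [bondJ, Matrix.conjTranspose_smul, Matrix.conjTranspose_sub, bond_adj, bond_adj]
  simp only [SpinLabel.adj]
  rw [← neg_sub, smul_neg, ← neg_smul]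
  congr 1
  simp

theorem hamiltonian_conjTranspose (n : ℕ) :
    (hamiltonian Δ n).conjTranspose = hamiltonian Δ n := by
  rw [hamiltonian_eq, hamOn, Matrix.conjTranspose_sum]
  exact Finset.sum_congr rfl fun x _ => bondH_conjTranspose Δ x

theorem current_conjTranspose (n : ℕ) : (current n).conjTranspose = current n := by
  rw [current_eq, Matrix.conjTranspose_sum]
  exact Finset.sum_congr rfl fun x _ => bondJ_conjTranspose x

theorem tracial_deriv (H A : ChainOp n) : tracial n (deriv H A) = 0 := by
  rw [deriv_apply, tracial_smul, tracial_sub, tracial_mul_comm, sub_self, mul_zero]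

theorem tracial_siteOp_mul {x : ℕ} (hx : x < n) (α β : SpinLabel)
    (h : (pauli α).trace = 0) : tracial n (siteOp n x α * siteOp n (x + 1) β) = 0 := by
  rw [tracial_mul_of_disjoint (S := {x}) (T := {x + 1}) (by simp)
    (siteOp_mem_localOps (by simp) _) (siteOp_mem_localOps (by simp) _), siteOp, tracial_tensor,
    Finset.prod_eq_zero (Finset.mem_univ (⟨x, hx⟩ : Fin n)), zero_mul]
  simp [h]

theorem tracial_bondJ {x : ℕ} (hx : x < n) : tracial n (bondJ n x) = 0 := by
  rw [bondJ, tracial_smul, tracial_sub, tracial_siteOp_mul hx, tracial_siteOp_mul hx]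
  · simp
  · simp [pauli, Matrix.trace_fin_two]
  · simp [pauli, Matrix.trace_fin_two]

variable {Δ}

theorem hsNorm_bond_mul_le {x : ℕ} (hx : x + 1 < n) (α β : SpinLabel) (A : ChainOp n) :
    hsNorm n (siteOp n x α * siteOp n (x + 1) β * A) ≤ hsNorm n A := by
  rw [mul_assoc]
  exact (hsNorm_siteOp_mul_le (by omega) _ _).trans (hsNorm_siteOp_mul_le hx _ _)

theorem hsNorm_bondH_mul_le (hΔ : |Δ| ≤ 1) {x : ℕ} (hx : x + 1 < n) (A : ChainOp n) :
    hsNorm n (bondH Δ n x * A) ≤ 5 * hsNorm n A := by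
  rw [bondH, add_mul, Matrix.smul_mul, Matrix.smul_mul, add_mul]
  have h1 := hsNorm_bond_mul_le hx .plus .minus A
  have h2 := hsNorm_bond_mul_le hx .minus .plus A
  have h3 := hsNorm_bond_mul_le hx .z .z A
  refine (hsNorm_add_le _ _).trans ?_
  rw [hsNorm_smul, hsNorm_smul, Complex.norm_real, Real.norm_eq_abs]
  have h4 := hsNorm_add_le (siteOp n x .plus * siteOp n (x + 1) .minus * A)
    (siteOp n x .minus * siteOp n (x + 1) .plus * A)
  have h5 := mul_le_mul hΔ h3 (hsNorm_nonneg _) zero_le_one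
  have h6 : ‖(2 : ℂ)‖ = 2 := by simp
  rw [h6]
  linarith

theorem hsNorm_mul_bondH_le (hΔ : |Δ| ≤ 1) {x : ℕ} (hx : x + 1 < n) (A : ChainOp n) :
    hsNorm n (A * bondH Δ n x) ≤ 5 * hsNorm n A := by
  rw [← hsNorm_conjTranspose, Matrix.conjTranspose_mul, bondH_conjTranspose]
  exact (hsNorm_bondH_mul_le hΔ hx _).trans (by rw [hsNorm_conjTranspose])

theorem hsNorm_deriv_bondH_le (hΔ : |Δ| ≤ 1) {x : ℕ} (hx : x + 1 < n) (A : ChainOp n) :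
    hsNorm n (deriv (bondH Δ n x) A) ≤ 10 * hsNorm n A := by
  rw [deriv_apply, hsNorm_smul, Complex.norm_I, one_mul]
  have h1 := hsNorm_bondH_mul_le hΔ hx A
  have h2 := hsNorm_mul_bondH_le hΔ hx A
  linarith [hsNorm_sub_le (bondH Δ n x * A) (A * bondH Δ n x)]

theorem hsNorm_bondJ_le {x : ℕ} (hx : x + 1 < n) : hsNorm n (bondJ n x) ≤ 8 := by
  have h1 := hsNorm_bond_mul_le hx .plus .minus (1 : ChainOp n)
  have h2 := hsNorm_bond_mul_le hx .minus .plus (1 : ChainOp n)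
  rw [mul_one, hsNorm_one] at h1 h2
  rw [bondJ, hsNorm_smul]
  have h3 : ‖(4 * Complex.I : ℂ)‖ = 4 := by simp
  rw [h3]
  linarith [hsNorm_sub_le (siteOp n x .plus * siteOp n (x + 1) .minus)
    (siteOp n x .minus * siteOp n (x + 1) .plus)]

theorem deriv_sum {ι : Type*} (s : Finset ι) (h : ι → ChainOp n) (A : ChainOp n) :
    deriv (∑ b ∈ s, h b) A = ∑ b ∈ s, deriv (h b) A := by
  simp only [deriv_apply, Finset.sum_mul, Finset.mul_sum, ← Finset.sum_sub_distrib,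
    Finset.smul_sum]

/-- The sites within distance `k` of the bond `x`. -/
def window (x k : ℕ) : Set ℕ := {y | x ≤ y + k ∧ y ≤ x + 1 + k}

/-- The bonds of `s` that touch the window. -/
def touching (s : Finset ℕ) (x k : ℕ) : Finset ℕ :=
  s.filter fun b => x ≤ b + 1 + k ∧ b ≤ x + 1 + k

theorem card_touching_le (s : Finset ℕ) (x k : ℕ) : (touching s x k).card ≤ 2 * k + 3 := by
  have h : touching s x k ⊆ Finset.Icc (x - (k + 1)) (x + 1 + k) := by
    intro b hb
    have := (Finset.mem_filter.mp hb).2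
    rw [Finset.mem_Icc]
    omega
  refine (Finset.card_le_card h).trans ?_
  rw [Nat.card_Icc]
  omega

theorem deriv_bondH_eq_zero {x k b : ℕ} (hb : ¬(x ≤ b + 1 + k ∧ b ≤ x + 1 + k)) {A : ChainOp n}
    (hA : A ∈ localOps n (window x k)) : deriv (bondH Δ n b) A = 0 := by
  rw [deriv_apply, localOps_commute ?_ (bondH_mem Δ b) hA, sub_self, smul_zero]
  rw [Set.disjoint_left]
  rintro y (rfl | rfl) hy
  · exact hb ⟨by have := hy.1; omega, hy.2⟩
  · exact hb ⟨hy.1, by have := hy.2; omega⟩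

/-- Bonds that miss the window commute with A. -/
theorem deriv_hamOn_eq {x k : ℕ} (s : Finset ℕ) {A : ChainOp n}
    (hA : A ∈ localOps n (window x k)) :
    deriv (hamOn Δ n s) A = ∑ b ∈ touching s x k, deriv (bondH Δ n b) A := by
  rw [hamOn, deriv_sum, touching, Finset.sum_filter]
  refine Finset.sum_congr rfl fun b _ => ?_
  split_ifs with h
  · rfl
  · exact deriv_bondH_eq_zero h hA

theorem deriv_hamOn_mem {x k : ℕ} (s : Finset ℕ) {A : ChainOp n}
    (hA : A ∈ localOps n (window x k)) :
    deriv (hamOn Δ n s) A ∈ localOps n (window x (k + 1)) := by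
  rw [deriv_hamOn_eq s hA]
  refine sum_mem fun b hb => ?_
  have hb' := (Finset.mem_filter.mp hb).2
  have h1 : bondH Δ n b ∈ localOps n (window x (k + 1)) := by
    refine localOps_mono ?_ (bondH_mem Δ b)
    rintro y (rfl | rfl) <;> constructor <;> omega
  have h2 : A ∈ localOps n (window x (k + 1)) := by
    refine localOps_mono ?_ hA
    rintro y ⟨h3, h4⟩
    constructor <;> omega
  exact Submodule.smul_mem _ _ (sub_mem (mul_mem_localOps h1 h2) (mul_mem_localOps h2 h1))

theorem deriv_pow_mem (s : Finset ℕ) (x k : ℕ) :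
    ((deriv (hamOn Δ n s)) ^ k) (bondJ n x) ∈ localOps n (window x k) := by
  induction k with
  | zero =>
    refine localOps_mono ?_ (bondJ_mem x)
    rintro y (rfl | rfl) <;> constructor <;> omega
  | succ k ih =>
    rw [pow_succ', Module.End.mul_apply]
    exact deriv_hamOn_mem s ih

/-- After k commutators the support is a window met by at most 2k + 3 ≤ 3(k + 1) bonds, and each
bond costs a factor 10. The factor 30(k + 1) per step gives a Taylor radius independent of n. -/
theorem hsNorm_deriv_pow_le (hΔ : |Δ| ≤ 1) {s : Finset ℕ} (hs : ∀ b ∈ s, b + 1 < n) {x : ℕ}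
    (hx : x + 1 < n) (k : ℕ) :
    hsNorm n (((deriv (hamOn Δ n s)) ^ k) (bondJ n x)) ≤ 8 * 30 ^ k * k.factorial := by
  induction k with
  | zero => simpa using hsNorm_bondJ_le hx
  | succ k ih =>
    rw [pow_succ', Module.End.mul_apply, deriv_hamOn_eq s (deriv_pow_mem s x k)]
    refine (hsNorm_sum_le _ _).trans ?_
    have h0 := Finset.sum_le_card_nsmul (touching s x k)
      (fun b => hsNorm n (deriv (bondH Δ n b) (((deriv (hamOn Δ n s)) ^ k) (bondJ n x))))
      (10 * (8 * 30 ^ k * k.factorial : ℝ)) fun b hb => by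
        refine (hsNorm_deriv_bondH_le hΔ (hs b (Finset.mem_filter.mp hb).1) _).trans ?_
        gcongr
    refine h0.trans ?_
    · rw [nsmul_eq_mul]
      have h1 : ((touching s x k).card : ℝ) ≤ 3 * (k + 1) := by
        have := card_touching_le s x k
        have h2 : (touching s x k).card ≤ 3 * (k + 1) := by omega
        exact_mod_cast h2
      refine (mul_le_mul_of_nonneg_right h1 (by positivity)).trans (le_of_eq ?_)
      rw [Nat.factorial_succ]
      push_cast
      ring

/-- The k-th nested commutator sees only the bonds within distance k; this removes the dependence on
the length of the chain. -/
theorem deriv_pow_congr {s t : Finset ℕ} {x k : ℕ}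
    (h : ∀ b, x ≤ b + k → b ≤ x + k → (b ∈ s ↔ b ∈ t)) :
    ((deriv (hamOn Δ n s)) ^ k) (bondJ n x) = ((deriv (hamOn Δ n t)) ^ k) (bondJ n x) := by
  induction k with
  | zero => rfl
  | succ k ih =>
    rw [pow_succ', pow_succ', Module.End.mul_apply, Module.End.mul_apply,
      ← ih fun b h1 h2 => h b (by omega) (by omega),
      deriv_hamOn_eq s (deriv_pow_mem s x k), deriv_hamOn_eq t (deriv_pow_mem s x k)]
    refine Finset.sum_congr ?_ fun _ _ => rfl
    ext b
    simp only [touching, Finset.mem_filter]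
    constructor
    · rintro ⟨h1, h2⟩
      exact ⟨(h b (by omega) (by omega)).mp h1, h2⟩
    · rintro ⟨h1, h2⟩
      exact ⟨(h b (by omega) (by omega)).mpr h1, h2⟩

theorem tracial_deriv_pow (s : Finset ℕ) {x : ℕ} (hx : x < n) (k : ℕ) :
    tracial n (((deriv (hamOn Δ n s)) ^ k) (bondJ n x)) = 0 := by
  rcases k with _ | k
  · exact tracial_bondJ hx
  · rw [pow_succ', Module.End.mul_apply, tracial_deriv]

end Derivation

end

end XXZ

namespace XXZ

noncomputable section

/-! ### Adding a site to the chain -/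

section Embedding

variable {n : ℕ}

/-- The embedding of the operators of the chain with the site `p` removed. -/
def embed (p : Fin (n + 1)) (A : ChainOp n) : ChainOp (n + 1) :=
  (Matrix.kroneckerMap (· * ·) (1 : Matrix (Fin 2) (Fin 2) ℂ) A).submatrix
    (Fin.insertNthEquiv (fun _ => Fin 2) p).symm (Fin.insertNthEquiv (fun _ => Fin 2) p).symm

variable (p : Fin (n + 1))

theorem embed_mul (A B : ChainOp n) : embed p (A * B) = embed p A * embed p B := by
  rw [embed, embed, embed, Matrix.submatrix_mul_equiv, ← Matrix.mul_kronecker_mul, one_mul]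

theorem embed_add (A B : ChainOp n) : embed p (A + B) = embed p A + embed p B := by
  ext σ τ
  simp [embed, mul_add]

theorem embed_smul (c : ℂ) (A : ChainOp n) : embed p (c • A) = c • embed p A := by
  ext σ τ
  simp [embed, mul_left_comm]

/-- `embed` as a linear map. -/
def embedLM : ChainOp n →ₗ[ℂ] ChainOp (n + 1) where
  toFun := embed p
  map_add' := embed_add p
  map_smul' := embed_smul p

theorem embedLM_apply (A : ChainOp n) : embedLM p A = embed p A := rfl

theorem embed_conjTranspose (A : ChainOp n) :
    embed p A.conjTranspose = (embed p A).conjTranspose := by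
  rw [embed, embed, Matrix.conjTranspose_submatrix, Matrix.conjTranspose_kronecker,
    Matrix.conjTranspose_one]

theorem tracial_embed (A : ChainOp n) : tracial (n + 1) (embed p A) = tracial n A := by
  have h : (embed p A).trace = 2 * A.trace := by
    have e : (embed p A).trace
        = (Matrix.kroneckerMap (· * ·) (1 : Matrix (Fin 2) (Fin 2) ℂ) A).trace :=
      Equiv.sum_comp (Fin.insertNthEquiv (fun _ => Fin 2) p).symm fun i =>
        Matrix.kroneckerMap (· * ·) (1 : Matrix (Fin 2) (Fin 2) ℂ) A i i
    rw [e, Matrix.trace_kronecker, Matrix.trace_one]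
    simp
  rw [tracial, tracial, h, pow_succ]
  field_simp

theorem hsInner_embed (A B : ChainOp n) :
    hsInner (n + 1) (embed p A) (embed p B) = hsInner n A B := by
  rw [hsInner, ← embed_conjTranspose, ← embed_mul, tracial_embed, hsInner]

theorem embed_tensor (a : Fin n → Matrix (Fin 2) (Fin 2) ℂ) :
    embed p (tensor a) = tensor (p.insertNth (α := fun _ => Matrix (Fin 2) (Fin 2) ℂ) 1 a) := by
  ext σ τ
  simp only [embed, tensor, Matrix.submatrix_apply, Matrix.of_apply, Matrix.kroneckerMap_apply]
  rw [Fin.prod_univ_succAbove _ p]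
  simp only [Fin.insertNth_apply_same, Fin.insertNth_apply_succAbove]
  rfl

theorem embed_last_siteOp {y : ℕ} (hy : y < n) (α : SpinLabel) :
    embed (Fin.last n) (siteOp n y α) = siteOp (n + 1) y α := by
  rw [siteOp, siteOp, embed_tensor]
  congr 1
  ext1 x
  refine Fin.lastCases ?_ (fun i => ?_) x
  · rw [Fin.insertNth_apply_same, if_neg]
    simp; omega
  · rw [← Fin.succAbove_last, Fin.insertNth_apply_succAbove]
    simp

theorem embed_zero_siteOp (y : ℕ) (α : SpinLabel) :
    embed (0 : Fin (n + 1)) (siteOp n y α) = siteOp (n + 1) (y + 1) α := by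
  rw [siteOp, siteOp, embed_tensor]
  congr 1
  ext1 x
  refine Fin.cases ?_ (fun i => ?_) x
  · rw [Fin.insertNth_apply_same, if_neg]
    simp
  · rw [← Fin.succAbove_zero, Fin.insertNth_apply_succAbove]
    simp

theorem embed_bondH {Δ : ℝ} {c x : ℕ}
    (h : ∀ α, embed p (siteOp n x α) = siteOp (n + 1) (x + c) α)
    (h' : ∀ α, embed p (siteOp n (x + 1) α) = siteOp (n + 1) (x + 1 + c) α) :
    embed p (bondH Δ n x) = bondH Δ (n + 1) (x + c) := by
  simp only [bondH, embed_add, embed_smul, embed_mul, h, h', add_right_comm x 1 c]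

theorem embed_bondJ {c x : ℕ}
    (h : ∀ α, embed p (siteOp n x α) = siteOp (n + 1) (x + c) α)
    (h' : ∀ α, embed p (siteOp n (x + 1) α) = siteOp (n + 1) (x + 1 + c) α) :
    embed p (bondJ n x) = bondJ (n + 1) (x + c) := by
  rw [bondJ, bondJ, embed_smul, ← embedLM_apply, map_sub, embedLM_apply, embedLM_apply]
  simp only [embed_mul, h, h', add_right_comm x 1 c]

theorem embed_deriv (H A : ChainOp n) : embed p (deriv H A) = deriv (embed p H) (embed p A) := by
  rw [deriv_apply, embed_smul, ← embedLM_apply, map_sub, embedLM_apply, embedLM_apply, embed_mul,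
    embed_mul, deriv_apply]

theorem embed_deriv_pow (H A : ChainOp n) (k : ℕ) :
    embed p ((deriv H ^ k) A) = (deriv (embed p H) ^ k) (embed p A) := by
  induction k with
  | zero => rfl
  | succ k ih => rw [pow_succ', pow_succ', Module.End.mul_apply, Module.End.mul_apply,
      embed_deriv, ih]

theorem embed_hamOn {Δ : ℝ} {c : ℕ} {s : Finset ℕ}
    (h : ∀ b ∈ s, embed p (bondH Δ n b) = bondH Δ (n + 1) (b + c)) :
    embed p (hamOn Δ n s) = hamOn Δ (n + 1) (s.image (· + c)) := by
  rw [hamOn, ← embedLM_apply, map_sum, hamOn, Finset.sum_image fun a _ b _ => by simp]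
  exact Finset.sum_congr rfl h

end Embedding

/-! ### Bulk values -/

section Bulk

variable {n : ℕ} {Δ : ℝ}

/-- The overlap of the current with the `k`-th derivative of a local current in the bulk. -/
def bulkValue (Δ : ℝ) (n x k : ℕ) : ℂ :=
  ∑ y ∈ Finset.Icc (x - (k + 1)) (x + (k + 1)), hsInner n (bondJ n y)
    ((deriv (hamOn Δ n (Finset.Icc (x - (k + 1)) (x + (k + 1)))) ^ k) (bondJ n x))

/-- The embedding is a ∗-homomorphism that preserves the normalized trace. The shift c is 1 for a
site added on the left and 0 for one on the right. -/
theorem bulkValue_embed (p : Fin (n + 1)) {c x k : ℕ} (hx : k + 1 ≤ x)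
    (h : ∀ y ≤ x + (k + 2), ∀ α, embed p (siteOp n y α) = siteOp (n + 1) (y + c) α) :
    bulkValue Δ (n + 1) (x + c) k = bulkValue Δ n x k := by
  have e : Finset.Icc (x + c - (k + 1)) (x + c + (k + 1))
      = (Finset.Icc (x - (k + 1)) (x + (k + 1))).image (· + c) := by
    rw [Finset.image_add_right_Icc]
    congr 1 <;> omega
  have hb : ∀ b ∈ Finset.Icc (x - (k + 1)) (x + (k + 1)),
      embed p (bondH Δ n b) = bondH Δ (n + 1) (b + c) := fun b hb => by
    have := (Finset.mem_Icc.mp hb).2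
    exact embed_bondH p (h b (by omega)) (h (b + 1) (by omega))
  rw [bulkValue, e, Finset.sum_image fun a _ b _ => by simp, bulkValue]
  refine Finset.sum_congr rfl fun y hy => ?_
  have hy' := (Finset.mem_Icc.mp hy).2
  rw [← embed_bondJ p (h y (by omega)) (h (y + 1) (by omega)),
    ← embed_bondJ p (h x (by omega)) (h (x + 1) (by omega)), ← embed_hamOn p hb,
    ← embed_deriv_pow, hsInner_embed]

/-- Any chain and any bulk position arise from the reference chain of length 2k + 4 with position k
+ 1 by adding sites on the left, then on the right. -/
theorem bulkValue_eq {x k : ℕ} (hx : k + 1 ≤ x) (hn : x + (k + 2) < n) :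
    bulkValue Δ n x k = bulkValue Δ (2 * k + 4) (k + 1) k := by
  have h1 : ∀ i, bulkValue Δ (2 * k + 4 + i) (k + 1 + i) k
      = bulkValue Δ (2 * k + 4) (k + 1) k := by
    intro i
    induction i with
    | zero => rfl
    | succ i ih =>
      rw [← ih]
      exact bulkValue_embed (0 : Fin (2 * k + 4 + i + 1)) (x := k + 1 + i) (c := 1) (by omega)
        fun y _ α => embed_zero_siteOp y α
  have h2 : ∀ i j, bulkValue Δ (2 * k + 4 + i + j) (k + 1 + i) k
      = bulkValue Δ (2 * k + 4) (k + 1) k := by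
    intro i j
    induction j with
    | zero => exact h1 i
    | succ j ih =>
      rw [← ih]
      exact bulkValue_embed (Fin.last (2 * k + 4 + i + j)) (x := k + 1 + i) (c := 0) (by omega)
        fun y hy α => embed_last_siteOp (by omega) α
  have := h2 (x - (k + 1)) (n - x - (k + 3))
  rwa [show k + 1 + (x - (k + 1)) = x by omega,
    show 2 * k + 4 + (x - (k + 1)) + (n - x - (k + 3)) = n by omega] at this

theorem hsInner_window {x y j k : ℕ} (h : x + j + k + 1 < y ∨ y + j + k + 1 < x)
    {A B : ChainOp n} (hA : A ∈ localOps n (window x j)) (hB : B ∈ localOps n (window y k))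
    (h0 : tracial n B = 0) : hsInner n A B = 0 := by
  refine hsInner_eq_zero_of_disjoint ?_ hA hB h0
  rw [Set.disjoint_left]
  rintro z ⟨h1, h2⟩ ⟨h3, h4⟩
  omega

theorem bondJ_mem_window (x : ℕ) : bondJ n x ∈ localOps n (window x 0) :=
  deriv_pow_mem (Δ := 0) ∅ x 0

/-- Locality is used twice: the Hamiltonian is cut to nearby bonds, and distant local currents drop
out by clustering. -/
theorem hsInner_hamOn_congr {x k : ℕ} (hx : k + 1 ≤ x) (hn : x + (k + 2) < n) :
    hsInner n (current n) ((deriv (hamiltonian Δ n) ^ k) (bondJ n x))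
      = bulkValue Δ (2 * k + 4) (k + 1) k := by
  rw [← bulkValue_eq hx hn, bulkValue, hamiltonian_eq, deriv_pow_congr
    (t := Finset.Icc (x - (k + 1)) (x + (k + 1))) ?_, current_eq, hsInner_sum_left]
  · symm
    refine Finset.sum_subset ?_ ?_
    · intro b hb
      rw [Finset.mem_Icc] at hb
      rw [Finset.mem_range]
      omega
    · intro b _ hb
      rw [Finset.mem_Icc] at hb
      exact hsInner_window (j := 0) (k := k) (by omega) (bondJ_mem_window b)
        (deriv_pow_mem _ x k) (tracial_deriv_pow _ (by omega) k)
  · intro b h1 h2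
    rw [Finset.mem_Icc, Finset.mem_range]
    omega

theorem norm_sum_le_of_near {B : ℝ} (hB : 0 ≤ B) (s : Finset ℕ) (x r : ℕ) {f : ℕ → ℂ}
    (h0 : ∀ y ∈ s, (x + r < y ∨ y + r < x) → f y = 0) (h1 : ∀ y ∈ s, ‖f y‖ ≤ B) :
    ‖∑ y ∈ s, f y‖ ≤ (2 * r + 1 : ℕ) * B := by
  classical
  have e : ∑ y ∈ s, f y = ∑ y ∈ s.filter (· ∈ Finset.Icc (x - r) (x + r)), f y := by
    rw [Finset.sum_filter]
    refine Finset.sum_congr rfl fun y hy => ?_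
    split_ifs with h
    · rfl
    · rw [Finset.mem_Icc] at h
      exact h0 y hy (by omega)
  rw [e]
  refine (norm_sum_le_of_le _ (f := f) (n := fun _ => B)
    fun y hy => h1 y (Finset.mem_filter.mp hy).1).trans ?_
  rw [Finset.sum_const, nsmul_eq_mul]
  refine mul_le_mul_of_nonneg_right ?_ hB
  have h2 : (s.filter (· ∈ Finset.Icc (x - r) (x + r))).card ≤ 2 * r + 1 := by
    refine (Finset.card_le_card (t := Finset.Icc (x - r) (x + r)) ?_).trans ?_
    · exact fun y hy => (Finset.mem_filter.mp hy).2
    · rw [Nat.card_Icc]; omega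
  exact_mod_cast h2

theorem norm_hsInner_current_deriv_pow_le (hΔ : |Δ| ≤ 1) {x : ℕ} (hx : x + 1 < n) (k : ℕ) :
    ‖hsInner n (current n) ((deriv (hamiltonian Δ n) ^ k) (bondJ n x))‖
      ≤ (2 * (k + 1) + 1 : ℕ) * (8 * (8 * 30 ^ k * k.factorial)) := by
  rw [current_eq, hsInner_sum_left, hamiltonian_eq]
  refine norm_sum_le_of_near (by positivity) _ x (k + 1) ?_ ?_
  · intro y _ h
    exact hsInner_window (j := 0) (k := k) (by omega) (bondJ_mem_window y)
      (deriv_pow_mem _ x k) (tracial_deriv_pow _ (by omega) k)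
  · intro y hy
    rw [Finset.mem_range] at hy
    refine (norm_hsInner_le _ _).trans (mul_le_mul (hsNorm_bondJ_le (by omega))
      (hsNorm_deriv_pow_le hΔ (fun b hb => ?_) hx k) (hsNorm_nonneg _) (by norm_num))
    rw [Finset.mem_range] at hb
    omega

/-- Local terms further apart than 2k + 1 are orthogonal, so the squared norm is linear in n. The at
most 4k + 3 ≤ 4·4ᵏ neighbours contribute 2·2ᵏ after the square root, which turns 8·30ᵏ into 16·60ᵏ.
-/
theorem hsNorm_deriv_pow_current_le (hΔ : |Δ| ≤ 1) (n k : ℕ) :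
    hsNorm n ((deriv (hamiltonian Δ n) ^ k) (current n))
      ≤ √n * (16 * (60 ^ k * k.factorial)) := by
  refine Real.sqrt_le_iff.mpr ⟨by positivity, ?_⟩
  have hb : ∀ b ∈ Finset.range (n - 1), b + 1 < n := fun b hb => by
    rw [Finset.mem_range] at hb; omega
  set b : ℝ := 8 * 30 ^ k * k.factorial with hbdef
  have hb0 : 0 ≤ b := by positivity
  have h1 : ‖hsInner n ((deriv (hamiltonian Δ n) ^ k) (current n))
      ((deriv (hamiltonian Δ n) ^ k) (current n))‖
      ≤ (n - 1 : ℕ) * ((2 * (2 * k + 1) + 1 : ℕ) * (b * b)) := by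
    rw [hamiltonian_eq, current_eq, map_sum, hsInner_sum_left]
    refine (norm_sum_le_of_le _ (n := fun _ => ((2 * (2 * k + 1) + 1 : ℕ) * (b * b) : ℝ))
      fun x hx => ?_).trans ?_
    · rw [hsInner_sum_right]
      refine norm_sum_le_of_near (by positivity) _ x (2 * k + 1) ?_ ?_
      · intro y hy h
        exact hsInner_window (j := k) (k := k) (by omega) (deriv_pow_mem _ x k)
          (deriv_pow_mem _ y k) (tracial_deriv_pow _ (by have := hb y hy; omega) k)
      · intro y hy
        exact (norm_hsInner_le _ _).trans (mul_le_mul (hsNorm_deriv_pow_le hΔ hb (hb x hx) k)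
          (hsNorm_deriv_pow_le hΔ hb (hb y hy) k) (hsNorm_nonneg _) hb0)
    · rw [Finset.sum_const, Finset.card_range, nsmul_eq_mul]
  refine (Complex.re_le_norm _).trans (h1.trans ?_)
  have h2 : ((n - 1 : ℕ) : ℝ) ≤ n := by exact_mod_cast Nat.sub_le n 1
  have h3 : ((2 * (2 * k + 1) + 1 : ℕ) : ℝ) ≤ 4 * 4 ^ k := by
    have : 2 * (2 * k + 1) + 1 ≤ 4 * 4 ^ k := by
      have := Nat.lt_pow_self (n := k) (a := 4) (by norm_num)
      omega
    exact_mod_cast this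
  calc ((n - 1 : ℕ) : ℝ) * ((2 * (2 * k + 1) + 1 : ℕ) * (b * b))
      ≤ n * ((4 * 4 ^ k) * (b * b)) := by gcongr
    _ = (√n * (16 * (60 ^ k * k.factorial))) ^ 2 := by
        rw [mul_pow, Real.sq_sqrt (Nat.cast_nonneg n), hbdef]
        have : (60 : ℝ) ^ k = 30 ^ k * 2 ^ k := by rw [← mul_pow]; norm_num
        have h4 : (4 : ℝ) ^ k = 2 ^ k * 2 ^ k := by rw [← mul_pow]; norm_num
        rw [this, h4]
        ring

/-- Only boundedly many terms near the ends differ from g. Their bound may grow, provided it is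
o(n); overlaps with charges need √n. -/
theorem tendsto_sum_div_of_bulk {a : ℕ → ℕ → ℂ} {g : ℂ} {r : ℕ} {B : ℕ → ℝ}
    (hB : Tendsto (fun n : ℕ => B n / n) atTop (𝓝 0))
    (hB' : ∀ n x, x + 1 < n → ‖a n x‖ ≤ B n)
    (h : ∀ n x, r ≤ x → x + r + 1 < n → a n x = g) :
    Tendsto (fun n : ℕ => (∑ x ∈ Finset.range (n - 1), a n x) / (n : ℂ)) atTop (𝓝 g) := by
  rw [tendsto_iff_norm_sub_tendsto_zero]
  have hlim : Tendsto (fun n : ℕ => (2 * r + 1) * (B n / n) + (2 * r + 2) * (‖g‖ / n)) atTop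
      (𝓝 0) := by
    have := (hB.const_mul (2 * r + 1 : ℝ)).add
      ((tendsto_const_div_atTop_nhds_zero_nat ‖g‖).const_mul (2 * r + 2 : ℝ))
    simpa using this
  refine squeeze_zero' (Eventually.of_forall fun _ => norm_nonneg _) ?_ hlim
  filter_upwards [eventually_ge_atTop (2 * r + 2)] with n hn
  have hn0 : (0 : ℝ) < n := by exact_mod_cast (by omega : 0 < n)
  have hB0 : 0 ≤ B n := (norm_nonneg _).trans (hB' n 0 (by omega))
  have e : (∑ x ∈ Finset.range (n - 1), a n x) / (n : ℂ) - g
      = (∑ x ∈ Finset.range (n - 1), (a n x - g) - g) / n := by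
    rw [Finset.sum_sub_distrib, Finset.sum_const, Finset.card_range, nsmul_eq_mul,
      Nat.cast_sub (by omega)]
    have : (n : ℂ) ≠ 0 := by exact_mod_cast (by omega : n ≠ 0)
    field_simp
    push_cast
    ring
  have h1 : ‖∑ x ∈ Finset.range (n - 1), (a n x - g)‖ ≤ (2 * r + 1) * (B n + ‖g‖) := by
    have e : ∑ x ∈ Finset.range (n - 1), (a n x - g)
        = ∑ x ∈ (Finset.range (n - 1)).filter (fun x => ¬(r ≤ x ∧ x + r + 1 < n)),
          (a n x - g) := by
      rw [Finset.sum_filter]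
      refine Finset.sum_congr rfl fun x _ => ?_
      split_ifs with hx
      · rw [h n x hx.1 hx.2, sub_self]
      · rfl
    rw [e]
    refine (norm_sum_le_of_le _ (n := fun _ => B n + ‖g‖) fun x hx => ?_).trans ?_
    · have := (Finset.mem_filter.mp hx).1
      rw [Finset.mem_range] at this
      exact (norm_sub_le _ _).trans (add_le_add_left (hB' n x (by omega)) _)
    · rw [Finset.sum_const, nsmul_eq_mul]
      refine mul_le_mul_of_nonneg_right ?_ (add_nonneg hB0 (norm_nonneg g))
      have : ((Finset.range (n - 1)).filter (fun x => ¬(r ≤ x ∧ x + r + 1 < n))).card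
          ≤ 2 * r + 1 := by
        refine (Finset.card_le_card
          (t := Finset.range r ∪ Finset.Icc (n - 1 - r) (n - 1)) ?_).trans ?_
        · intro x hx
          rw [Finset.mem_filter, Finset.mem_range] at hx
          rw [Finset.mem_union, Finset.mem_range, Finset.mem_Icc]
          omega
        · refine (Finset.card_union_le _ _).trans ?_
          rw [Finset.card_range, Nat.card_Icc]
          omega
      exact_mod_cast this
  rw [e, norm_div, Complex.norm_natCast, div_le_iff₀ hn0]
  refine (norm_sub_le _ _).trans ((add_le_add_left h1 _).trans (le_of_eq ?_))
  field_simp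
  ring

/-- The infinite-volume derivatives at time zero of the current autocorrelation. -/
theorem tendsto_hsInner_current_deriv_pow (hΔ : |Δ| ≤ 1) (k : ℕ) :
    Tendsto (fun n : ℕ =>
      hsInner n (current n) ((deriv (hamiltonian Δ n) ^ k) (current n)) / (n : ℂ)) atTop
      (𝓝 (bulkValue Δ (2 * k + 4) (k + 1) k)) := by
  have h := tendsto_sum_div_of_bulk (g := bulkValue Δ (2 * k + 4) (k + 1) k) (r := k + 1)
    (a := fun n x => hsInner n (current n) ((deriv (hamiltonian Δ n) ^ k) (bondJ n x)))
    (tendsto_const_div_atTop_nhds_zero_nat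
      ((2 * (k + 1) + 1 : ℕ) * (8 * (8 * 30 ^ k * k.factorial)) : ℝ))
    (fun n x hx => norm_hsInner_current_deriv_pow_le hΔ hx k)
    (fun n x h1 h2 => hsInner_hamOn_congr h1 (by omega))
  refine h.congr fun n => ?_
  rw [← hsInner_sum_right, ← map_sum, ← current_eq]

end Bulk

end

end XXZ

set_option linter.unusedSimpArgs false
namespace XXZ

noncomputable section

/-! ### The divergence condition for the Lax operator -/

section MatrixAction

variable {R : Type*} [Ring R] [Algebra ℂ R]

/-- Multiplication of a matrix of operators by a numerical matrix from the left. -/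
def lmulMat (a : Matrix (Fin 2) (Fin 2) ℂ) (X : Matrix (Fin 2) (Fin 2) R) :
    Matrix (Fin 2) (Fin 2) R := Matrix.of fun i j => ∑ k, a i k • X k j

/-- Multiplication of a matrix of operators by a numerical matrix from the right. -/
def rmulMat (X : Matrix (Fin 2) (Fin 2) R) (a : Matrix (Fin 2) (Fin 2) ℂ) :
    Matrix (Fin 2) (Fin 2) R := Matrix.of fun i j => ∑ k, a k j • X i k

/-- The commutator of the two-site energy with `X ⊗ X` is `W ⊗ X - X ⊗ W`. -/
def IsDivergence (c : ℂ) (X W : Matrix (Fin 2) (Fin 2) R) : Prop :=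
  ∀ i j i' j' : Fin 2, (2 : ℂ) • (lmulMat (pauli .plus) X i j * lmulMat (pauli .minus) X i' j'
        + lmulMat (pauli .minus) X i j * lmulMat (pauli .plus) X i' j')
      + c • (lmulMat (pauli .z) X i j * lmulMat (pauli .z) X i' j')
      - ((2 : ℂ) • (rmulMat X (pauli .plus) i j * rmulMat X (pauli .minus) i' j'
          + rmulMat X (pauli .minus) i j * rmulMat X (pauli .plus) i' j')
        + c • (rmulMat X (pauli .z) i j * rmulMat X (pauli .z) i' j'))
      = W i j * X i' j' - X i j * W i' j'

set_option maxHeartbeats 1000000 in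
-- Each of the sixteen entries of the two-site identity is trivial or a signed combination of the
-- listed quadratic relations. The abstract form separates this linear algebra from the trigonometry
-- of `lax_relations`.
theorem divergence_of_relations {c μ : ℂ} {O Y B C Z : R} (h1 : O * Y = Y * O)
    (h2 : O * Z = Z * O) (h3 : Y * Z = Z * Y)
    (h4 : (2 : ℂ) • (C * B - B * C) = (2 : ℂ) • (Z * O))
    (b1 : (2 * c) • (B * Y) - (2 : ℂ) • (Y * B) = μ • (B * O))
    (b2 : (2 * c) • (B * O) - (2 : ℂ) • (O * B) = μ • (B * Y) - B * Z)
    (b3 : (2 * c) • (Y * B) - (2 : ℂ) • (B * Y) = -(μ • (O * B)))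
    (b4 : (2 * c) • (O * B) - (2 : ℂ) • (B * O) = Z * B - μ • (Y * B))
    (c1 : (2 * c) • (C * Y) - (2 : ℂ) • (Y * C) = -(μ • (C * O)))
    (c2 : (2 * c) • (C * O) - (2 : ℂ) • (O * C) = C * Z - μ • (C * Y))
    (c3 : (2 * c) • (Y * C) - (2 : ℂ) • (C * Y) = μ • (O * C))
    (c4 : (2 * c) • (O * C) - (2 : ℂ) • (C * O) = μ • (Y * C) - Z * C)
    {X W : Matrix (Fin 2) (Fin 2) R} (hX : X = !![O + Y, B; C, O - Y])
    (hW : W = !![Z, μ • B; μ • C, -Z]) : IsDivergence c X W := by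
  subst hX hW
  intro i j i' j'
  fin_cases i <;> fin_cases j <;> fin_cases i' <;> fin_cases j' <;>
    simp [lmulMat, rmulMat, pauli, mul_add, add_mul, sub_mul, mul_sub, h1, h2, h3]
  · linear_combination (norm := module) b4 + b3
  · linear_combination (norm := module) -c3 - c4
  · linear_combination (norm := module) h4
  · linear_combination (norm := module) b2 + b1
  · module
  · linear_combination (norm := module) b1 - b2
  · linear_combination (norm := module) -c2 - c1
  · module
  · linear_combination (norm := module) c2 - c1
  · linear_combination (norm := module) -h4
  · linear_combination (norm := module) b3 - b4
  · linear_combination (norm := module) c4 - c3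
  · module

end MatrixAction

section Divergence

variable (γ : ℝ) (φ : ℂ)

theorem aux_end_ext {f g : Module.End ℂ Aux} (h : ∀ a, f (ket a) = g (ket a)) : f = g := by
  refine Finsupp.lhom_ext fun a c => ?_
  have hs : Finsupp.single a c = c • ket a := by simp [ket]
  rw [hs, map_smul, map_smul, h]

/-- The Lax operator as a matrix over the operators on the auxiliary space. -/
def laxMat : Matrix (Fin 2) (Fin 2) (Module.End ℂ Aux) :=
  Matrix.of fun i j => ∑ α, pauli α i j • lax γ φ α

/-- The components of the boundary operator on basis vectors. -/
def boundaryOnBasis : SpinLabel → AuxLabel → Aux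
  | .zero, _ => 0
  | .plus, a => (2 * Complex.sin γ * (Complex.cos φ / Complex.sin φ)) • laxOnBasis γ φ .plus a
  | .minus, a => (2 * Complex.sin γ * (Complex.cos φ / Complex.sin φ)) • laxOnBasis γ φ .minus a
  | .z, .left => 0
  | .z, .right => ket .left
  | .z, .level k => (-(2 * Complex.sin γ * Complex.sin (γ * (k + 1)) / Complex.sin φ ^ 2)) •
      ket (.level k)

/-- The components of the boundary operator in the divergence condition. -/
def boundaryOp (α : SpinLabel) : Module.End ℂ Aux :=
  Finsupp.linearCombination ℂ (boundaryOnBasis γ φ α)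

theorem boundaryOp_ket (α : SpinLabel) (a : AuxLabel) :
    boundaryOp γ φ α (ket a) = boundaryOnBasis γ φ α a := by
  simp [boundaryOp, ket]

/-- The boundary operator as a matrix over the operators on the auxiliary space. -/
def boundaryMat : Matrix (Fin 2) (Fin 2) (Module.End ℂ Aux) :=
  Matrix.of fun i j => ∑ α, pauli α i j • boundaryOp γ φ α

variable {γ φ}

theorem lax_minus_level_succ (hγ : Real.sin γ ≠ 0) (k : ℕ) :
    lax γ φ .minus (ket (.level (k + 1)))
      = (Complex.sin (γ * (k + 1) + γ) / Complex.sin φ) • ket (.level k) := by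
  rw [lax_ket, laxOnBasis]
  congr 1
  have : (Real.sin γ : ℂ) ≠ 0 := by exact_mod_cast hγ
  rw [qNumber]
  push_cast at this ⊢
  rw [show (γ : ℂ) * (k + 1) + γ = γ * (k + 2) by ring]
  field_simp

theorem lax_plus_level (hγ : Real.sin γ ≠ 0) (k : ℕ) :
    lax γ φ .plus (ket (.level k))
      = (-(Complex.sin (γ * (k + 1)) / Complex.sin φ)) • ket (.level (k + 1)) := by
  rw [lax_ket, laxOnBasis]
  congr 1
  have : (Real.sin γ : ℂ) ≠ 0 := by exact_mod_cast hγ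
  rw [qNumber]
  push_cast at this ⊢
  rw [mul_neg, Complex.sin_neg]
  field_simp

theorem lax_zero_level (k : ℕ) :
    lax γ φ .zero (ket (.level k)) = Complex.cos (γ * (k + 1)) • ket (.level k) := by
  rw [lax_ket, laxOnBasis]
  push_cast
  rw [mul_neg, Complex.cos_neg]

theorem lax_z_level (k : ℕ) :
    lax γ φ .z (ket (.level k))
      = (-(Complex.cos φ / Complex.sin φ * Complex.sin (γ * (k + 1)))) • ket (.level k) := by
  rw [lax_ket, laxOnBasis]
  push_cast
  rw [mul_neg, Complex.sin_neg, mul_neg]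

theorem boundaryOp_zero : boundaryOp γ φ .zero = 0 :=
  aux_end_ext fun a => by rw [boundaryOp_ket]; rfl

theorem boundaryOp_plus : boundaryOp γ φ .plus
    = (2 * Complex.sin γ * (Complex.cos φ / Complex.sin φ)) • lax γ φ .plus :=
  aux_end_ext fun a => by
    rw [boundaryOp_ket, LinearMap.smul_apply, lax_ket, boundaryOnBasis]

theorem boundaryOp_minus : boundaryOp γ φ .minus
    = (2 * Complex.sin γ * (Complex.cos φ / Complex.sin φ)) • lax γ φ .minus :=
  aux_end_ext fun a => by
    rw [boundaryOp_ket, LinearMap.smul_apply, lax_ket, boundaryOnBasis]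

theorem boundaryOp_z_left : boundaryOp γ φ .z (ket .left) = 0 := boundaryOp_ket ..

theorem boundaryOp_z_right : boundaryOp γ φ .z (ket .right) = ket .left := boundaryOp_ket ..

theorem boundaryOp_z_level (k : ℕ) : boundaryOp γ φ .z (ket (.level k))
    = (-(2 * Complex.sin γ * Complex.sin (γ * (k + 1)) / Complex.sin φ ^ 2)) • ket (.level k) :=
  boundaryOp_ket ..

theorem lax_zero_left : lax γ φ .zero (ket .left) = ket .left := lax_ket ..

theorem lax_zero_right : lax γ φ .zero (ket .right) = ket .right := lax_ket ..

theorem lax_z_left : lax γ φ .z (ket .left) = 0 := lax_ket ..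

theorem lax_z_right : lax γ φ .z (ket .right) = 0 := lax_ket ..

theorem lax_plus_left : lax γ φ .plus (ket .left) = 0 := lax_ket ..

theorem lax_plus_right : lax γ φ .plus (ket .right) = ket (.level 0) := lax_ket ..

theorem lax_minus_left : lax γ φ .minus (ket .left) = 0 := lax_ket ..

theorem lax_minus_right : lax γ φ .minus (ket .right) = 0 := lax_ket ..

theorem lax_minus_level_zero : lax γ φ .minus (ket (.level 0)) = ket .left := lax_ket ..

set_option maxHeartbeats 3000000 in
/-- The quadratic relations between the Lax operator and the boundary operator. -/
theorem lax_relations (hγ : Real.sin γ ≠ 0) (hφ : Complex.sin φ ≠ 0) :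
    (lax γ φ .zero * lax γ φ .z = lax γ φ .z * lax γ φ .zero) ∧
    (lax γ φ .zero * boundaryOp γ φ .z = boundaryOp γ φ .z * lax γ φ .zero) ∧
    (lax γ φ .z * boundaryOp γ φ .z = boundaryOp γ φ .z * lax γ φ .z) ∧
    ((2 : ℂ) • (lax γ φ .minus * lax γ φ .plus - lax γ φ .plus * lax γ φ .minus) = (2 : ℂ) • (boundaryOp γ φ .z * lax γ φ .zero)) ∧
    ((2 * Complex.cos γ) • (lax γ φ .plus * lax γ φ .z) - (2 : ℂ) • (lax γ φ .z * lax γ φ .plus) = (2 * Complex.sin γ * (Complex.cos φ / Complex.sin φ)) • (lax γ φ .plus * lax γ φ .zero)) ∧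
    ((2 * Complex.cos γ) • (lax γ φ .plus * lax γ φ .zero) - (2 : ℂ) • (lax γ φ .zero * lax γ φ .plus) = (2 * Complex.sin γ * (Complex.cos φ / Complex.sin φ)) • (lax γ φ .plus * lax γ φ .z) - lax γ φ .plus * boundaryOp γ φ .z) ∧
    ((2 * Complex.cos γ) • (lax γ φ .z * lax γ φ .plus) - (2 : ℂ) • (lax γ φ .plus * lax γ φ .z) = -((2 * Complex.sin γ * (Complex.cos φ / Complex.sin φ)) • (lax γ φ .zero * lax γ φ .plus))) ∧
    ((2 * Complex.cos γ) • (lax γ φ .zero * lax γ φ .plus) - (2 : ℂ) • (lax γ φ .plus * lax γ φ .zero) = boundaryOp γ φ .z * lax γ φ .plus - (2 * Complex.sin γ * (Complex.cos φ / Complex.sin φ)) • (lax γ φ .z * lax γ φ .plus)) ∧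
    ((2 * Complex.cos γ) • (lax γ φ .minus * lax γ φ .z) - (2 : ℂ) • (lax γ φ .z * lax γ φ .minus) = -((2 * Complex.sin γ * (Complex.cos φ / Complex.sin φ)) • (lax γ φ .minus * lax γ φ .zero))) ∧
    ((2 * Complex.cos γ) • (lax γ φ .minus * lax γ φ .zero) - (2 : ℂ) • (lax γ φ .zero * lax γ φ .minus) = lax γ φ .minus * boundaryOp γ φ .z - (2 * Complex.sin γ * (Complex.cos φ / Complex.sin φ)) • (lax γ φ .minus * lax γ φ .z)) ∧
    ((2 * Complex.cos γ) • (lax γ φ .z * lax γ φ .minus) - (2 : ℂ) • (lax γ φ .minus * lax γ φ .z) = (2 * Complex.sin γ * (Complex.cos φ / Complex.sin φ)) • (lax γ φ .zero * lax γ φ .minus)) ∧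
    ((2 * Complex.cos γ) • (lax γ φ .zero * lax γ φ .minus) - (2 : ℂ) • (lax γ φ .minus * lax γ φ .zero) = (2 * Complex.sin γ * (Complex.cos φ / Complex.sin φ)) • (lax γ φ .z * lax γ φ .minus) - boundaryOp γ φ .z * lax γ φ .minus) := by
  have hk : ∀ x : ℂ, Complex.cos x ^ 2 = 1 - Complex.sin x ^ 2 := Complex.cos_sq'
  have hc := hk φ
  have hg := hk γ
  refine ⟨?_, ?_, ?_, ?_, ?_, ?_, ?_, ?_, ?_, ?_, ?_, ?_⟩ <;>
    refine aux_end_ext fun a => ?_ <;> rcases a with _ | _ | (_ | k) <;>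
    simp [lax_minus_level_succ hγ, lax_plus_level hγ, lax_zero_level, lax_z_level,
      boundaryOp_z_left, boundaryOp_z_right, boundaryOp_z_level, lax_zero_left, lax_zero_right,
      lax_z_left, lax_z_right, lax_plus_left, lax_plus_right, lax_minus_left, lax_minus_right,
      lax_minus_level_zero, smul_smul, ← sub_smul, ← add_smul, ← neg_smul]
  -- On basis kets each relation becomes a scalar identity, settled by the addition formulas and
  -- cos² = 1 - sin² at φ and γ.
  all_goals
    congr 1
    try simp only [mul_add, mul_one, Complex.sin_add, Complex.cos_add]
    field_simp
    try grind

theorem divergence_condition (hγ : Real.sin γ ≠ 0) (hφ : Complex.sin φ ≠ 0) :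
    IsDivergence (Complex.cos γ) (laxMat γ φ) (boundaryMat γ φ) := by
  obtain ⟨h1, h2, h3, h4, b1, b2, b3, b4, c1, c2, c3, c4⟩ := lax_relations hγ hφ
  refine divergence_of_relations h1 h2 h3 h4 b1 b2 b3 b4 c1 c2 c3 c4 ?_ ?_
  · ext i j : 1
    fin_cases i <;> fin_cases j <;> simp [laxMat, sum_spinLabel, pauli, sub_eq_add_neg]
    module
  · ext i j : 1
    fin_cases i <;> fin_cases j <;>
      simp [boundaryMat, sum_spinLabel, pauli, boundaryOp_zero, boundaryOp_plus, boundaryOp_minus]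
    module

end Divergence
end
end XXZ

namespace XXZ

noncomputable section

/-! ### Matrix product operators -/

/-- The outer factors u, w depend only on the entries away from b and b + 1, so one pair serves
every modification there and a local identity can be sandwiched. -/
theorem exists_prod_ofFn_split {R : Type*} [Ring R] {n b : ℕ} (hb : b + 1 < n)
    (e : ℕ → R) : ∃ u w : R,
    ∀ e' : ℕ → R, (∀ x, x ≠ b → x ≠ b + 1 → e' x = e x) →
      (List.ofFn fun x : Fin n => e' x).prod = u * (e' b * e' (b + 1)) * w := by
  induction n generalizing b e with
  | zero => omega
  | succ n ih =>
    rcases b with _ | b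
    · obtain ⟨n, rfl⟩ : ∃ k, n = k + 1 := ⟨n - 1, by omega⟩
      refine ⟨1, (List.ofFn fun x : Fin n => e (x + 2)).prod, fun e' he => ?_⟩
      rw [List.ofFn_succ, List.ofFn_succ, List.prod_cons, List.prod_cons, one_mul, mul_assoc]
      congr 2
      congr 2
      ext1 x
      exact he _ (by simp) (by simp)
    · obtain ⟨u, w, h⟩ := ih (b := b) (by omega) fun x => e (x + 1)
      refine ⟨e 0 * u, w, fun e' he => ?_⟩
      have := h (fun x => e' (x + 1)) fun x h1 h2 => he _ (by simpa using h1) (by simpa using h2)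
      rw [List.ofFn_succ, List.prod_cons]
      simp only [Fin.val_zero, Fin.val_succ]
      rw [this, he 0 (by simp) (by simp)]
      simp only [mul_assoc]

section MPO

variable {R : Type*} [Ring R] [Algebra ℂ R]

/-- The ordered product of the entries of a sequence of matrices. -/
def mpoEntry (n : ℕ) (X : ℕ → Matrix (Fin 2) (Fin 2) R) (σ τ : Fin n → Fin 2) : R :=
  (List.ofFn fun x : Fin n => X x (σ x) (τ x)).prod

/-- The matrix product operator of a sequence of matrices with a functional on the ring. -/
def mpo (n : ℕ) (ℓ : R →ₗ[ℂ] ℂ) (X : ℕ → Matrix (Fin 2) (Fin 2) R) : ChainOp n :=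
  Matrix.of fun σ τ => ℓ (mpoEntry n X σ τ)

/-- Distributivity for an ordered noncommutative product with scalar coefficients. Both products
with tensors and the trace of a matrix product operator reduce to it. -/
theorem sum_smul_prod_ofFn {n : ℕ} (c : Fin n → Fin 2 → ℂ) (d : Fin n → Fin 2 → R) :
    ∑ ρ : Fin n → Fin 2, (∏ x, c x (ρ x)) • (List.ofFn fun x => d x (ρ x)).prod
      = (List.ofFn fun x => ∑ i, c x i • d x i).prod := by
  induction n with
  | zero => simp
  | succ n ih =>
    rw [← (Fin.consEquiv fun _ : Fin (n + 1) => Fin 2).sum_comp, Fintype.sum_prod_type,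
      List.ofFn_succ, List.prod_cons, ← ih, Finset.sum_mul]
    refine Finset.sum_congr rfl fun i _ => ?_
    rw [Finset.mul_sum]
    refine Finset.sum_congr rfl fun ρ _ => ?_
    rw [Fin.prod_univ_succ, List.ofFn_succ, List.prod_cons, smul_mul_smul_comm]
    simp [Fin.consEquiv]

theorem tensor_mul_mpo {n : ℕ} (a : ℕ → Matrix (Fin 2) (Fin 2) ℂ) (ℓ : R →ₗ[ℂ] ℂ)
    (X : ℕ → Matrix (Fin 2) (Fin 2) R) :
    tensor (fun x : Fin n => a x) * mpo n ℓ X = mpo n ℓ fun x => lmulMat (a x) (X x) := by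
  ext σ τ
  simp only [Matrix.mul_apply, tensor, mpo, Matrix.of_apply]
  have := sum_smul_prod_ofFn (fun x : Fin n => a x (σ x)) fun x i => X x i (τ x)
  rw [mpoEntry, show (fun x : Fin n => lmulMat (a x) (X x) (σ x) (τ x))
    = fun x : Fin n => ∑ i, a x (σ x) i • X x i (τ x) from rfl, ← this, map_sum]
  exact Finset.sum_congr rfl fun ρ _ => (map_smul ℓ _ _).symm

theorem mpo_mul_tensor {n : ℕ} (a : ℕ → Matrix (Fin 2) (Fin 2) ℂ) (ℓ : R →ₗ[ℂ] ℂ)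
    (X : ℕ → Matrix (Fin 2) (Fin 2) R) :
    mpo n ℓ X * tensor (fun x : Fin n => a x) = mpo n ℓ fun x => rmulMat (X x) (a x) := by
  ext σ τ
  simp only [Matrix.mul_apply, tensor, mpo, Matrix.of_apply]
  have := sum_smul_prod_ofFn (fun (x : Fin n) i => a x i (τ x)) fun x i => X x (σ x) i
  rw [mpoEntry, show (fun x : Fin n => rmulMat (X x) (a x) (σ x) (τ x))
    = fun x : Fin n => ∑ i, a x i (τ x) • X x (σ x) i from rfl, ← this, map_sum]
  refine Finset.sum_congr rfl fun ρ _ => ?_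
  rw [map_smul, smul_eq_mul, mul_comm]
  rfl

theorem trace_mpo (n : ℕ) (ℓ : R →ₗ[ℂ] ℂ) (X : ℕ → Matrix (Fin 2) (Fin 2) R) :
    (mpo n ℓ X).trace = ℓ (List.ofFn fun x : Fin n => ∑ i, X x i i).prod := by
  have := sum_smul_prod_ofFn (fun (_ : Fin n) _ => 1) fun x i => X x i i
  simp only [Finset.prod_const_one, one_smul] at this
  rw [← this, map_sum]
  rfl

theorem lmulMat_one (X : Matrix (Fin 2) (Fin 2) R) : lmulMat 1 X = X := by
  ext i j
  fin_cases i <;> simp [lmulMat]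

theorem rmulMat_one (X : Matrix (Fin 2) (Fin 2) R) : rmulMat X 1 = X := by
  ext i j
  fin_cases j <;> simp [rmulMat]

theorem sandwich_identity (ℓ : R →ₗ[ℂ] ℂ) (u w : R) {c : ℝ} {p₁ p₂ p₃ q₁ q₂ q₃ s t : R}
    (h : (2 : ℂ) • (p₁ + p₂) + Complex.cos c • p₃ - ((2 : ℂ) • (q₁ + q₂) + Complex.cos c • q₃)
      = s - t) :
    (2 : ℂ) • (ℓ (u * p₁ * w) + ℓ (u * p₂ * w)) + (Real.cos c : ℂ) • ℓ (u * p₃ * w)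
      - ((2 : ℂ) • (ℓ (u * q₁ * w) + ℓ (u * q₂ * w)) + (Real.cos c : ℂ) • ℓ (u * q₃ * w))
      = ℓ (u * s * w) - ℓ (u * t * w) := by
  have := congrArg (fun r => ℓ (u * r * w)) h
  simp only [mul_sub, sub_mul, mul_add, add_mul, map_sub, map_add, mul_smul_comm, smul_mul_assoc,
    map_smul, smul_eq_mul] at this
  rw [← this]
  push_cast
  simp only [smul_eq_mul, mul_add]

/-- A matrix product operator whose matrices at `b`, `b + 1` are `Y`, `Z` and are `X` elsewhere. -/
def mpo₂ (n : ℕ) (ℓ : R →ₗ[ℂ] ℂ) (X : Matrix (Fin 2) (Fin 2) R) (b : ℕ)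
    (Y Z : Matrix (Fin 2) (Fin 2) R) : ChainOp n :=
  mpo n ℓ fun x => if x = b then Y else if x = b + 1 then Z else X

theorem exists_mpo₂_split {n b : ℕ} (hb : b + 1 < n) (ℓ : R →ₗ[ℂ] ℂ)
    (X : Matrix (Fin 2) (Fin 2) R) (σ τ : Fin n → Fin 2) : ∃ u w : R, ∃ i j i' j' : Fin 2,
      ∀ Y Z, mpo₂ n ℓ X b Y Z σ τ = ℓ (u * (Y i j * Z i' j') * w) := by
  let s : ℕ → Fin 2 := fun x => if h : x < n then σ ⟨x, h⟩ else 0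
  let t : ℕ → Fin 2 := fun x => if h : x < n then τ ⟨x, h⟩ else 0
  obtain ⟨u, w, h⟩ := exists_prod_ofFn_split hb fun x => X (s x) (t x)
  refine ⟨u, w, s b, t b, s (b + 1), t (b + 1), fun Y Z => ?_⟩
  have := h (fun x => (if x = b then Y else if x = b + 1 then Z else X) (s x) (t x))
    fun x h1 h2 => by rw [if_neg h1, if_neg h2]
  rw [if_pos rfl, if_neg (Nat.succ_ne_self b), if_pos rfl] at this
  rw [mpo₂, mpo, Matrix.of_apply, mpoEntry, ← this]
  congr 4
  ext x
  simp [s, t]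

theorem siteOp_mul_siteOp_mul_mpo₂ (n b : ℕ) (ℓ : R →ₗ[ℂ] ℂ) (X Y Z : Matrix (Fin 2) (Fin 2) R)
    (α β : SpinLabel) : siteOp n b α * siteOp n (b + 1) β * mpo₂ n ℓ X b Y Z
      = mpo₂ n ℓ X b (lmulMat (pauli α) Y) (lmulMat (pauli β) Z) := by
  have := tensor_mul_mpo (n := n)
    (fun x => pauli (if x = b then α else if x = b + 1 then β else .zero)) ℓ
    (fun x => if x = b then Y else if x = b + 1 then Z else X)
  rw [siteOp_mul_siteOp, mpo₂, mpo₂]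
  refine this.trans ?_
  congr 1
  ext1 x
  split_ifs
  · rfl
  · rfl
  · exact lmulMat_one X

theorem mpo₂_mul_siteOp_mul_siteOp (n b : ℕ) (ℓ : R →ₗ[ℂ] ℂ) (X Y Z : Matrix (Fin 2) (Fin 2) R)
    (α β : SpinLabel) : mpo₂ n ℓ X b Y Z * (siteOp n b α * siteOp n (b + 1) β)
      = mpo₂ n ℓ X b (rmulMat Y (pauli α)) (rmulMat Z (pauli β)) := by
  have := mpo_mul_tensor (n := n)
    (fun x => pauli (if x = b then α else if x = b + 1 then β else .zero)) ℓ
    (fun x => if x = b then Y else if x = b + 1 then Z else X)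
  rw [siteOp_mul_siteOp, mpo₂, mpo₂]
  refine this.trans ?_
  congr 1
  ext1 x
  split_ifs
  · rfl
  · rfl
  · exact rmulMat_one X

theorem bondH_commutator_mpo₂ {n b : ℕ} (hb : b + 1 < n) (ℓ : R →ₗ[ℂ] ℂ) {c : ℝ}
    {X W : Matrix (Fin 2) (Fin 2) R} (h : IsDivergence (Complex.cos c) X W) :
    bondH (Real.cos c) n b * mpo₂ n ℓ X b X X - mpo₂ n ℓ X b X X * bondH (Real.cos c) n b
      = mpo₂ n ℓ X b W X - mpo₂ n ℓ X b X W := by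
  rw [bondH, add_mul, mul_add, Matrix.smul_mul, Matrix.smul_mul, Matrix.mul_smul,
    Matrix.mul_smul, add_mul, mul_add]
  simp only [siteOp_mul_siteOp_mul_mpo₂, mpo₂_mul_siteOp_mul_siteOp]
  ext σ τ
  obtain ⟨u, w, i, j, i', j', hs⟩ := exists_mpo₂_split hb ℓ X σ τ
  simp only [Matrix.sub_apply, Matrix.add_apply, Matrix.smul_apply, hs]
  exact sandwich_identity ℓ u w (h i j i' j')

/-- A acts as the identity at y, so the trace over that site alone puts the factor ∑ X_y(i,i) = 0
into the ordered product. -/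
theorem hsInner_mpo_eq_zero {n : ℕ} {S : Set ℕ} {y : ℕ} (hy : y < n) (hyS : y ∉ S)
    {ℓ : R →ₗ[ℂ] ℂ} {X : ℕ → Matrix (Fin 2) (Fin 2) R} (hX : ∑ i, X y i i = 0) {A : ChainOp n}
    (hA : A ∈ localOps n S) : hsInner n A (mpo n ℓ X) = 0 := by
  induction hA using Submodule.span_induction with
  | mem A h =>
    obtain ⟨a, ha, rfl⟩ := h
    set a' : ℕ → Matrix (Fin 2) (Fin 2) ℂ :=
      fun x => if h : x < n then (a ⟨x, h⟩).conjTranspose else 1 with ha'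
    have e : (tensor a).conjTranspose = tensor fun x : Fin n => a' x := by
      rw [tensor_conjTranspose]
      congr 1
      ext1 x
      simp [ha']
    rw [hsInner, e, tensor_mul_mpo, tracial, trace_mpo, List.prod_eq_zero, map_zero, zero_div]
    rw [List.mem_ofFn]
    refine ⟨⟨y, hy⟩, ?_⟩
    have h1 : a' y = 1 := by
      rw [ha']
      simp only [hy, dif_pos]
      rw [ha _ hyS, Matrix.conjTranspose_one]
    simp only [h1, lmulMat_one, hX]
  | zero => simp [hsInner, tracial_zero]
  | add A B _ _ h1 h2 => rw [hsInner_add_left, h1, h2, add_zero]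
  | smul c A _ h => rw [hsInner_smul_left, h, mul_zero]

end MPO

/-! ### Almost conservation of the charges -/

section Conservation

variable {γ : ℝ} {φ : ℂ} {n : ℕ}

/-- The matrix element between the boundary vectors. -/
def boundaryElement : Module.End ℂ Aux →ₗ[ℂ] ℂ where
  toFun A := A (ket .right) .left
  map_add' _ _ := rfl
  map_smul' _ _ := rfl

theorem charge_eq_mpo (γ : ℝ) (φ : ℂ) (n : ℕ) :
    charge γ n φ = mpo n boundaryElement fun _ => laxMat γ φ := by
  have key : ∀ (n : ℕ) (σ τ : Fin n → Fin 2), mpoEntry n (fun _ => laxMat γ φ) σ τ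
      = ∑ α : Fin n → SpinLabel, (∏ x, pauli (α x) (σ x) (τ x)) •
        (List.ofFn fun x => lax γ φ (α x)).prod := by
    intro n
    induction n with
    | zero => intro σ τ; simp [mpoEntry]
    | succ n ih =>
      intro σ τ
      rw [sum_cons, mpoEntry, List.ofFn_succ, List.prod_cons]
      have := ih (fun x => σ x.succ) fun x => τ x.succ
      rw [mpoEntry] at this
      rw [this, laxMat, Matrix.of_apply, Finset.sum_mul]
      refine Finset.sum_congr rfl fun α _ => ?_
      rw [Finset.mul_sum]
      refine Finset.sum_congr rfl fun ρ _ => ?_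
      rw [Fin.prod_univ_succ, List.ofFn_succ, List.prod_cons, smul_mul_smul_comm]
      simp
  ext σ τ
  rw [mpo, Matrix.of_apply, key, map_sum, charge, Matrix.sum_apply]
  refine Finset.sum_congr rfl fun α _ => ?_
  rw [map_smul, Matrix.smul_apply, smul_eq_mul, smul_eq_mul, mul_comm]
  rfl

/-- The charge with the Lax operator at the site `y` replaced by the boundary operator. -/
def defect (γ : ℝ) (φ : ℂ) (n y : ℕ) : ChainOp n :=
  mpo n boundaryElement fun x => if x = y then boundaryMat γ φ else laxMat γ φ

theorem bondH_commutator_charge (hγ : Real.sin γ ≠ 0) (hφ : Complex.sin φ ≠ 0) {b : ℕ}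
    (hb : b + 1 < n) :
    bondH (Real.cos γ) n b * charge γ n φ - charge γ n φ * bondH (Real.cos γ) n b
      = defect γ φ n b - defect γ φ n (b + 1) := by
  have e : charge γ n φ
      = mpo₂ n boundaryElement (laxMat γ φ) b (laxMat γ φ) (laxMat γ φ) := by
    rw [charge_eq_mpo, mpo₂]
    congr 1
    ext1 x
    split_ifs <;> rfl
  have e1 : defect γ φ n b
      = mpo₂ n boundaryElement (laxMat γ φ) b (boundaryMat γ φ) (laxMat γ φ) := by
    rw [defect, mpo₂]
    congr 1
    ext1 x
    split_ifs <;> rfl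
  have e2 : defect γ φ n (b + 1)
      = mpo₂ n boundaryElement (laxMat γ φ) b (laxMat γ φ) (boundaryMat γ φ) := by
    rw [defect, mpo₂]
    congr 1
    ext1 x
    split_ifs with h1 h2
    · omega
    · rfl
    · rfl
    · rfl
  have h := divergence_condition hγ hφ
  rw [e, e1, e2]
  have := bondH_commutator_mpo₂ hb boundaryElement h
  exact this

/-- The bond contributions telescope, leaving one defect at each end. -/
theorem hamiltonian_commutator_charge (hγ : Real.sin γ ≠ 0) (hφ : Complex.sin φ ≠ 0) (n : ℕ) :
    hamiltonian (Real.cos γ) n * charge γ n φ - charge γ n φ * hamiltonian (Real.cos γ) n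
      = defect γ φ n 0 - defect γ φ n (n - 1) := by
  rw [hamiltonian_eq, hamOn, Finset.sum_mul, Finset.mul_sum, ← Finset.sum_sub_distrib,
    ← Finset.sum_range_sub' (fun y => defect γ φ n y)]
  refine Finset.sum_congr rfl fun b hb => bondH_commutator_charge hγ hφ ?_
  rw [Finset.mem_range] at hb
  omega

/-- The boundary operator has no component along σ⁰. Hence a defect is orthogonal to all operators
that act as the identity at its site. -/
theorem boundaryMat_diag_sum : ∑ i, boundaryMat γ φ i i = 0 := by
  have h : ∀ v : Module.End ℂ Aux, v + (-1 : ℂ) • v = 0 := fun v => by module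
  simp [Fin.sum_univ_two, boundaryMat, sum_spinLabel, pauli, boundaryOp_zero, h]

theorem hsInner_defect {S : Set ℕ} {y : ℕ} (hy : y < n) (hyS : y ∉ S) {A : ChainOp n}
    (hA : A ∈ localOps n S) : hsInner n A (defect γ φ n y) = 0 := by
  refine hsInner_mpo_eq_zero hy hyS ?_ hA
  rw [if_pos rfl]
  exact boundaryMat_diag_sum

/-- By cyclicity of the trace the commutator moves onto the charge, where only the two end defects
remain; A touches neither end. -/
theorem hsInner_charge_deriv (hγ : Real.sin γ ≠ 0) (hφ : Complex.sin φ ≠ 0) {S : Set ℕ}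
    (hn : 0 < n) (h0 : 0 ∉ S) (h1 : n - 1 ∉ S) {A : ChainOp n} (hA : A ∈ localOps n S) :
    hsInner n (charge γ n φ) (deriv (hamiltonian (Real.cos γ) n) A) = 0 := by
  have e : hsInner n A (hamiltonian (Real.cos γ) n * charge γ n φ
      - charge γ n φ * hamiltonian (Real.cos γ) n) = 0 := by
    rw [hamiltonian_commutator_charge hγ hφ, hsInner_sub_right, hsInner_defect hn h0 hA,
      hsInner_defect (by omega) h1 hA, sub_zero]
  have e' : hsInner n (charge γ n φ) (hamiltonian (Real.cos γ) n * A
      - A * hamiltonian (Real.cos γ) n) = 0 := by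
    rw [← hsInner_conj, map_eq_zero, ← e, hsInner, hsInner, Matrix.conjTranspose_sub,
      Matrix.conjTranspose_mul, Matrix.conjTranspose_mul, hamiltonian_conjTranspose, sub_mul,
      mul_sub, tracial_sub, tracial_sub, mul_assoc, ← mul_assoc _ _ (hamiltonian _ _),
      tracial_mul_comm (_ * _) (hamiltonian _ _), mul_assoc]
  rw [deriv_apply, hsInner_smul_right, e', mul_zero]

end Conservation

end

end XXZ

namespace XXZ

noncomputable section

/-! ### Limits of the overlaps of the charges with the derivatives of the current -/

section ChargeLimit

variable {γ : ℝ} {φ : ℂ}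

/-- Order zero is the overlap with the current. In higher orders the bulk terms vanish exactly by
almost conservation, and each of the boundedly many terms near the ends is O(√n) by Cauchy-Schwarz.
-/
theorem tendsto_hsInner_charge_deriv_pow (hγ : Real.sin γ ≠ 0) (hφ : Complex.sin φ ≠ 0) {G : ℝ}
    (hG : ∀ n, hsNorm n (charge γ n φ) ≤ √n * G) (k : ℕ) :
    Tendsto (fun n : ℕ => hsInner n (charge γ n φ)
      ((deriv (hamiltonian (Real.cos γ) n) ^ k) (current n)) / (n : ℂ)) atTop
      (𝓝 (if k = 0 then -Complex.I else 0)) := by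
  rcases k with _ | k
  · have h1 : Tendsto (fun n : ℕ => -Complex.I * (1 - 1 / (n : ℂ))) atTop (𝓝 (-Complex.I)) := by
      simpa using (tendsto_const_nhds (x := (1 : ℂ))).sub
        (tendsto_one_div_atTop_nhds_zero_nat (𝕜 := ℂ)) |>.const_mul (-Complex.I)
    rw [if_pos rfl]
    refine h1.congr' ?_
    filter_upwards [eventually_ge_atTop 1] with n hn
    have hn0 : (n : ℂ) ≠ 0 := by exact_mod_cast (by omega : n ≠ 0)
    rw [pow_zero, Module.End.one_apply, ← hsInner_conj, hsInner_current_charge γ φ n hn]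
    simp only [map_mul, map_sub, Complex.conj_I, map_one, Complex.conj_natCast]
    field_simp
  · rw [if_neg (Nat.succ_ne_zero k)]
    set b : ℝ := 8 * 30 ^ (k + 1) * (k + 1).factorial
    have hB : Tendsto (fun n : ℕ => √n * G * b / n) atTop (𝓝 0) := by
      have h1 : Tendsto (fun n : ℕ => (√n)⁻¹) atTop (𝓝 0) :=
        tendsto_inv_atTop_zero.comp (Real.tendsto_sqrt_atTop.comp tendsto_natCast_atTop_atTop)
      have h2 := h1.mul_const (G * b)
      rw [zero_mul] at h2
      refine h2.congr fun n => ?_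
      rw [mul_assoc, mul_div_right_comm, Real.sqrt_div_self]
    have h := tendsto_sum_div_of_bulk (g := 0) (r := k + 1)
      (a := fun n x => hsInner n (charge γ n φ)
        ((deriv (hamiltonian (Real.cos γ) n) ^ (k + 1)) (bondJ n x))) hB ?_ ?_
    · refine h.congr fun n => ?_
      rw [← hsInner_sum_right, ← map_sum, ← current_eq]
    · intro n x hx
      refine (norm_hsInner_le _ _).trans (mul_le_mul (hG n) ?_ (hsNorm_nonneg _)
        ((hsNorm_nonneg _).trans (hG n)))
      refine hsNorm_deriv_pow_le (Real.abs_cos_le_one γ) (fun b hb => ?_) hx (k + 1)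
      rw [Finset.mem_range] at hb
      omega
    · intro n x h1 h2
      rw [pow_succ', Module.End.mul_apply]
      refine hsInner_charge_deriv hγ hφ (by omega) ?_ ?_ (deriv_pow_mem _ x k)
      · rintro ⟨h3, h4⟩
        omega
      · rintro ⟨h3, h4⟩
        omega

end ChargeLimit

/-! ### Heisenberg evolution -/

section Evolution

open scoped Matrix.Norms.Operator

variable {n : ℕ} {Δ : ℝ}

theorem evolve_zero (A : ChainOp n) : evolve Δ n 0 A = A := by
  simp [evolve, NormedSpace.exp_zero]

theorem evolve_add (s t : ℝ) (A : ChainOp n) :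
    evolve Δ n (s + t) A = evolve Δ n s (evolve Δ n t A) := by
  have h1 : NormedSpace.exp ((Complex.I * ((s + t : ℝ) : ℂ)) • hamiltonian Δ n)
      = NormedSpace.exp ((Complex.I * (s : ℂ)) • hamiltonian Δ n)
        * NormedSpace.exp ((Complex.I * (t : ℂ)) • hamiltonian Δ n) := by
    rw [← Matrix.exp_add_of_commute]
    · rw [← add_smul]; push_cast; ring_nf
    · exact ((Commute.refl _).smul_left _).smul_right _
  have h2 : NormedSpace.exp (-((Complex.I * ((s + t : ℝ) : ℂ)) • hamiltonian Δ n))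
      = NormedSpace.exp (-((Complex.I * (t : ℂ)) • hamiltonian Δ n))
        * NormedSpace.exp (-((Complex.I * (s : ℂ)) • hamiltonian Δ n)) := by
    rw [← Matrix.exp_add_of_commute]
    · rw [← neg_add, ← add_smul]; push_cast; ring_nf
    · exact (((Commute.refl _).smul_left _).smul_right _).neg_left.neg_right
  rw [evolve, h1, h2, evolve, evolve]
  simp only [mul_assoc]

theorem exp_neg_mul_exp (A : ChainOp n) : NormedSpace.exp (-A) * NormedSpace.exp A = 1 := by
  rw [← Matrix.exp_add_of_commute _ _ (Commute.refl A).neg_left, neg_add_cancel,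
    NormedSpace.exp_zero]

theorem exp_conjTranspose (t : ℝ) :
    (NormedSpace.exp ((Complex.I * (t : ℂ)) • hamiltonian Δ n)).conjTranspose
      = NormedSpace.exp (-((Complex.I * (t : ℂ)) • hamiltonian Δ n)) := by
  rw [← Matrix.exp_conjTranspose, Matrix.conjTranspose_smul, hamiltonian_conjTranspose,
    ← neg_smul]
  congr 2
  simp

theorem exp_neg_conjTranspose (t : ℝ) :
    (NormedSpace.exp (-((Complex.I * (t : ℂ)) • hamiltonian Δ n))).conjTranspose
      = NormedSpace.exp ((Complex.I * (t : ℂ)) • hamiltonian Δ n) := by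
  rw [← exp_conjTranspose, Matrix.conjTranspose_conjTranspose]

theorem evolve_conjTranspose (t : ℝ) (A : ChainOp n) :
    (evolve Δ n t A).conjTranspose = evolve Δ n t A.conjTranspose := by
  rw [evolve, Matrix.conjTranspose_mul, Matrix.conjTranspose_mul, exp_neg_conjTranspose,
    exp_conjTranspose, evolve, mul_assoc]

theorem evolve_mul (t : ℝ) (A B : ChainOp n) :
    evolve Δ n t (A * B) = evolve Δ n t A * evolve Δ n t B := by
  have h := exp_neg_mul_exp ((Complex.I * (t : ℂ)) • hamiltonian Δ n)
  simp only [evolve]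
  calc _ = NormedSpace.exp ((Complex.I * (t : ℂ)) • hamiltonian Δ n) * A * 1 * B
        * NormedSpace.exp (-((Complex.I * (t : ℂ)) • hamiltonian Δ n)) := by
          rw [mul_one]; simp only [mul_assoc]
    _ = _ := by rw [← h]; simp only [mul_assoc]

theorem tracial_evolve (t : ℝ) (A : ChainOp n) : tracial n (evolve Δ n t A) = tracial n A := by
  rw [evolve, tracial_mul_comm, ← mul_assoc, exp_neg_mul_exp, one_mul]

theorem hsInner_evolve (t : ℝ) (A B : ChainOp n) :
    hsInner n (evolve Δ n t A) (evolve Δ n t B) = hsInner n A B := by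
  rw [hsInner, evolve_conjTranspose, ← evolve_mul, tracial_evolve, hsInner]

theorem hsNorm_evolve (t : ℝ) (A : ChainOp n) : hsNorm n (evolve Δ n t A) = hsNorm n A := by
  rw [hsNorm, hsInner_evolve, hsNorm]

/-- The derivation is a sum of a left and a right multiplication, which commute, so the binomial
theorem applies. -/
theorem deriv_pow_eq_sum (H A : ChainOp n) (k : ℕ) :
    (deriv H ^ k) A = ∑ p ∈ Finset.HasAntidiagonal.antidiagonal k,
      k.choose p.1 • ((Complex.I • H) ^ p.1 * A * (-(Complex.I • H)) ^ p.2) := by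
  have h : deriv H = LinearMap.mulLeft ℂ (Complex.I • H) + LinearMap.mulRight ℂ (-(Complex.I • H))
      := by
    refine LinearMap.ext fun B => ?_
    rw [deriv_apply, LinearMap.add_apply, LinearMap.mulLeft_apply, LinearMap.mulRight_apply,
      Matrix.smul_mul, mul_neg, Matrix.mul_smul, smul_sub, sub_eq_add_neg]
  rw [h, Commute.add_pow' (LinearMap.commute_mulLeft_right (R := ℂ) _ _), LinearMap.sum_apply]
  refine Finset.sum_congr rfl fun p _ => ?_
  rw [LinearMap.smul_apply, Module.End.mul_apply, LinearMap.pow_mulLeft, LinearMap.pow_mulRight,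
    LinearMap.mulLeft_apply, LinearMap.mulRight_apply, mul_assoc]

/-- The Taylor series of the Heisenberg evolution. -/
theorem hasSum_evolve (t : ℝ) (A : ChainOp n) :
    HasSum (fun j : ℕ => ((t : ℂ) ^ j / (j.factorial : ℂ)) •
      (deriv (hamiltonian Δ n) ^ j) A) (evolve Δ n t A) := by
  set X : ChainOp n := (Complex.I * (t : ℂ)) • hamiltonian Δ n with hX
  have e1 := NormedSpace.exp_series_hasSum_exp' (𝕂 := ℂ) X
  have e2 := NormedSpace.exp_series_hasSum_exp' (𝕂 := ℂ) (-X)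
  have s1 : Summable fun j : ℕ => ‖((j.factorial : ℂ)⁻¹ • X ^ j) * A‖ :=
    ((NormedSpace.norm_expSeries_summable' (𝕂 := ℂ) X).mul_right ‖A‖).of_nonneg_of_le
      (fun _ => norm_nonneg _) fun _ => norm_mul_le _ _
  have s2 := NormedSpace.norm_expSeries_summable' (𝕂 := ℂ) (-X)
  -- The Cauchy product of the two exponential series, with A absorbed into the first factor.
  have h := tsum_mul_tsum_eq_tsum_sum_antidiagonal_of_summable_norm s1 s2
  have hs := (summable_norm_sum_mul_antidiagonal_of_summable_norm s1 s2).of_norm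
  rw [(e1.mul_right A).tsum_eq, e2.tsum_eq] at h
  have h' := hs.hasSum
  rw [← h] at h'
  have e : (fun j : ℕ => ((t : ℂ) ^ j / (j.factorial : ℂ)) • (deriv (hamiltonian Δ n) ^ j) A)
      = fun j => ∑ p ∈ Finset.HasAntidiagonal.antidiagonal j,
        ((p.1.factorial : ℂ)⁻¹ • X ^ p.1) * A * ((p.2.factorial : ℂ)⁻¹ • (-X) ^ p.2) := by
    ext1 j
    rw [deriv_pow_eq_sum, Finset.smul_sum]
    refine Finset.sum_congr rfl fun p hp => ?_
    have hp' : p.1 + p.2 = j := Finset.HasAntidiagonal.mem_antidiagonal.mp hp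
    obtain ⟨Y, hY⟩ : ∃ Y, Y = Complex.I • hamiltonian Δ n := ⟨_, rfl⟩
    have hX1 : X = (t : ℂ) • Y := by rw [hX, hY, smul_smul, mul_comm]
    rw [hX1, ← hY, ← smul_neg, smul_pow, smul_pow, ← Nat.cast_smul_eq_nsmul ℂ]
    simp only [Matrix.smul_mul, Matrix.mul_smul, smul_smul]
    congr 1
    have h1 := Nat.choose_mul_factorial_mul_factorial (Nat.le.intro hp')
    rw [show j - p.1 = p.2 by omega] at h1
    have h2 : (j.choose p.1 : ℂ) * p.1.factorial * p.2.factorial = j.factorial := by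
      exact_mod_cast h1
    have f1 : (p.1.factorial : ℂ) ≠ 0 := by exact_mod_cast p.1.factorial_ne_zero
    have f2 : (p.2.factorial : ℂ) ≠ 0 := by exact_mod_cast p.2.factorial_ne_zero
    have f3 : (j.factorial : ℂ) ≠ 0 := by exact_mod_cast j.factorial_ne_zero
    rw [← hp', pow_add, hp']
    field_simp
    rw [← h2]
    ring
  rw [e]
  exact h'

end Evolution

end

end XXZ

namespace XXZ

noncomputable section

/-! ### Convergence of families of Taylor series -/

section Taylor

/-- `a k` are the successive derivatives of a function, with a uniform radius of convergence. -/
structure IsTaylorFamily (M : ℝ) (a : ℕ → ℝ → ℂ) : Prop where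
  bound : ∀ k s, ‖a k s‖ ≤ M * (60 ^ k * k.factorial)
  hasSum : ∀ (k : ℕ) (s h : ℝ),
    HasSum (fun j : ℕ => ((h : ℂ) ^ j / (j.factorial : ℂ)) * a (k + j) s) (a k (s + h))

variable {M : ℝ} {a : ℕ → ℝ → ℂ}

theorem IsTaylorFamily.nonneg (ha : IsTaylorFamily M a) : 0 ≤ M := by
  have := (norm_nonneg _).trans (ha.bound 0 0)
  simpa using this

/-- (k+j)! ≤ 2^(k+j) k! j! doubles the rate 60 to 120, and steps of length 1/240 make the series
geometric with ratio 1/2. -/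
theorem IsTaylorFamily.term_le (ha : IsTaylorFamily M a) (k : ℕ) (s : ℝ) {h : ℝ}
    (hh : |h| ≤ 1 / 240) (j : ℕ) :
    ‖((h : ℂ) ^ j / (j.factorial : ℂ)) * a (k + j) s‖
      ≤ M * (120 ^ k * k.factorial) * (1 / 2) ^ j := by
  have hj : (0 : ℝ) < j.factorial := by exact_mod_cast j.factorial_pos
  have h1 : ((k + j).factorial : ℝ) ≤ 2 ^ (k + j) * (k.factorial * j.factorial) := by
    have h2 := Nat.choose_le_two_pow (k + j) j
    have h3 := Nat.add_choose_mul_factorial_mul_factorial k j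
    have h4 : (k + j).factorial ≤ 2 ^ (k + j) * (k.factorial * j.factorial) := by
      rw [← h3, mul_assoc]
      exact Nat.mul_le_mul_right _ h2
    exact_mod_cast h4
  rw [norm_mul, norm_div, norm_pow, Complex.norm_real, Complex.norm_natCast, Real.norm_eq_abs]
  have hM := ha.nonneg
  calc |h| ^ j / j.factorial * ‖a (k + j) s‖
      ≤ (1 / 240) ^ j / j.factorial
        * (M * (60 ^ (k + j) * (2 ^ (k + j) * (k.factorial * j.factorial)))) := by
        refine mul_le_mul (by gcongr) ((ha.bound _ _).trans (by gcongr)) (norm_nonneg _)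
          (by positivity)
    _ = M * (120 ^ k * k.factorial) * (1 / 2) ^ j := by
        have e1 : (120 : ℝ) ^ k = 60 ^ k * 2 ^ k := by rw [← mul_pow]; norm_num
        have e2 : (1 / 2 : ℝ) ^ j = (1 / 240) ^ j * (60 ^ j * 2 ^ j) := by
          rw [← mul_pow, ← mul_pow]; norm_num
        rw [e1, e2, pow_add, pow_add]
        field_simp

/-- The constant depends on M only, so the estimate passes to limits of families and gives
continuity there. -/
theorem IsTaylorFamily.norm_sub_le (ha : IsTaylorFamily M a) (s : ℝ) {h : ℝ}
    (hh : |h| ≤ 1 / 240) : ‖a 0 (s + h) - a 0 s‖ ≤ 120 * M * |h| := by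
  have h1 := ha.hasSum 0 s h
  rw [← hasSum_nat_add_iff' 1] at h1
  simp only [Finset.range_one, Finset.sum_singleton, pow_zero, Nat.factorial_zero, Nat.cast_one,
    div_one, one_mul, add_zero] at h1
  have hM := ha.nonneg
  have h2 : HasSum (fun j : ℕ => 60 * M * |h| * (1 / 2 : ℝ) ^ j) (60 * M * |h| * 2) :=
    hasSum_geometric_two.mul_left _
  rw [← h1.tsum_eq]
  refine (tsum_of_norm_bounded h2 fun j => ?_).trans (le_of_eq (by ring))
  have hj : (0 : ℝ) < (j + 1).factorial := by exact_mod_cast (j + 1).factorial_pos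
  rw [norm_mul, norm_div, norm_pow, Complex.norm_real, Complex.norm_natCast, Real.norm_eq_abs,
    zero_add]
  calc |h| ^ (j + 1) / (j + 1).factorial * ‖a (j + 1) s‖
      ≤ |h| ^ (j + 1) / (j + 1).factorial * (M * (60 ^ (j + 1) * (j + 1).factorial)) := by
        gcongr
        exact ha.bound _ _
    _ = 60 * M * |h| * (60 * |h|) ^ j := by
        rw [mul_pow]
        field_simp
        ring
    _ ≤ _ := by
        gcongr
        linarith

theorem continuous_of_norm_sub_le {E : Type*} [SeminormedAddCommGroup E] {f : ℝ → E} {K : ℝ}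
    (hf : ∀ s h, |h| ≤ 1 / 240 → ‖f (s + h) - f s‖ ≤ K * |h|) : Continuous f := by
  refine continuous_iff_continuousAt.mpr fun s => ?_
  rw [ContinuousAt, tendsto_iff_norm_sub_tendsto_zero]
  have h1 : Tendsto (fun x => K * |x - s|) (𝓝 s) (𝓝 0) := by
    have : Continuous fun x => K * |x - s| := by fun_prop
    simpa using this.tendsto s
  refine squeeze_zero' (Eventually.of_forall fun _ => norm_nonneg _) ?_ h1
  filter_upwards [Metric.closedBall_mem_nhds s (by norm_num : (0 : ℝ) < 1 / 240)] with x hx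
  rw [Metric.mem_closedBall, Real.dist_eq] at hx
  simpa using hf s (x - s) hx

theorem IsTaylorFamily.continuous (ha : IsTaylorFamily M a) : Continuous (a 0) :=
  continuous_of_norm_sub_le fun s _ hh => ha.norm_sub_le s hh

variable {b : ℕ → ℕ → ℝ → ℂ}

/-- Dominated convergence for the Taylor series: convergence of all derivatives at s implies the
same at s + h. -/
theorem tendsto_taylor_step (hb : ∀ n, IsTaylorFamily M (b n)) {s h : ℝ} (hh : |h| ≤ 1 / 240)
    {c : ℕ → ℂ} (hc : ∀ k, Tendsto (fun n => b n k s) atTop (𝓝 (c k))) (k : ℕ) :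
    Tendsto (fun n => b n k (s + h)) atTop
      (𝓝 (∑' j : ℕ, ((h : ℂ) ^ j / (j.factorial : ℂ)) * c (k + j))) := by
  have h1 : ∀ n, b n k (s + h)
      = ∑' j : ℕ, ((h : ℂ) ^ j / (j.factorial : ℂ)) * b n (k + j) s :=
    fun n => ((hb n).hasSum k s h).tsum_eq.symm
  simp only [h1]
  exact tendsto_tsum_of_dominated_convergence
    (summable_geometric_two.mul_left (M * (120 ^ k * k.factorial)))
    (fun j => (hc (k + j)).const_mul _)
    (Eventually.of_forall fun n j => (hb n).term_le k s hh j)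

/-- The admissible step is uniform in s, so finitely many equal steps lead from 0 to any real time.
-/
theorem forall_real_of_step {Q : ℝ → Prop} (h0 : Q 0)
    (h1 : ∀ s h, |h| ≤ 1 / 240 → Q s → Q (s + h)) (s : ℝ) : Q s := by
  obtain ⟨N, hN⟩ := exists_nat_gt (240 * |s|)
  have hN0 : (0 : ℝ) < N := lt_of_le_of_lt (by positivity) hN
  have h2 : ∀ i : ℕ, Q (i * (s / N)) := by
    intro i
    induction i with
    | zero => simpa using h0
    | succ i ih =>
      have := h1 _ (s / N) ?_ ih
      · convert this using 1
        push_cast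
        ring
      · rw [abs_div, abs_of_pos hN0, div_le_div_iff₀ hN0 (by norm_num)]
        linarith
  have := h2 N
  rwa [mul_div_cancel₀ _ hN0.ne'] at this

theorem exists_tendsto_taylor (hb : ∀ n, IsTaylorFamily M (b n))
    (h0 : ∀ k, ∃ c, Tendsto (fun n => b n k 0) atTop (𝓝 c)) (s : ℝ) :
    ∀ k, ∃ c, Tendsto (fun n => b n k s) atTop (𝓝 c) := by
  refine forall_real_of_step (Q := fun s => ∀ k, ∃ c, Tendsto (fun n => b n k s) atTop (𝓝 c))
    h0 (fun s h hh hs k => ?_) s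
  choose c hc using hs
  exact ⟨_, tendsto_taylor_step hb hh hc k⟩

/-- If all higher derivatives die out in the limit, only the zeroth Taylor term survives a step, and
the property reproduces itself. -/
theorem tendsto_taylor_const (hb : ∀ n, IsTaylorFamily M (b n)) {g : ℂ}
    (h0 : ∀ k, Tendsto (fun n => b n k 0) atTop (𝓝 (if k = 0 then g else 0))) (s : ℝ) :
    Tendsto (fun n => b n 0 s) atTop (𝓝 g) := by
  have := forall_real_of_step
    (Q := fun s => ∀ k, Tendsto (fun n => b n k s) atTop (𝓝 (if k = 0 then g else 0)))
    h0 (fun s h hh hs k => ?_) s 0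
  · simpa using this
  · have h1 := tendsto_taylor_step hb hh hs k
    rw [tsum_eq_single 0] at h1
    · simpa using h1
    · intro j hj
      rw [if_neg (by omega), mul_zero]

end Taylor

/-! ### The current autocorrelation function -/

section Autocorrelation

variable {Δ : ℝ}

/-- The overlap per site of `A` with the evolved `k`-th derivative of the current. -/
def currentOverlap (Δ : ℝ) (n : ℕ) (A : ChainOp n) (k : ℕ) (s : ℝ) : ℂ :=
  hsInner n A (evolve Δ n s ((deriv (hamiltonian Δ n) ^ k) (current n))) / (n : ℂ)

/-- The evolution preserves the Hilbert-Schmidt norm, so the bounds at time zero hold at all times;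
the two factors √n cancel the division by n. -/
theorem isTaylorFamily_currentOverlap (hΔ : |Δ| ≤ 1) {n : ℕ} {A : ChainOp n} {G : ℝ}
    (hA : hsNorm n A ≤ √n * G) (hG : 0 ≤ G) :
    IsTaylorFamily (16 * G) (currentOverlap Δ n A) := by
  constructor
  · intro k s
    rcases n.eq_zero_or_pos with rfl | hn
    · simp only [currentOverlap, Nat.cast_zero, div_zero, norm_zero]
      positivity
    have hn' : (0 : ℝ) < n := by exact_mod_cast hn
    rw [currentOverlap, norm_div, Complex.norm_natCast, div_le_iff₀ hn']
    refine (norm_hsInner_le _ _).trans ?_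
    rw [hsNorm_evolve]
    refine (mul_le_mul hA (hsNorm_deriv_pow_current_le hΔ n k) (hsNorm_nonneg _)
      (by positivity)).trans (le_of_eq ?_)
    have := Real.mul_self_sqrt hn'.le
    calc _ = (√n * √n) * (16 * G * (60 ^ k * k.factorial)) := by ring
      _ = _ := by rw [this]; ring
  · intro k s h
    let L : ChainOp n →ₗ[ℂ] ℂ :=
      { toFun := fun B => hsInner n A (evolve Δ n s B) / (n : ℂ)
        map_add' := fun B C => by
          rw [evolve, mul_add, add_mul, hsInner_add_right, add_div]; rfl
        map_smul' := fun c B => by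
          rw [evolve, Matrix.mul_smul, Matrix.smul_mul, hsInner_smul_right, mul_div_assoc]; rfl }
    have hL : Continuous L := L.continuous_of_finiteDimensional
    have h1 := (hasSum_evolve (Δ := Δ) h ((deriv (hamiltonian Δ n) ^ k) (current n))).map L hL
    have e : L (evolve Δ n h ((deriv (hamiltonian Δ n) ^ k) (current n)))
        = currentOverlap Δ n A k (s + h) := by
      rw [currentOverlap, evolve_add]; rfl
    rw [e] at h1
    have e' : (fun j : ℕ => ((h : ℂ) ^ j / (j.factorial : ℂ)) * currentOverlap Δ n A (k + j) s)
        = L ∘ fun j : ℕ => ((h : ℂ) ^ j / (j.factorial : ℂ)) •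
          (deriv (hamiltonian Δ n) ^ j) ((deriv (hamiltonian Δ n) ^ k) (current n)) := by
      ext1 j
      rw [Function.comp_apply, map_smul, smul_eq_mul, ← Module.End.mul_apply, ← pow_add,
        add_comm j k]
      rfl
    rw [e']
    exact h1

theorem hsNorm_current_le (hΔ : |Δ| ≤ 1) (n : ℕ) : hsNorm n (current n) ≤ √n * 16 := by
  simpa using hsNorm_deriv_pow_current_le hΔ n 0

theorem isTaylorFamily_current (hΔ : |Δ| ≤ 1) (n : ℕ) :
    IsTaylorFamily (16 * 16) (currentOverlap Δ n (current n)) :=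
  isTaylorFamily_currentOverlap hΔ (hsNorm_current_le hΔ n) (by norm_num)

theorem currentOverlap_zero_zero (n : ℕ) (A : ChainOp n) (k : ℕ) :
    currentOverlap Δ n A k 0
      = hsInner n A ((deriv (hamiltonian Δ n) ^ k) (current n)) / (n : ℂ) := by
  rw [currentOverlap, evolve_zero]

theorem currentOverlap_eq (n : ℕ) (A : ChainOp n) (s : ℝ) :
    currentOverlap Δ n A 0 s = hsInner n A (evolve Δ n s (current n)) / (n : ℂ) := rfl

theorem tracial_current_mul (n : ℕ) (A : ChainOp n) :
    tracial n (current n * A) = hsInner n (current n) A := by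
  rw [hsInner, current_conjTranspose]

theorem hsInner_current_evolve_conj (n : ℕ) (s : ℝ) :
    starRingEnd ℂ (hsInner n (current n) (evolve Δ n s (current n)))
      = hsInner n (current n) (evolve Δ n s (current n)) := by
  rw [hsInner_conj, hsInner, evolve_conjTranspose, current_conjTranspose, tracial_mul_comm,
    tracial_current_mul]

theorem hsInner_evolve_evolve (n : ℕ) (s t : ℝ) :
    hsInner n (evolve Δ n s (current n)) (evolve Δ n t (current n))
      = hsInner n (current n) (evolve Δ n (t - s) (current n)) := by
  rw [← hsInner_evolve (Δ := Δ) (-s), ← evolve_add, ← evolve_add, neg_add_cancel, evolve_zero,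
    neg_add_eq_sub]

theorem hsInner_current_evolve_neg (n : ℕ) (s : ℝ) :
    hsInner n (current n) (evolve Δ n (-s) (current n))
      = hsInner n (current n) (evolve Δ n s (current n)) := by
  rw [← hsInner_current_evolve_conj n s, hsInner_conj, ← zero_sub, ← hsInner_evolve_evolve,
    evolve_zero]

/-- The current autocorrelation function of the infinite chain exists. -/
theorem exists_correlation (hΔ : |Δ| ≤ 1) : ∃ C : ℝ → ℝ, IsCurrentCorrelation Δ C ∧
    (∀ s, C (-s) = C s) ∧
    ∀ s, Tendsto (fun n => currentOverlap Δ n (current n) 0 s) atTop (𝓝 (C s : ℂ)) := by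
  have h0 : ∀ k, ∃ c, Tendsto (fun n => currentOverlap Δ n (current n) k 0) atTop (𝓝 c) := by
    intro k
    refine ⟨_, (tendsto_hsInner_current_deriv_pow hΔ k).congr fun n => ?_⟩
    rw [currentOverlap_zero_zero]
  have h1 := fun s => exists_tendsto_taylor (fun n => isTaylorFamily_current hΔ n) h0 s 0
  choose c hc using h1
  have hreal : ∀ s, (c s).im = 0 := by
    intro s
    have h2 : Tendsto (fun n => (currentOverlap Δ n (current n) 0 s).im) atTop (𝓝 (c s).im) :=
      (Complex.continuous_im.tendsto _).comp (hc s)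
    refine tendsto_nhds_unique h2 ?_
    have : ∀ n, (currentOverlap Δ n (current n) 0 s).im = 0 := by
      intro n
      refine Complex.conj_eq_iff_im.mp ?_
      rw [currentOverlap_eq, map_div₀, hsInner_current_evolve_conj, Complex.conj_natCast]
    simp [this]
  have hre : ∀ s, ((c s).re : ℂ) = c s := fun s => Complex.ext (by simp) (by simp [hreal s])
  have hc' : ∀ s, Tendsto (fun n => currentOverlap Δ n (current n) 0 s) atTop
      (𝓝 (((c s).re : ℝ) : ℂ)) := fun s => by rw [hre]; exact hc s
  refine ⟨fun s => (c s).re, ⟨?_, fun s => ?_⟩, fun s => ?_, hc'⟩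
  · refine Complex.continuous_re.comp (continuous_of_norm_sub_le (K := 120 * (16 * 16))
      fun s h hh => ?_)
    refine le_of_tendsto ((hc (s + h)).sub (hc s)).norm (Eventually.of_forall fun n => ?_)
    exact (isTaylorFamily_current hΔ n).norm_sub_le s hh
  · simp only [tracial_current_mul]
    exact hc' s
  · have h2 := hc' (-s)
    have h3 : ∀ n, currentOverlap Δ n (current n) 0 (-s) = currentOverlap Δ n (current n) 0 s :=
      fun n => by rw [currentOverlap_eq, hsInner_current_evolve_neg, currentOverlap_eq]
    simp only [h3] at h2
    exact_mod_cast tendsto_nhds_unique h2 (hc' s)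

/-- The charges keep a constant overlap per site with the evolved current. -/
theorem tendsto_hsInner_charge_evolve {γ : ℝ} {φ : ℂ} (hγ : Real.sin γ ≠ 0)
    (hφ : Complex.sin φ ≠ 0) {G : ℝ} (hG : ∀ n, hsNorm n (charge γ n φ) ≤ √n * G) (hG0 : 0 ≤ G)
    (s : ℝ) : Tendsto (fun n : ℕ => hsInner n (charge γ n φ)
      (evolve (Real.cos γ) n s (current n)) / (n : ℂ)) atTop (𝓝 (-Complex.I)) := by
  refine tendsto_taylor_const (M := 16 * G)
    (b := fun n => currentOverlap (Real.cos γ) n (charge γ n φ))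
    (fun n => isTaylorFamily_currentOverlap (Real.abs_cos_le_one γ) (hG n) hG0) (fun k => ?_) s
  refine (tendsto_hsInner_charge_deriv_pow hγ hφ hG k).congr fun n => ?_
  rw [currentOverlap_zero_zero]

end Autocorrelation

end

end XXZ

namespace XXZ

noncomputable section

/-! ### Integrability of the norm bound against the weight -/

section NormBound

variable {m : ℕ} {κ : ℝ} {γ : ℝ}

/-- A bound on the norm of the charge per square root of the length. -/
def normBound (κ : ℝ) (m : ℕ) (φ : ℂ) : ℝ := √(1 / (4 * κ * gap m φ))

theorem hsNorm_charge_le (hm : 2 ≤ m) (hγ : Real.sin γ ≠ 0) (hγm : Real.sin (γ * m) = 0)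
    (hκ0 : 0 < κ) (hκ : ∀ k, k + 1 < m → κ ≤ Real.sin (γ * (k + 1 : ℕ)) ^ 2) {φ : ℂ}
    (hφ : φ ∈ strip m) (n : ℕ) : hsNorm n (charge γ n φ) ≤ √n * normBound κ m φ := by
  rw [normBound, ← Real.sqrt_mul (Nat.cast_nonneg n)]
  exact Real.sqrt_le_sqrt (hsInner_charge_self_le hm hγ hγm hκ0 hκ hφ n)

theorem normBound_nonneg (φ : ℂ) : 0 ≤ normBound κ m φ := Real.sqrt_nonneg _

theorem measurable_normBound : Measurable (normBound κ m) := by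
  have h1 : Measurable fun φ : ℂ => φ.re := Complex.measurable_re
  unfold normBound gap
  fun_prop

/-- The product form exhibits the zeros of the gap at the two edges. -/
theorem gap_numerator_eq (x : ℝ) : -Real.cos (2 * x) - Real.cos (Real.pi / m)
    = 2 * Real.sin (x - stripL m) * Real.sin (stripR m - x) := by
  have e1 : x - stripL m = (x - Real.pi / 2) + Real.pi / (2 * m) := by rw [stripL]; ring
  have e2 : stripR m - x = Real.pi / (2 * m) - (x - Real.pi / 2) := by rw [stripR]; ring
  have e3 : 2 * x = 2 * (x - Real.pi / 2) + Real.pi := by ring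
  have e4 : Real.pi / m = 2 * (Real.pi / (2 * m)) := by
    rw [mul_comm 2 (m : ℝ), ← div_div, mul_div_cancel₀ _ two_ne_zero]
  rw [e1, e2, e3, e4]
  generalize x - Real.pi / 2 = t
  generalize Real.pi / (2 * m) = b
  rw [Real.cos_add_pi, Real.cos_two_mul, Real.cos_two_mul, Real.sin_add,
    Real.sin_sub]
  have h1 := Real.sin_sq_add_cos_sq t
  have h2 := Real.sin_sq_add_cos_sq b
  linear_combination 2 * Real.cos b ^ 2 * h1 - 2 * Real.cos t ^ 2 * h2

theorem stripR_sub_stripL_le (hm : 2 ≤ m) : stripR m - stripL m ≤ Real.pi / 2 := by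
  have : (2 : ℝ) ≤ m := by exact_mod_cast hm
  have h : Real.pi / (2 * m) ≤ Real.pi / 4 := by
    have := Real.pi_pos
    gcongr
    linarith
  rw [stripL, stripR]
  linarith

/-- Jordan's inequality bounds the numerator below by uv/4, where u, v are the distances to the
edges. Then √(u+v) ≤ √u + √v splits 1/√(uv) into two integrable edge singularities. -/
theorem inv_sqrt_gap_numerator_le (hm : 2 ≤ m) {x : ℝ} (hx : x ∈ Set.Ioo (stripL m) (stripR m)) :
    1 / √(-Real.cos (2 * x) - Real.cos (Real.pi / m))
      ≤ 2 / √(stripR m - stripL m) * (1 / √(x - stripL m) + 1 / √(stripR m - x)) := by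
  have hu : 0 < x - stripL m := sub_pos.mpr hx.1
  have hv : 0 < stripR m - x := sub_pos.mpr hx.2
  have hl := stripR_sub_stripL_le hm
  have h1 := Real.mul_le_sin hu.le (by linarith)
  have h2 := Real.mul_le_sin hv.le (by linarith)
  have hpi := Real.pi_pos
  have hpi4 := Real.pi_lt_four
  have hc : 1 / 4 ≤ 2 * (2 / Real.pi) * (2 / Real.pi) := by
    have : 1 / 2 ≤ 2 / Real.pi := by rw [div_le_div_iff₀ (by norm_num) hpi]; linarith
    nlinarith
  set u := x - stripL m
  set v := stripR m - x
  have huv : stripR m - stripL m = u + v := by simp only [u, v]; ring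
  have hN : (1 / 2) ^ 2 * (u * v) ≤ -Real.cos (2 * x) - Real.cos (Real.pi / m) := by
    rw [gap_numerator_eq]
    calc (1 / 2) ^ 2 * (u * v) ≤ 2 * (2 / Real.pi) * (2 / Real.pi) * (u * v) := by
          gcongr; linarith
      _ = 2 * (2 / Real.pi * u) * (2 / Real.pi * v) := by ring
      _ ≤ _ := by
        have := (mul_nonneg (by positivity) hu.le).trans h1
        have := mul_le_mul h1 h2 (by positivity) this
        linarith
  have hsu := Real.sqrt_pos.mpr hu
  have hsv := Real.sqrt_pos.mpr hv
  have hs : 1 / 2 * (√u * √v) ≤ √(-Real.cos (2 * x) - Real.cos (Real.pi / m)) := by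
    rw [← Real.sqrt_mul hu.le]
    refine Real.le_sqrt_of_sq_le ?_
    rw [mul_pow, Real.sq_sqrt (by positivity)]
    exact hN
  have hsum : √(u + v) ≤ √u + √v := by
    refine Real.sqrt_le_iff.mpr ⟨by positivity, ?_⟩
    nlinarith [Real.sq_sqrt hu.le, Real.sq_sqrt hv.le, mul_pos hsu hsv]
  have hs0 : 0 < √(u + v) := Real.sqrt_pos.mpr (by linarith)
  rw [huv]
  calc 1 / √(-Real.cos (2 * x) - Real.cos (Real.pi / m)) ≤ 1 / (1 / 2 * (√u * √v)) :=
        one_div_le_one_div_of_le (by positivity) hs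
    _ = 2 / √(u + v) * (√(u + v) / (√u * √v)) := by field_simp
    _ ≤ 2 / √(u + v) * ((√u + √v) / (√u * √v)) := by gcongr
    _ = _ := by field_simp; ring

theorem intervalIntegrable_one_div_sqrt {b : ℝ} (hb : 0 ≤ b) :
    IntervalIntegrable (fun x : ℝ => 1 / √x) volume 0 b := by
  refine (intervalIntegral.intervalIntegrable_rpow' (r := -(1 / 2))
    (by norm_num)).congr fun x hx => ?_
  rw [Set.uIoc_of_le hb] at hx
  rw [Real.rpow_neg hx.1.le, ← Real.sqrt_eq_rpow, one_div]

/-- The norm bound diverges at the edges only like an inverse square root and grows vertically like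
|sin z|, which the weight absorbs. This domination justifies interchanging n → ∞ with the integrals
over the strip. -/
theorem integrableOn_weight_mul_normBound (hm : 2 ≤ m) (hκ0 : 0 < κ) {c : ℝ} (hc : 0 < c) :
    IntegrableOn (fun φ => weight c φ * normBound κ m φ) (strip m) := by
  have hI : IntegrableOn (fun x => c * √2 / √(4 * κ) * (2 / √(stripR m - stripL m) *
      (1 / √(x - stripL m) + 1 / √(stripR m - x)))) (Set.Ioo (stripL m) (stripR m)) := by
    refine Integrable.const_mul (Integrable.const_mul (Integrable.add ?_ ?_) _) _
    · have := (intervalIntegrable_one_div_sqrt (sub_nonneg.mpr (stripL_le_stripR m))).comp_sub_right (stripL m)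
      rw [zero_add, sub_add_cancel, intervalIntegrable_iff_integrableOn_Ioo_of_le
        (stripL_le_stripR m)] at this
      exact this
    · have := (intervalIntegrable_one_div_sqrt (sub_nonneg.mpr (stripL_le_stripR m))).comp_sub_left (stripR m)
      rw [sub_zero, sub_sub_cancel] at this
      have := this.symm
      rw [intervalIntegrable_iff_integrableOn_Ioo_of_le (stripL_le_stripR m)] at this
      exact this
  refine integrableOn_strip_of_le (m := m) (q := fun y => 2 * (1 + y ^ 2)⁻¹) ?_ hI
    (integrable_inv_one_add_sq.const_mul 2) fun z hz => ?_
  · refine Measurable.aestronglyMeasurable ?_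
    refine Measurable.mul ?_ measurable_normBound
    unfold weight
    fun_prop
  · have hz' := mem_strip_iff.mp hz
    have hs := norm_pos_iff.mpr (sin_ne_zero_of_mem_strip hm hz)
    have h1 := one_div_norm_sin_sq_le hm hz
    have h2 := inv_sqrt_gap_numerator_le hm hz'
    have h3 : 1 / ‖Complex.sin z‖ ≤ √2 := by
      refine Real.le_sqrt_of_sq_le ?_
      rw [div_pow, one_pow]
      refine h1.trans ?_
      have : (1 + z.im ^ 2)⁻¹ ≤ 1 := inv_le_one_of_one_le₀ (by nlinarith [sq_nonneg z.im])
      linarith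
    rw [Real.norm_of_nonneg (mul_nonneg (by unfold weight; positivity) (normBound_nonneg z))]
    -- Of |sin z|⁻³ one factor is bounded by √2, and the other two give the decay 2/(1 + y²).
    have e : weight c z * normBound κ m z = c * (1 / ‖Complex.sin z‖) / √(4 * κ)
        * (1 / √(-Real.cos (2 * z.re) - Real.cos (Real.pi / m))) * (1 / ‖Complex.sin z‖ ^ 2) := by
      have hN : 0 < -Real.cos (2 * z.re) - Real.cos (Real.pi / m) := by
        have := gap_pos hm hz
        rw [gap] at this
        exact (div_pos_iff_of_pos_right (by positivity)).mp this
      have hq : 1 / (4 * κ * gap m z) = ‖Complex.sin z‖ ^ 2 /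
          (4 * κ * (-Real.cos (2 * z.re) - Real.cos (Real.pi / m))) := by
        rw [gap]; field_simp
      rw [weight, normBound, hq, Real.sqrt_div (by positivity), Real.sqrt_sq hs.le,
        Real.sqrt_mul (by positivity)]
      field_simp
    rw [e]
    gcongr

end NormBound

end

end XXZ

namespace XXZ

noncomputable section

/-! ### The weighted charge -/

section WeightedCharge

variable {γ c : ℝ} {m : ℕ} {g : ℂ → ℝ}

theorem measurable_laxVec (γ : ℝ) {n : ℕ} (α : Fin n → SpinLabel) (a : AuxLabel) :
    Measurable fun φ : ℂ => laxVec γ φ α a := by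
  induction n generalizing a with
  | zero => simp only [laxVec_zero]; exact measurable_const
  | succ n ih =>
    have h := ih fun x => α x.succ
    rw [← Fin.cons_self_tail α]
    simp only [laxVec_cons, lax_apply]
    have h' : ∀ a, Measurable fun φ : ℂ => laxVec γ φ (Fin.tail α) a := h
    rcases α 0 <;> rcases a with _ | _ | (_ | k) <;> simp only [laxCoord] <;> fun_prop

theorem measurable_hsInner_charge (γ : ℝ) {n : ℕ} (A : ChainOp n) :
    Measurable fun φ : ℂ => hsInner n A (charge γ n φ) := by
  simp only [charge_eq, hsInner_sum_right, hsInner_smul_right]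
  exact Finset.measurable_sum _ fun α _ => (measurable_laxVec γ α _).mul_const _

theorem measurable_charge_hsInner (γ : ℝ) {n : ℕ} (A : ChainOp n) :
    Measurable fun φ : ℂ => hsInner n (charge γ n φ) A := by
  have h := Complex.continuous_conj.measurable.comp (measurable_hsInner_charge γ A)
  simpa only [Function.comp_def, hsInner_conj] using h

theorem norm_hsInner_div_le {n : ℕ} {A B : ChainOp n} {a b : ℝ} (hA : hsNorm n A ≤ √n * a)
    (hB : hsNorm n B ≤ √n * b) (ha : 0 ≤ a) (hb : 0 ≤ b) : ‖hsInner n A B / (n : ℂ)‖ ≤ a * b := by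
  rcases n.eq_zero_or_pos with rfl | hn
  · simp; positivity
  have hn' : (0 : ℝ) < n := by exact_mod_cast hn
  rw [norm_div, Complex.norm_natCast, div_le_iff₀ hn']
  refine (norm_hsInner_le _ _).trans ((mul_le_mul hA hB (hsNorm_nonneg _)
    (by positivity)).trans (le_of_eq ?_))
  calc _ = (√n * √n) * (a * b) := by ring
    _ = _ := by rw [Real.mul_self_sqrt hn'.le]; ring

theorem measurable_weight (c : ℝ) : Measurable (weight c) := by
  unfold weight
  fun_prop

theorem weight_nonneg (hc : 0 ≤ c) (φ : ℂ) : 0 ≤ weight c φ := by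
  unfold weight
  positivity

theorem norm_weight (hc : 0 ≤ c) (φ : ℂ) : ‖(weight c φ : ℂ)‖ = weight c φ := by
  rw [Complex.norm_real, Real.norm_of_nonneg (weight_nonneg hc φ)]

/-- The charges integrated against the weight. -/
def weightedCharge (γ c : ℝ) (m n : ℕ) : ChainOp n :=
  ∑ α : Fin n → SpinLabel, (∫ φ in strip m, (weight c φ : ℂ) * laxVec γ φ α .left) •
    tensor fun x => pauli (α x)

/-- `g` bounds the norms of the charges and is integrable against the weight. -/
structure IsChargeBound (γ c : ℝ) (m : ℕ) (g : ℂ → ℝ) : Prop where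
  const_nonneg : 0 ≤ c
  nonneg : ∀ φ, 0 ≤ g φ
  norm_le : ∀ φ ∈ strip m, ∀ n, hsNorm n (charge γ n φ) ≤ √n * g φ
  integrable : IntegrableOn (fun φ => weight c φ * g φ) (strip m)

/-- The amplitude of a string is its overlap with the charge up to a nonzero weight, so it inherits
the norm bound by Cauchy-Schwarz. -/
theorem integrableOn_weight_mul_laxVec (hg : IsChargeBound γ c m g) {n : ℕ} (α : Fin n → SpinLabel) :
    IntegrableOn (fun φ => (weight c φ : ℂ) * laxVec γ φ α .left) (strip m) := by
  set w := ∏ y, pauliWeight (α y) with hw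
  have hw0 : w ≠ 0 := by
    rw [hw, Finset.prod_ne_zero_iff]
    intro x _
    rcases α x <;> simp [pauliWeight]
  set K := hsNorm n (tensor fun y => pauli (α y)) * √n / ‖w‖ with hK
  refine Integrable.mono' (hg.integrable.const_mul K) ?_ ?_
  · refine Measurable.aestronglyMeasurable ?_
    exact (Complex.measurable_ofReal.comp (measurable_weight c)).mul (measurable_laxVec γ α _)
  · refine (ae_restrict_mem (measurableSet_strip m)).mono fun φ hφ => ?_
    have h1 : ‖laxVec γ φ α .left‖ ≤ K * g φ := by
      have h2 := hsInner_tensor_charge γ φ α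
      have h3 := norm_hsInner_le (tensor fun y => pauli (α y)) (charge γ n φ)
      rw [h2, norm_mul, ← hw] at h3
      have h4 := mul_le_mul_of_nonneg_left (hg.norm_le φ hφ n)
        (hsNorm_nonneg (tensor fun y => pauli (α y)))
      have h5 : 0 < ‖w‖ := norm_pos_iff.mpr hw0
      rw [hK, div_mul_eq_mul_div, le_div_iff₀ h5]
      linarith
    rw [norm_mul, norm_weight hg.const_nonneg]
    calc _ ≤ weight c φ * (K * g φ) := mul_le_mul_of_nonneg_left h1 (weight_nonneg hg.const_nonneg φ)
      _ = _ := by ring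

theorem hsInner_weightedCharge (hg : IsChargeBound γ c m g) {n : ℕ} (A : ChainOp n) :
    hsInner n A (weightedCharge γ c m n)
    = ∫ φ in strip m, (weight c φ : ℂ) * hsInner n A (charge γ n φ) := by
  have h := fun α : Fin n → SpinLabel => integrableOn_weight_mul_laxVec hg α
  simp only [weightedCharge, charge_eq, hsInner_sum_right, hsInner_smul_right, Finset.mul_sum,
    ← mul_assoc]
  rw [integral_finsetSum _ fun α _ => (h α).mul_const _]
  exact Finset.sum_congr rfl fun α _ => (integral_mul_const _ _).symm

theorem hsInner_weightedCharge_left (hg : IsChargeBound γ c m g) {n : ℕ} (A : ChainOp n) :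
    hsInner n (weightedCharge γ c m n) A
      = ∫ φ in strip m, (weight c φ : ℂ) * hsInner n (charge γ n φ) A := by
  rw [← hsInner_conj, hsInner_weightedCharge hg, ← integral_conj]
  refine integral_congr_ae (Eventually.of_forall fun φ => ?_)
  simp only [map_mul, Complex.conj_ofReal, hsInner_conj]

/-- The overlap per site of the weighted charge with the evolved current. -/
theorem tendsto_hsInner_weightedCharge_evolve (hg : IsChargeBound γ c m g) (hm : 2 ≤ m)
    (hγ : Real.sin γ ≠ 0) (s : ℝ) :
    Tendsto (fun n : ℕ => hsInner n (weightedCharge γ c m n)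
      (evolve (Real.cos γ) n s (current n)) / (n : ℂ)) atTop
      (𝓝 (-Complex.I * ((∫ φ in strip m, weight c φ : ℝ) : ℂ))) := by
  have e : -Complex.I * ((∫ φ in strip m, weight c φ : ℝ) : ℂ)
      = ∫ φ in strip m, (weight c φ : ℂ) * -Complex.I := by
    rw [integral_mul_const, ← integral_complex_ofReal, mul_comm]
  rw [e]
  simp only [hsInner_weightedCharge_left hg, ← integral_div]
  refine tendsto_integral_of_dominated_convergence (fun φ => weight c φ * g φ * 16) ?_
    (hg.integrable.mul_const 16) ?_ ?_
  · intro n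
    refine Measurable.aestronglyMeasurable ?_
    refine ((Complex.measurable_ofReal.comp (measurable_weight c)).mul ?_).div_const _
    exact measurable_charge_hsInner γ _
  · intro n
    refine (ae_restrict_mem (measurableSet_strip m)).mono fun φ hφ => ?_
    rw [mul_div_assoc, norm_mul, norm_weight hg.const_nonneg, mul_assoc]
    refine mul_le_mul_of_nonneg_left ?_ (weight_nonneg hg.const_nonneg φ)
    refine norm_hsInner_div_le (hg.norm_le φ hφ n) ?_ (hg.nonneg φ) (by norm_num)
    rw [hsNorm_evolve]
    exact hsNorm_current_le (Real.abs_cos_le_one γ) n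
  · refine (ae_restrict_mem (measurableSet_strip m)).mono fun φ hφ => ?_
    simp only [mul_div_assoc]
    exact (tendsto_hsInner_charge_evolve hγ (sin_ne_zero_of_mem_strip hm hφ) (hg.norm_le φ hφ) (hg.nonneg φ)
      s).const_mul _

/-- The limit is the left side of the Fredholm equation at φ̄. The equation thus says that the
weighted charge has unit overlap per site with every charge. -/
theorem tendsto_hsInner_charge_weightedCharge (hg : IsChargeBound γ c m g) {l : ℕ}
    (hF : SolvesFredholm l m (weight c)) (hK : ∀ φ ∈ strip m, ∀ φ' ∈ strip m,
      Tendsto (fun n : ℕ => overlap γ n φ φ' / (n : ℂ)) atTop (𝓝 (kernel l m φ φ')))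
    {φ : ℂ} (hφ : φ ∈ strip m) :
    Tendsto (fun n : ℕ => hsInner n (charge γ n φ) (weightedCharge γ c m n) / (n : ℂ)) atTop
      (𝓝 1) := by
  rw [← (hF _ (conj_mem_strip hφ)).2]
  simp only [hsInner_weightedCharge hg, ← integral_div]
  refine tendsto_integral_of_dominated_convergence (fun φ' => weight c φ' * g φ' * g φ) ?_
    (hg.integrable.mul_const _) ?_ ?_
  · intro n
    refine Measurable.aestronglyMeasurable ?_
    exact ((Complex.measurable_ofReal.comp (measurable_weight c)).mul
      (measurable_hsInner_charge γ _)).div_const _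
  · intro n
    refine (ae_restrict_mem (measurableSet_strip m)).mono fun φ' hφ' => ?_
    rw [mul_div_assoc, norm_mul, norm_weight hg.const_nonneg, mul_assoc, mul_comm (g φ')]
    exact mul_le_mul_of_nonneg_left (norm_hsInner_div_le (hg.norm_le φ hφ n)
      (hg.norm_le φ' hφ' n) (hg.nonneg φ) (hg.nonneg φ')) (weight_nonneg hg.const_nonneg φ')
  · refine (ae_restrict_mem (measurableSet_strip m)).mono fun φ' hφ' => ?_
    simp only [mul_div_assoc]
    rw [mul_comm (kernel l m _ _)]
    refine Tendsto.const_mul _ ((hK _ (conj_mem_strip hφ) φ' hφ').congr fun n => ?_)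
    rw [overlap, Complex.conj_conj]

theorem norm_hsInner_charge_weightedCharge_le (hg : IsChargeBound γ c m g) {φ : ℂ}
    (hφ : φ ∈ strip m) (n : ℕ) :
    ‖hsInner n (charge γ n φ) (weightedCharge γ c m n) / (n : ℂ)‖
      ≤ g φ * ∫ φ' in strip m, weight c φ' * g φ' := by
  rw [hsInner_weightedCharge hg, ← integral_div, ← integral_const_mul]
  refine norm_integral_le_of_norm_le (hg.integrable.const_mul _) ?_
  refine (ae_restrict_mem (measurableSet_strip m)).mono fun φ' hφ' => ?_
  rw [mul_div_assoc, norm_mul, norm_weight hg.const_nonneg, mul_left_comm]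
  exact mul_le_mul_of_nonneg_left (norm_hsInner_div_le (hg.norm_le φ hφ n)
    (hg.norm_le φ' hφ' n) (hg.nonneg φ) (hg.nonneg φ')) (weight_nonneg hg.const_nonneg φ')

/-- The norm per site of the weighted charge. -/
theorem tendsto_hsInner_weightedCharge_self (hg : IsChargeBound γ c m g) {l : ℕ}
    (hF : SolvesFredholm l m (weight c)) (hK : ∀ φ ∈ strip m, ∀ φ' ∈ strip m,
      Tendsto (fun n : ℕ => overlap γ n φ φ' / (n : ℂ)) atTop (𝓝 (kernel l m φ φ'))) :
    Tendsto (fun n : ℕ => hsInner n (weightedCharge γ c m n) (weightedCharge γ c m n) / (n : ℂ))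
      atTop (𝓝 ((∫ φ in strip m, weight c φ : ℝ) : ℂ)) := by
  have e : ((∫ φ in strip m, weight c φ : ℝ) : ℂ)
      = ∫ φ in strip m, (weight c φ : ℂ) * 1 := by
    simp only [mul_one, integral_complex_ofReal]
  rw [e]
  simp only [hsInner_weightedCharge_left hg (weightedCharge γ c m _), ← integral_div]
  refine tendsto_integral_of_dominated_convergence
    (fun φ => weight c φ * g φ * ∫ φ' in strip m, weight c φ' * g φ') ?_
    (hg.integrable.mul_const _) ?_ ?_
  · intro n
    refine Measurable.aestronglyMeasurable ?_
    exact ((Complex.measurable_ofReal.comp (measurable_weight c)).mul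
      (measurable_charge_hsInner γ _)).div_const _
  · intro n
    refine (ae_restrict_mem (measurableSet_strip m)).mono fun φ hφ => ?_
    rw [mul_div_assoc, norm_mul, norm_weight hg.const_nonneg, mul_assoc]
    exact mul_le_mul_of_nonneg_left (norm_hsInner_charge_weightedCharge_le hg hφ n)
      (weight_nonneg hg.const_nonneg φ)
  · refine (ae_restrict_mem (measurableSet_strip m)).mono fun φ hφ => ?_
    simp only [mul_div_assoc]
    exact (tendsto_hsInner_charge_weightedCharge hg hF hK hφ).const_mul _

end WeightedCharge

/-! ### Orthogonality of the weighted charge and its adjoint -/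

section Orthogonality

variable {γ c : ℝ} {m : ℕ} {g : ℂ → ℝ}

/-- To reach |L⟩ the leftmost letter other than σ⁰ must be σ⁻, and taking adjoints turns it into σ⁺.
-/
theorem laxVec_left_eq_zero_or (γ : ℝ) {n : ℕ} (α : Fin n → SpinLabel) :
    (∀ φ, laxVec γ φ α .left = 0) ∨ ∀ φ, laxVec γ φ (fun x => (α x).adj) .left = 0 := by
  induction n with
  | zero => exact Or.inl fun φ => by rw [laxVec_zero]; simp [ket]
  | succ n ih =>
    have e : (fun x => (α x).adj)
        = (Fin.cons (α 0).adj (fun x => (Fin.tail α x).adj) : Fin (n + 1) → SpinLabel) := by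
      ext1 x
      refine Fin.cases ?_ (fun x => ?_) x <;> simp [Fin.tail]
    rw [e, ← Fin.cons_self_tail α]
    simp only [laxVec_cons, lax_apply]
    have := ih (Fin.tail α)
    rcases α 0
    · simpa [laxCoord, SpinLabel.adj] using this
    · exact Or.inl fun φ => rfl
    · exact Or.inr fun φ => rfl
    · exact Or.inl fun φ => rfl

/-- No string occurs in both the charge and its adjoint. -/
theorem hsInner_weightedCharge_adjoint (hg : IsChargeBound γ c m g) (n : ℕ) :
    hsInner n (weightedCharge γ c m n).conjTranspose (weightedCharge γ c m n) = 0 := by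
  have e : (weightedCharge γ c m n).conjTranspose = ∑ α : Fin n → SpinLabel,
      (starRingEnd ℂ (∫ φ in strip m, (weight c φ : ℂ) * laxVec γ φ α .left)) •
        tensor fun x => pauli (α x).adj := by
    simp only [weightedCharge, Matrix.conjTranspose_sum, Matrix.conjTranspose_smul,
      tensor_conjTranspose, pauli_conjTranspose]
    rfl
  rw [e, hsInner_sum_left]
  refine Finset.sum_eq_zero fun α _ => ?_
  rw [hsInner_smul_left, Complex.conj_conj, hsInner_weightedCharge hg]
  rcases laxVec_left_eq_zero_or γ α with h | h
  · simp [h]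
  · have h' : ∀ φ, hsInner n (tensor fun x => pauli (α x).adj) (charge γ n φ) = 0 := fun φ => by
      rw [hsInner_tensor_charge γ φ fun x => (α x).adj, h, zero_mul]
    simp [h']

end Orthogonality

/-! ### The Mazur bound for positive combinations of the evolved current -/

section Mazur

variable {γ c : ℝ} {m : ℕ} {g : ℂ → ℝ}

/-- Cauchy-Schwarz between the Hermitian A = ∑ p_i τ_{s_i}(J) and B - B†. The limiting overlap of B
with A is imaginary, so passing to B - B† doubles it, while orthogonality only doubles the squared
norm. This gains a factor 2 over B alone: 4I²(∑ p_i)² ≤ 2I ∑ p_i p_j C(s_j - s_i). -/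
theorem mazur_bound (hg : IsChargeBound γ c m g) {l : ℕ} (hm : 2 ≤ m) (hγ : Real.sin γ ≠ 0)
    (hF : SolvesFredholm l m (weight c)) (hK : ∀ φ ∈ strip m, ∀ φ' ∈ strip m,
      Tendsto (fun n : ℕ => overlap γ n φ φ' / (n : ℂ)) atTop (𝓝 (kernel l m φ φ')))
    {C : ℝ → ℝ} (hC : ∀ s, Tendsto
      (fun n => currentOverlap (Real.cos γ) n (current n) 0 s) atTop (𝓝 (C s : ℂ)))
    (hpos : 0 < ∫ φ in strip m, weight c φ) {ι : Type*} (S : Finset ι) (p s : ι → ℝ) :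
    2 * (∫ φ in strip m, weight c φ) * (∑ i ∈ S, p i) ^ 2
      ≤ ∑ i ∈ S, ∑ j ∈ S, p i * p j * C (s j - s i) := by
  set I := ∫ φ in strip m, weight c φ with hIdef
  let A : ∀ n, ChainOp n := fun n =>
    ∑ i ∈ S, (p i : ℂ) • evolve (Real.cos γ) n (s i) (current n)
  let B : ∀ n, ChainOp n := weightedCharge γ c m
  have hA : ∀ n, (A n).conjTranspose = A n := fun n => by
    simp only [A, Matrix.conjTranspose_sum, Matrix.conjTranspose_smul, evolve_conjTranspose,
      current_conjTranspose]
    refine Finset.sum_congr rfl fun i _ => ?_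
    congr 1
    exact Complex.conj_ofReal _
  have hBA : Tendsto (fun n : ℕ => hsInner n (B n) (A n) / (n : ℂ)) atTop
      (𝓝 (∑ i ∈ S, (p i : ℂ) * (-Complex.I * (I : ℂ)))) := by
    have := tendsto_finsetSum S fun i _ =>
      (tendsto_hsInner_weightedCharge_evolve hg hm hγ (s i)).const_mul (p i : ℂ)
    refine this.congr fun n => ?_
    simp only [A, B, hsInner_sum_right, hsInner_smul_right, Finset.sum_div, mul_div_assoc]
  have hAA : Tendsto (fun n : ℕ => hsInner n (A n) (A n) / (n : ℂ)) atTop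
      (𝓝 (∑ i ∈ S, ∑ j ∈ S, (p i : ℂ) * ((p j : ℂ) * (C (s j - s i) : ℂ)))) := by
    have := tendsto_finsetSum S fun i _ => tendsto_finsetSum S fun j _ =>
      ((hC (s j - s i)).const_mul (p j : ℂ)).const_mul (p i : ℂ)
    refine this.congr fun n => ?_
    simp only [A, hsInner_sum_left, hsInner_smul_left, hsInner_sum_right, hsInner_smul_right,
      Finset.sum_div, Complex.conj_ofReal, hsInner_evolve_evolve, currentOverlap_eq,
      Finset.mul_sum, mul_div_assoc]
    rw [Finset.sum_comm]
    exact Finset.sum_congr rfl fun i _ => Finset.sum_congr rfl fun j _ => by ring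
  have hBB := tendsto_hsInner_weightedCharge_self hg hF hK
  have hGA : ∀ n, hsInner n (B n - (B n).conjTranspose) (A n)
      = hsInner n (B n) (A n) - starRingEnd ℂ (hsInner n (B n) (A n)) := fun n => by
    have h : hsInner n (B n).conjTranspose (A n) = hsInner n (A n) (B n) := by
      have := hsInner_conjTranspose (B n) (A n)
      rwa [hA] at this
    rw [hsInner_sub_left, h, hsInner_conj]
  have hGG : ∀ n, hsInner n (B n - (B n).conjTranspose) (B n - (B n).conjTranspose)
      = 2 * hsInner n (B n) (B n) := fun n => by
    have h1 := hsInner_weightedCharge_adjoint hg n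
    have h2 : hsInner n (B n) (B n).conjTranspose = 0 := by
      rw [← hsInner_conj]
      simp only [B, h1, map_zero]
    rw [hsInner_sub_left, hsInner_sub_right, hsInner_sub_right, hsInner_conjTranspose, h2]
    simp only [B, h1]
    ring
  have hCS : ∀ n : ℕ, ‖hsInner n (B n) (A n) / (n : ℂ)
        - starRingEnd ℂ (hsInner n (B n) (A n) / (n : ℂ))‖ ^ 2
      ≤ (2 * (hsInner n (B n) (B n) / (n : ℂ))).re * (hsInner n (A n) (A n) / (n : ℂ)).re := by
    intro n
    have h := norm_hsInner_sq_le (B n - (B n).conjTranspose) (A n)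
    rw [hGA, hGG] at h
    have e1 : ∀ z : ℂ, (z / (n : ℂ)).re = z.re / n := fun z => by
      rw [← Complex.ofReal_natCast, Complex.div_ofReal_re]
    rw [map_div₀, Complex.conj_natCast, ← sub_div, norm_div, Complex.norm_natCast, div_pow,
      ← mul_div_assoc, e1, e1, div_mul_div_comm, ← sq]
    exact div_le_div_of_nonneg_right h (by positivity)
  have hlim := le_of_tendsto_of_tendsto'
    ((hBA.sub ((Complex.continuous_conj.tendsto _).comp hBA)).norm.pow 2)
    (((Complex.continuous_re.tendsto _).comp (hBB.const_mul 2)).mul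
      ((Complex.continuous_re.tendsto _).comp hAA)) hCS
  have e1 : ∑ i ∈ S, (p i : ℂ) * (-Complex.I * (I : ℂ))
      = -Complex.I * ((I * ∑ i ∈ S, p i : ℝ) : ℂ) := by
    rw [← Finset.sum_mul]
    push_cast
    ring
  have e2 : (∑ i ∈ S, ∑ j ∈ S, (p i : ℂ) * ((p j : ℂ) * (C (s j - s i) : ℂ)))
      = ((∑ i ∈ S, ∑ j ∈ S, p i * p j * C (s j - s i) : ℝ) : ℂ) := by
    push_cast
    simp only [mul_assoc]
  have e3 : ∀ x : ℝ, ‖-Complex.I * (x : ℂ) - starRingEnd ℂ (-Complex.I * (x : ℂ))‖ ^ 2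
      = 4 * x ^ 2 := fun x => by
    have : -Complex.I * (x : ℂ) - starRingEnd ℂ (-Complex.I * (x : ℂ))
        = ((-2 * x : ℝ) : ℂ) * Complex.I := by
      simp only [map_mul, map_neg, Complex.conj_I, Complex.conj_ofReal]
      push_cast
      ring
    rw [this, norm_mul, Complex.norm_I, mul_one, Complex.norm_real, Real.norm_eq_abs, sq_abs]
    ring
  rw [e1, e2, e3] at hlim
  have e4 : ((2 : ℂ) * (I : ℂ)).re = 2 * I := by simp
  rw [e4, Complex.ofReal_re, mul_pow] at hlim
  have h5 : 2 * I * (2 * I * (∑ i ∈ S, p i) ^ 2)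
      ≤ 2 * I * ∑ i ∈ S, ∑ j ∈ S, p i * p j * C (s j - s i) := by
    linarith
  exact le_of_mul_le_mul_left h5 (by linarith)

end Mazur

end

end XXZ

namespace XXZ

noncomputable section

/-! ### Time averages of positive definite functions -/

section TimeAverage

variable {C : ℝ → ℝ} {κ M : ℝ}

/-- The bilinear form of a function of the difference, on finite combinations of points. -/
def diffForm (C : ℝ → ℝ) : (ℝ →₀ ℝ) →ₗ[ℝ] (ℝ →₀ ℝ) →ₗ[ℝ] ℝ :=
  Finsupp.linearCombination ℝ fun s => Finsupp.linearCombination ℝ fun t => C (t - s)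

theorem diffForm_apply (p q : ℝ →₀ ℝ) :
    diffForm C p q = ∑ s ∈ p.support, ∑ t ∈ q.support, p s * q t * C (t - s) := by
  rw [diffForm, Finsupp.linearCombination_apply, Finsupp.sum, LinearMap.sum_apply]
  refine Finset.sum_congr rfl fun s _ => ?_
  rw [LinearMap.smul_apply, Finsupp.linearCombination_apply, Finsupp.sum, Finset.smul_sum]
  refine Finset.sum_congr rfl fun t _ => ?_
  rw [smul_eq_mul, smul_eq_mul, mul_assoc]

theorem diffForm_comm (hC : ∀ s, C (-s) = C s) (p q : ℝ →₀ ℝ) :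
    diffForm C p q = diffForm C q p := by
  rw [diffForm_apply, diffForm_apply, Finset.sum_comm]
  refine Finset.sum_congr rfl fun s _ => Finset.sum_congr rfl fun t _ => ?_
  rw [← neg_sub, hC, mul_comm (p t)]

/-- The total mass. -/
def mass : (ℝ →₀ ℝ) →ₗ[ℝ] ℝ := Finsupp.linearCombination ℝ fun _ => 1

theorem mass_apply (p : ℝ →₀ ℝ) : mass p = ∑ s ∈ p.support, p s := by
  rw [mass, Finsupp.linearCombination_apply, Finsupp.sum]
  simp

theorem mass_single (u : ℝ) : mass (Finsupp.single u 1) = 1 := by simp [mass]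

theorem diffForm_single_single (u : ℝ) :
    diffForm C (Finsupp.single u 1) (Finsupp.single u 1) = C 0 := by
  simp [diffForm]

theorem diffForm_single (p : ℝ →₀ ℝ) (u : ℝ) :
    diffForm C p (Finsupp.single u 1) = ∑ s ∈ p.support, p s * C (u - s) := by
  rw [diffForm, Finsupp.linearCombination_apply, Finsupp.sum, LinearMap.sum_apply]
  simp

/-- The mean ergodic theorem in variational form: c₀ is the infimum of the form on combinations of
mass 1, and a near-minimizer is nearly orthogonal to every direction of mass zero. Its pairing with
any point mass is therefore close to c₀, uniformly in the point. -/
theorem exists_almost_invariant (hC : ∀ s, C (-s) = C s) (hκ : 0 ≤ κ)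
    (hpd : ∀ p : ℝ →₀ ℝ, κ * mass p ^ 2 ≤ diffForm C p p) :
    ∃ c₀, κ ≤ c₀ ∧ ∀ ε > 0, ∃ p : ℝ →₀ ℝ, mass p = 1 ∧
      ∀ u, |∑ s ∈ p.support, p s * C (u - s) - c₀| ≤ ε := by
  have hpos : ∀ p, 0 ≤ diffForm C p p := fun p => le_trans (by positivity) (hpd p)
  set V := {x | ∃ p, mass p = 1 ∧ diffForm C p p = x} with hV
  have hne : V.Nonempty := ⟨_, Finsupp.single 0 1, mass_single 0, rfl⟩
  have hbdd : BddBelow V := ⟨0, by rintro _ ⟨p, -, rfl⟩; exact hpos p⟩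
  have hle : ∀ p, mass p = 1 → sInf V ≤ diffForm C p p := fun p hp => csInf_le hbdd ⟨p, hp, rfl⟩
  have hκ' : κ ≤ sInf V := by
    refine le_csInf hne ?_
    rintro _ ⟨p, hp, rfl⟩
    simpa [hp] using hpd p
  refine ⟨sInf V, hκ', fun ε hε => ?_⟩
  set c₀ := sInf V
  have hc₀ : 0 ≤ c₀ := hκ.trans hκ'
  have hC0 : 0 ≤ C 0 := by simpa [diffForm_single_single] using hpos (Finsupp.single 0 1)
  -- K bounds the form on the difference of a point mass and a near-minimizer, by the parallelogram
  -- identity.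
  set K := 2 * C 0 + 2 * (c₀ + 1) with hK
  have hK0 : 0 < K := by linarith
  obtain ⟨δ, hδ0, hδ1, hδε, hδK⟩ : ∃ δ : ℝ, 0 < δ ∧ δ ≤ 1 ∧ δ ≤ ε / 2 ∧ δ * K ≤ (ε / 2) ^ 2 := by
    refine ⟨min 1 (min (ε / 2) ((ε / 2) ^ 2 / K)), ?_, min_le_left _ _,
      (min_le_right _ _).trans (min_le_left _ _), ?_⟩
    · exact lt_min one_pos (lt_min (by positivity) (by positivity))
    · rw [← le_div_iff₀ hK0]
      exact (min_le_right _ _).trans (min_le_right _ _)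
  obtain ⟨_, ⟨p, hp, rfl⟩, hp2⟩ := exists_lt_of_csInf_lt hne (lt_add_of_pos_right c₀ hδ0)
  refine ⟨p, hp, fun u => ?_⟩
  rw [← diffForm_single]
  set x : ℝ →₀ ℝ := Finsupp.single u 1 with hx
  set d := x - p with hd
  have hmd : mass d = 0 := by rw [hd, map_sub, hx, mass_single, hp, sub_self]
  have hsym := diffForm_comm hC d p
  -- Moving along d keeps the mass equal to 1, so the form stays at least c₀ while at p it is below
  -- c₀ + δ. The discriminant then bounds the pairing of p with d by √(δK).
  have hline : ∀ y : ℝ, 0 ≤ diffForm C d d * (y * y) + 2 * diffForm C p d * y + δ := by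
    intro y
    have h1 := hle (p + y • d) (by rw [map_add, map_smul, hmd, hp]; simp)
    simp only [map_add, map_smul, LinearMap.add_apply, LinearMap.smul_apply, smul_eq_mul,
      hsym] at h1
    nlinarith
  have hdisc := discrim_le_zero hline
  rw [discrim] at hdisc
  have hdd : diffForm C d d ≤ K := by
    have h1 := hpos (x + p)
    have h2 : diffForm C d d = 2 * diffForm C x x + 2 * diffForm C p p
        - diffForm C (x + p) (x + p) := by
      simp only [hd, map_add, map_sub, LinearMap.add_apply, LinearMap.sub_apply]
      ring
    have h3 : diffForm C x x = C 0 := diffForm_single_single u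
    rw [h2, h3]
    linarith
  have hpdle : |diffForm C p d| ≤ ε / 2 := by
    refine abs_le_of_sq_le_sq ?_ (by positivity)
    nlinarith [mul_le_mul_of_nonneg_left hdd hδ0.le]
  have e : diffForm C p x = diffForm C p d + diffForm C p p := by
    rw [hd, map_sub]; ring
  have h4 := hle p hp
  rw [e]
  rw [abs_le] at hpdle ⊢
  constructor <;> linarith

theorem abs_integral_shift_sub_le (hcont : Continuous C) (hM : ∀ s, |C s| ≤ M) (s t : ℝ) :
    |(∫ u in (0 : ℝ)..t, C (u - s)) - ∫ u in (0 : ℝ)..t, C u| ≤ 2 * M * |s| := by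
  rw [intervalIntegral.integral_comp_sub_right]
  have hi : ∀ a b, IntervalIntegrable C volume a b := fun a b => hcont.intervalIntegrable a b
  rw [intervalIntegral.integral_interval_sub_interval_comm (hi _ _) (hi _ _) (hi _ _)]
  have h1 := intervalIntegral.norm_integral_le_of_norm_le_const (a := 0 - s) (b := 0) (f := C)
    (C := M) fun x _ => hM x
  have h2 := intervalIntegral.norm_integral_le_of_norm_le_const (a := t - s) (b := t) (f := C)
    (C := M) fun x _ => hM x
  rw [Real.norm_eq_abs] at h1 h2
  rw [show (0 : ℝ) - (0 - s) = s by ring] at h1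
  rw [show t - (t - s) = s by ring] at h2
  have := abs_sub (∫ u in (0 - s)..0, C u) (∫ u in (t - s)..t, C u)
  linarith

/-- The time average of a bounded, even, positive definite function converges. -/
theorem exists_tendsto_average (hcont : Continuous C) (hM : ∀ s, |C s| ≤ M)
    (hC : ∀ s, C (-s) = C s) (hκ : 0 ≤ κ)
    (hpd : ∀ p : ℝ →₀ ℝ, κ * mass p ^ 2 ≤ diffForm C p p) :
    ∃ c₀, κ ≤ c₀ ∧ Tendsto (fun t : ℝ => 1 / t * ∫ u in (0 : ℝ)..t, C u) atTop (𝓝 c₀) := by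
  obtain ⟨c₀, hc₀, h⟩ := exists_almost_invariant hC hκ hpd
  refine ⟨c₀, hc₀, ?_⟩
  rw [Metric.tendsto_atTop]
  intro ε hε
  obtain ⟨p, hp, hpu⟩ := h (ε / 2) (by positivity)
  -- K bounds the total error of replacing the shifted integrals by the unshifted one. It does not
  -- depend on t and disappears after division by t.
  set K := ∑ s ∈ p.support, |p s| * (2 * M * |s|) with hK
  have hM0 : 0 ≤ M := (abs_nonneg _).trans (hM 0)
  have hK0 : 0 ≤ K := Finset.sum_nonneg fun s _ => by positivity
  refine ⟨2 * K / ε + 1, fun t ht => ?_⟩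
  have ht0 : 0 < t := lt_of_lt_of_le (by positivity) ht
  have hKt : K / t < ε / 2 := by
    rw [div_lt_div_iff₀ ht0 two_pos]
    have : 2 * K / ε < t := by linarith
    rw [div_lt_iff₀ hε] at this
    linarith
  have hci : ∀ s, IntervalIntegrable (fun u => C (u - s)) volume 0 t := fun s =>
    (hcont.comp (continuous_id.sub continuous_const)).intervalIntegrable _ _
  have e1 : ∫ u in (0 : ℝ)..t, ∑ s ∈ p.support, p s * C (u - s)
      = ∑ s ∈ p.support, p s * ∫ u in (0 : ℝ)..t, C (u - s) := by
    rw [intervalIntegral.integral_finsetSum fun s _ => (hci s).const_mul _]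
    simp
  have h1 : |(∫ u in (0 : ℝ)..t, ∑ s ∈ p.support, p s * C (u - s)) - t * c₀| ≤ ε / 2 * t := by
    have h2 : ∫ u in (0 : ℝ)..t, (∑ s ∈ p.support, p s * C (u - s) - c₀)
        = (∫ u in (0 : ℝ)..t, ∑ s ∈ p.support, p s * C (u - s)) - t * c₀ := by
      rw [intervalIntegral.integral_sub _ intervalIntegrable_const]
      · simp
      · exact (continuous_finsetSum _ fun s _ => continuous_const.mul
          (hcont.comp (continuous_id.sub continuous_const))).intervalIntegrable _ _
    rw [← h2]
    have := intervalIntegral.norm_integral_le_of_norm_le_const (a := 0) (b := t)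
      (f := fun u => ∑ s ∈ p.support, p s * C (u - s) - c₀) (C := ε / 2) fun x _ => hpu x
    rwa [sub_zero, abs_of_pos ht0] at this
  have h2 : |(∫ u in (0 : ℝ)..t, ∑ s ∈ p.support, p s * C (u - s)) - ∫ u in (0 : ℝ)..t, C u|
      ≤ K := by
    have e2 : (∫ u in (0 : ℝ)..t, C u) = ∑ s ∈ p.support, p s * ∫ u in (0 : ℝ)..t, C u := by
      rw [← Finset.sum_mul, ← mass_apply, hp, one_mul]
    rw [e1, e2, ← Finset.sum_sub_distrib]
    refine (Finset.abs_sum_le_sum_abs _ _).trans (Finset.sum_le_sum fun s _ => ?_)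
    rw [← mul_sub, abs_mul]
    exact mul_le_mul_of_nonneg_left (abs_integral_shift_sub_le hcont hM s t) (abs_nonneg _)
  rw [Real.dist_eq]
  have e3 : 1 / t * (∫ u in (0 : ℝ)..t, C u) - c₀
      = ((∫ u in (0 : ℝ)..t, C u) - t * c₀) / t := by field_simp
  rw [e3, abs_div, abs_of_pos ht0, div_lt_iff₀ ht0]
  rw [div_lt_iff₀ ht0] at hKt
  rw [abs_le] at h1 h2
  rw [abs_lt]
  constructor <;> linarith

end TimeAverage

end

end XXZ

namespace XXZ

noncomputable section

/-! ### The high-temperature limit of the thermal Drude weight -/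

section Thermal

open scoped Matrix.Norms.Operator

variable {Δ : ℝ} {n : ℕ}

theorem continuous_evolve (A : ChainOp n) : Continuous fun s : ℝ => evolve Δ n s A := by
  have h : Continuous fun s : ℝ => (Complex.I * (s : ℂ)) • hamiltonian Δ n := by fun_prop
  exact ((NormedSpace.exp_continuous.comp h).mul continuous_const).mul
    (NormedSpace.exp_continuous.comp h.neg)

theorem continuous_boltzmann (Δ : ℝ) (n : ℕ) :
    Continuous fun β : ℝ => NormedSpace.exp (-((β : ℂ) • hamiltonian Δ n)) := by
  have h : Continuous fun β : ℝ => -((β : ℂ) • hamiltonian Δ n) := by fun_prop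
  exact NormedSpace.exp_continuous.comp h

theorem gibbs_zero (A : ChainOp n) : gibbs Δ 0 n A = tracial n A := by
  simp [gibbs, tracial, NormedSpace.exp_zero, Matrix.trace_one]

/-- In matrix elements the time integral involves A only, so β enters through finitely many
continuous scalars and a denominator that is nonzero at β = 0. -/
theorem continuousAt_integral_gibbs {A : ℝ → ChainOp n} (hA : Continuous A) (a b : ℝ) :
    ContinuousAt (fun β : ℝ => ∫ s in a..b, gibbs Δ β n (A s)) 0 := by
  have hE := continuous_boltzmann Δ n
  set E : ℝ → ChainOp n := fun β => NormedSpace.exp (-((β : ℂ) • hamiltonian Δ n)) with hEdef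
  have hci : ∀ σ τ, Continuous fun s => A s σ τ := fun σ τ => hA.matrix_elem σ τ
  have e : (fun β : ℝ => ∫ s in a..b, gibbs Δ β n (A s)) = fun β =>
      (∑ σ, ∑ τ, (∫ s in a..b, A s σ τ) * E β τ σ) / (E β).trace := by
    ext β
    have e1 : ∀ s, gibbs Δ β n (A s) = (∑ σ, ∑ τ, A s σ τ * E β τ σ) / (E β).trace := fun s => rfl
    simp only [e1]
    rw [intervalIntegral.integral_div, intervalIntegral.integral_finsetSum]
    · congr 1
      refine Finset.sum_congr rfl fun σ _ => ?_
      rw [intervalIntegral.integral_finsetSum]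
      · exact Finset.sum_congr rfl fun τ _ => intervalIntegral.integral_mul_const _ _
      · exact fun τ _ => ((hci σ τ).mul continuous_const).intervalIntegrable _ _
    · exact fun σ _ => (continuous_finsetSum _ fun τ _ =>
        (hci σ τ).mul continuous_const).intervalIntegrable _ _
  rw [e]
  refine ContinuousAt.div ?_ hE.matrix_trace.continuousAt ?_
  · exact (continuous_finsetSum _ fun σ _ => continuous_finsetSum _ fun τ _ =>
      continuous_const.mul (hE.matrix_elem τ σ)).continuousAt
  · simp [hEdef, NormedSpace.exp_zero, Matrix.trace_one]

theorem tendsto_thermalDrude (Δ t : ℝ) (n : ℕ) :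
    Tendsto (fun β : ℝ => thermalDrude Δ β t n / (β : ℂ)) (𝓝[>] 0)
      (𝓝 (((1 / (4 * t) : ℝ) : ℂ) *
        ∫ s in (-t)..t, currentOverlap Δ n (current n) 0 s)) := by
  have h := (continuousAt_integral_gibbs (Δ := Δ) (A := fun s => current n *
    evolve Δ n s (current n)) (continuous_const.mul (continuous_evolve _)) (-t) t).tendsto
  have h2 := (h.mono_left (nhdsWithin_le_nhds (s := Set.Ioi 0))).const_mul
    ((1 / (4 * n * t) : ℝ) : ℂ)
  have e : ((1 / (4 * n * t) : ℝ) : ℂ) *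
      (∫ s in (-t)..t, gibbs Δ 0 n (current n * evolve Δ n s (current n)))
      = ((1 / (4 * t) : ℝ) : ℂ) * ∫ s in (-t)..t, currentOverlap Δ n (current n) 0 s := by
    simp only [gibbs_zero, tracial_current_mul, currentOverlap, pow_zero, Module.End.one_apply]
    rw [intervalIntegral.integral_div]
    push_cast
    ring
  rw [e] at h2
  refine h2.congr' ?_
  filter_upwards [self_mem_nhdsWithin] with β hβ
  have hβ' : (β : ℂ) ≠ 0 := by exact_mod_cast (Set.mem_Ioi.mp hβ).ne'
  rw [thermalDrude, div_eq_mul_one_div (β : ℝ)]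
  push_cast
  field_simp

end Thermal

/-! ### The Drude weight as a time average, and positivity of the bound. -/

section Rate

variable {Δ D : ℝ} {C : ℝ → ℝ}

theorem abs_correlation_le (hΔ : |Δ| ≤ 1) (hC : ∀ s, Tendsto
    (fun n => currentOverlap Δ n (current n) 0 s) atTop (𝓝 (C s : ℂ))) (s : ℝ) : |C s| ≤ 256 := by
  have h := le_of_tendsto' (hC s).norm fun n => (isTaylorFamily_current hΔ n).bound 0 s
  rw [Complex.norm_real, Real.norm_eq_abs] at h
  norm_num at h
  exact h

theorem integral_symm_of_even (hcont : Continuous C) (hC : ∀ s, C (-s) = C s) (t : ℝ) :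
    ∫ s in (-t)..t, C s = 2 * ∫ s in (0 : ℝ)..t, C s := by
  rw [← intervalIntegral.integral_add_adjacent_intervals (b := 0)
    (hcont.intervalIntegrable _ _) (hcont.intervalIntegrable _ _), two_mul]
  congr 1
  have := intervalIntegral.integral_comp_neg (a := 0) (b := t) C
  rw [neg_zero] at this
  rw [← this]
  simp only [hC]

/-- The limit n → ∞ passes under the time integral by the uniform bound 256 = 16 · 16. Evenness
identifies the symmetric average over [-t, t] with the one-sided average. -/
theorem isThermalDrudeRate (hΔ : |Δ| ≤ 1) (hcont : Continuous C) (heven : ∀ s, C (-s) = C s)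
    (hC : ∀ s, Tendsto (fun n => currentOverlap Δ n (current n) 0 s) atTop (𝓝 (C s : ℂ)))
    (hD : Tendsto (fun t : ℝ => 1 / (2 * t) * ∫ s in (0 : ℝ)..t, C s) atTop (𝓝 D)) :
    IsThermalDrudeRate Δ D := by
  refine ⟨fun t n => ((1 / (4 * t) : ℝ) : ℂ) *
      ∫ s in (-t)..t, currentOverlap Δ n (current n) 0 s,
    fun t => ((1 / (4 * t) : ℝ) : ℂ) * ∫ s in (-t)..t, (C s : ℂ),
    fun t _ n => tendsto_thermalDrude Δ t n, fun t _ => ?_, ?_⟩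
  · refine Tendsto.const_mul _ ?_
    refine intervalIntegral.tendsto_integral_filter_of_dominated_convergence (fun _ => 256)
      (Eventually.of_forall fun n =>
        (isTaylorFamily_current hΔ n).continuous.aestronglyMeasurable)
      (Eventually.of_forall fun n => Eventually.of_forall fun s _ => ?_)
      intervalIntegrable_const (Eventually.of_forall fun s _ => hC s)
    have := (isTaylorFamily_current hΔ n).bound 0 s
    norm_num at this
    exact this
  · have h := (Complex.continuous_ofReal.tendsto D).comp hD
    refine h.congr fun t => ?_
    rw [Function.comp_apply, intervalIntegral.integral_ofReal, ← Complex.ofReal_mul,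
      integral_symm_of_even hcont heven]
    congr 1
    ring

/-- From sin x < x at x = 2π/m. Strict positivity is needed to divide by ∫ f in `mazur_bound`. -/
theorem drudeBound_pos {l m : ℕ} (hm : 2 ≤ m) (hl : Real.sin (Real.pi * l / m) ≠ 0) :
    0 < drudeBound l m := by
  have hm0 : (0 : ℝ) < m := by exact_mod_cast (by omega : 0 < m)
  have hpi := Real.pi_pos
  have hs := sin_pi_div_pos hm
  have h := Real.sin_lt (x := 2 * Real.pi / m) (by positivity)
  have h2 : m / (2 * Real.pi) * Real.sin (2 * Real.pi / m) < 1 := by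
    calc _ < m / (2 * Real.pi) * (2 * Real.pi / m) := by gcongr
      _ = 1 := by field_simp
  have h3 : 0 < 1 - m / (2 * Real.pi) * Real.sin (2 * Real.pi / m) := sub_pos.mpr h2
  rw [drudeBound]
  positivity

end Rate

end

end XXZ

theorem mainTheorem9 (l m : ℕ) (hm : 2 ≤ m) (hlm : Nat.Coprime l m) (γ Δ : ℝ)
    (hγ : γ = Real.pi * l / m) (hΔ : Δ = Real.cos γ) :
    -- overlaps of the charges with the current, and the kernel as rate of growth of their
    -- mutual overlaps
    (∀ φ ∈ XXZ.strip m, ∀ n : ℕ, 1 ≤ n →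
      XXZ.hsInner n (XXZ.current n) (XXZ.charge γ n φ) = Complex.I * ((n : ℂ) - 1)) ∧
    (∀ φ ∈ XXZ.strip m, ∀ φ' ∈ XXZ.strip m,
      Tendsto (fun n : ℕ => XXZ.overlap γ n φ φ' / (n : ℂ)) atTop
        (𝓝 (XXZ.kernel l m φ φ'))) ∧
    -- the Fredholm equation, the integral form of the bound, and its closed form
    (∃ c : ℝ, 0 < c ∧ XXZ.SolvesFredholm l m (XXZ.weight c) ∧
      IntegrableOn (XXZ.weight c) (XXZ.strip m) ∧
      (1 / 4 : ℝ) * ∫ φ in XXZ.strip m, XXZ.weight c φ = XXZ.drudeBound l m) ∧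
    -- the high-temperature Drude weight exists and obeys the bound
    (∃ (C : ℝ → ℝ) (D : ℝ), XXZ.IsCurrentCorrelation Δ C ∧
      Tendsto (fun t : ℝ => 1 / (2 * t) * ∫ s in (0 : ℝ)..t, C s) atTop (𝓝 D) ∧
      XXZ.IsThermalDrudeRate Δ D ∧
      4 * XXZ.drudeBound l m ≤ D ∧ XXZ.drudeBound l m / 4 ≤ D) := by
  have hγm := XXZ.sin_mul_eq_zero l hm hγ
  have hsin : Real.sin γ ≠ 0 := by
    simpa using XXZ.sin_mul_ne_zero l hlm hγ one_pos (by omega)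
  have hl : Real.sin (Real.pi * l / m) ≠ 0 := hγ ▸ hsin
  obtain ⟨κ, hκ0, hκ⟩ := XXZ.exists_sinSq_lower l hm hlm hγ
  have hK := fun φ (hφ : φ ∈ XXZ.strip m) φ' (hφ' : φ' ∈ XXZ.strip m) =>
    XXZ.tendsto_overlap_div l hm hγ hsin hγm hκ0 hκ hφ hφ'
  have hF := XXZ.solvesFredholm hm hl
  have hc := XXZ.weightConst_pos hm hl
  have hI := XXZ.integral_weight l hm
  have hpos := XXZ.drudeBound_pos hm hl
  refine ⟨fun φ _ n hn => XXZ.hsInner_current_charge γ φ n hn, hK,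
    ⟨_, hc, hF, XXZ.integrableOn_weight hm _, hI⟩, ?_⟩
  subst hΔ
  have hΔ1 := Real.abs_cos_le_one γ
  obtain ⟨C, hC, heven, hlim⟩ := XXZ.exists_correlation hΔ1
  have hg : XXZ.IsChargeBound γ (XXZ.weightConst l m) m (XXZ.normBound κ m) :=
    ⟨hc.le, XXZ.normBound_nonneg, fun φ hφ n => XXZ.hsNorm_charge_le hm hsin hγm hκ0 hκ hφ n,
      XXZ.integrableOn_weight_mul_normBound hm hκ0 hc⟩
  set I := ∫ φ in XXZ.strip m, XXZ.weight (XXZ.weightConst l m) φ with hIdef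
  have hI0 : 0 < I := by linarith
  -- The average c₀ of C is at least 2I, and the Drude weight is c₀/2, hence at least I = 4 D_K.
  obtain ⟨c₀, hle, hc₀⟩ := XXZ.exists_tendsto_average hC.1 (XXZ.abs_correlation_le hΔ1 hlim) heven
    (κ := 2 * I) (by positivity) fun p => by
      rw [XXZ.diffForm_apply, XXZ.mass_apply]
      exact XXZ.mazur_bound hg hm hsin hF hK hlim hI0 p.support p id
  have hD : Tendsto (fun t : ℝ => 1 / (2 * t) * ∫ s in (0 : ℝ)..t, C s) atTop (𝓝 (c₀ / 2)) := by
    refine (hc₀.div_const 2).congr fun t => ?_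
    rw [one_div_mul_eq_div, one_div_mul_eq_div, div_div, mul_comm]
  refine ⟨C, c₀ / 2, hC, hD, XXZ.isThermalDrudeRate hΔ1 hC.1 heven hlim hD, ?_, ?_⟩ <;> linarith
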